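/- **Setting.** Let $N=[n]$ be a set of $n\ge 1$ agents, $M$ a finite set of indivisible goods, and let each agent $i$ have a valuation $v_i:2^M\to\mathbb{R}_{\ge 0}$. A valuation $v$ is *monotone* if $S\subseteq T$ implies $v(S)\le v(T)$; it is *additive* if $v(S)=\sum_{g\in S}v(\{g\})$ for all $S$; it is *restricted-MMS-feasible* if for every $S\subseteq M$, every $k\ge 1$ and any two partitions $(X_1,\dots,X_k)$, $(Z_1,\dots,Z_k)$ of $S$ (parts may be empty), $\max_\ell v(X_\ell)\ge\min_\ell v(Z_\ell)$. Let $\mathbf X=(X_1,\dots,X_k)$ be a partition of $M$. $X_\ell$ is *EFX-feasible* for $i$ in $\mathbf X$ if $v_i(X_\ell)\ge v_i(X_z\setminus g)$ for all $z\ne\ell$ and all $g\in X_z$. $X_\ell$ is *MXS-feasible* for $i$ in $\mathbf X$ if there is a partition $(Y_1,\dots,Y_k)$ of $M$ into the same number of bundles such that $Y_\ell$ is EFX-feasible for $i$ in it and $v_i(X_\ell)\ge v_i(Y_\ell)$. $X_\ell$ is *EFL-feasible* for $i$ in $\mathbf X$ if for every $z$ either $|X_z|\le 1$ or some $g\in X_z$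 satisfies $v_i(X_\ell)\ge v_i(X_z\setminus g)$ and $v_i(X_\ell)\ge v_i(\{g\})$. An *association function* $f$ assigns to each index $\ell$ an agent $f(\ell)\in[n]$ or $0$ (the bundle is *free*), no agent being assigned to two indices; agents not in its image are free. It is *full* if no bundle is free. A *full fair association* for $\mathbf X$ is a full association function such that every $X_\ell$ is MXS-feasible and EFL-feasible for $f(\ell)$ in $\mathbf X$. An *MXS and EFL allocation* is a partition of $M$ into $n$ bundles together with a full association function such that each agent's bundle is MXS-feasible and EFL-feasible for that agent. The *envy graph* $G(\mathbf X,f)$ has the bundles as vertices and an edge $X_\ell\to X_z$ whenever $f(\ell)\ne0$ and $v_{f(\ell)}(X_\ell)<v_{f(\ell)}(X_z)$. A *chain* to $X_z$ is a simple (possibly one-vertex) path in $G(\mathbf X,f)$ that ends in $X_z$ and whose first vertex has in-degree $0$. *Shifting* $f$ along a path $X_{q_s}\to\dots\to X_{q_0}$ means $f(q_\ell)\gets f(q_{\ell+1})$ for $\ell=0,\dots,s-1$ and then $f(q_s)\gets 0$. *EliminateCycles* repeats, as long as $G(\mathbf X,f)$ has a cycle, the rotation of $f$ along some cycle (each agent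 on the cycle gets the bundle that the next edge points to). $X_z$ is *EFX-best* for $i$ in $\mathbf X$ if for all $\ell\ne z$ either $X_\ell=\emptyset$ or $\max_{g\in X_z}v_i(X_z\setminus g)\ge\max_{g\in X_\ell}v_i(X_\ell\setminus g)$. $\mathrm{FindMins}(S,i,j)$, for $S\neq\emptyset$, is a subroutine returning $x^i\in\arg\max_{g\in S}v_i(S\setminus g)$ and $x^j\in\arg\max_{g\in S}v_j(S\setminus g)$, with $x^i=x^j$ whenever the two sets meet; its tie-breaking is arbitrary but fixed (equal inputs give equal outputs). $\mathrm{NextBest}_j$ of three bundles is the second one when they are ordered by decreasing value for $j$, ties going to the bundle with more goods and remaining ties being broken arbitrarily. **Algorithm MXS+EFL.** Start with $\mathbf X=(M)$, $f(1)=1$. For $k=2,\dots,n$: run EliminateCycles, append an empty free bundle $X_k$, and replace $(\mathbf X,f)$ by the result of *ReBalance*$(\mathbf X,f)$. Finally return $(\mathbf X,f)$. **ReBalance**$(\mathbf X,f)$, with $k$ bundles. *Phase 1.* Repeat: if $\mathbf X$ has a full fair association, return $\mathbf X$ with one. Choose a free agent $i$ and $p$ with $X_p$ EFX-best for $i$;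 let $j=f(p)$. If $X_p$ is not EFX-best for $j$, set $f(p)\gets i$ and repeat. Let $(x^i,x^j)=\mathrm{FindMins}(X_p,i,j)$ and let $c$ be any chain to $X_k$, with first bundle $X_q$. If $v_u(X_q\cup x^u)\le v_u(X_p\setminus x^u)$ for some $u\in\{i,j\}$, then for such a $u$ move $x^u$ from $X_p$ to $X_q$, set $f(p)\gets u$, run EliminateCycles and repeat. Otherwise leave Phase 1. *Transition.* Shift $f$ along $c$, set $f(p)\gets0$, and let $R=X_p\setminus x^j$. *Phase 2.* Repeat: run EliminateCycles; let $c$ be any chain to $X_q$, with first bundle $X_r$; let $(x^i,x^j)=\mathrm{FindMins}(X_p,i,j)$. Let $\mathbf X'$ (resp. $\mathbf X''$) be $\mathbf X$ with $x^j$ (resp. $x^i$) moved from $X_p$ to $X_r$. If $\mathbf X'$ has a full fair association, return $\mathbf X'$ with one; otherwise, if $\mathbf X''$ has one, return $\mathbf X''$ with one. Otherwise set $R\gets\mathrm{NextBest}_j(R,X'_p,X'_r)$. If $v_j(X'_r)>v_j(X'_p)$, shift $f$ along $c$ and set $q\gets p$, then $p\gets r$; else if $v_i(X'_r)\ge v_i(X_q)$,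 shift $f$ along $c$ and set $q\gets r$. Finally set $\mathbf X\gets\mathbf X'$. **Theorem.** Suppose that all $v_i$ are monotone and restricted-MMS-feasible. Then, for every implementation of FindMins and however all other choices are made, Algorithm MXS+EFL terminates after finitely many steps, never reaches an undefined instruction, and returns an MXS and EFL allocation. In particular, an MXS and EFL allocation exists. Additive valuations are monotone and restricted-MMS-feasible; hence an MXS and EFL allocation exists whenever all valuations are additive. -/

import Mathlib

open scoped NNReal

namespace FairDivision

/-! Goods form a finite type `G`; a bundle is a `Finset G`; a valuation is a function
`Finset G → ℝ≥0`; the agents are the elements of `Fin n`. A family of `k` bundles is a function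
`Fin k → Finset G`. -/

section Notions

variable {G : Type*} [DecidableEq G]

/-- `X` is a partition of `S` into `k` (possibly empty) bundles. -/
def IsPartition {k : ℕ} (S : Finset G) (X : Fin k → Finset G) : Prop :=
  (∀ ℓ z, ℓ ≠ z → Disjoint (X ℓ) (X z)) ∧ Finset.univ.biUnion X = S

/-- For every bundle `S`, every number `k + 1 ≥ 1` of parts and any two partitions `X`, `Z` of `S`
into that many parts, `max (v (X ℓ)) ≥ min (v (Z ℓ))`. -/
def RestrictedMMSFeasible (v : Finset G → ℝ≥0) : Prop :=
  ∀ (S : Finset G) (k : ℕ) (X Z : Fin (k + 1) → Finset G), IsPartition S X → IsPartition S Z →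
    Finset.univ.inf' Finset.univ_nonempty (fun ℓ => v (Z ℓ)) ≤
      Finset.univ.sup' Finset.univ_nonempty (fun ℓ => v (X ℓ))

/-- The value of a bundle is the sum of the values of its goods. -/
def IsAdditive (v : Finset G → ℝ≥0) : Prop :=
  ∀ S, v S = ∑ g ∈ S, v {g}

/-- With valuation `v`, the bundle `T` is EFX-envied relative to `S`. -/
def EFXEnvies (v : Finset G → ℝ≥0) (S T : Finset G) : Prop :=
  ∃ g ∈ T, v S < v (T.erase g)

/-- With valuation `v`, the bundle `T` is EFL-envied relative to `S`. -/
def EFLEnvies (v : Finset G → ℝ≥0) (S T : Finset G) : Prop :=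
  1 < T.card ∧ ∀ g ∈ T, v S < v (T.erase g) ∨ v S < v {g}

/-- The bundle `X ℓ` is EFX-feasible in `X`. -/
def EFXFeasible {k : ℕ} (v : Finset G → ℝ≥0) (X : Fin k → Finset G) (ℓ : Fin k) : Prop :=
  ∀ z, z ≠ ℓ → ¬ EFXEnvies v (X ℓ) (X z)

/-- The bundle `X ℓ` is EFL-feasible in `X`. -/
def EFLFeasible {k : ℕ} (v : Finset G → ℝ≥0) (X : Fin k → Finset G) (ℓ : Fin k) : Prop :=
  ∀ z, ¬ EFLEnvies v (X ℓ) (X z)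

/-- The bundle `X ℓ` of the family `X` of `k` bundles is `k`-MXS-feasible. -/
def MXSFeasible [Fintype G] {k : ℕ} (v : Finset G → ℝ≥0) (X : Fin k → Finset G) (ℓ : Fin k) :
    Prop :=
  ∃ Y : Fin k → Finset G, IsPartition Finset.univ Y ∧ EFXFeasible v Y ℓ ∧ v (Y ℓ) ≤ v (X ℓ)

/-- The goods of `S` whose removal leaves the largest value: `argmax_{g ∈ S} v (S \ g)`. -/
def minGoods (v : Finset G → ℝ≥0) (S : Finset G) : Set G :=
  {g | g ∈ S ∧ ∀ h ∈ S, v (S.erase h) ≤ v (S.erase g)}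

/-- The bundle `X z` is EFX-best in `X`. -/
def EFXBest {k : ℕ} (v : Finset G → ℝ≥0) (X : Fin k → Finset G) (z : Fin k) : Prop :=
  ∀ ℓ, ℓ ≠ z → X ℓ = ∅ ∨
    ∃ g ∈ minGoods v (X z), ∃ h ∈ minGoods v (X ℓ), v ((X ℓ).erase h) ≤ v ((X z).erase g)

/-- `S` is ranked weakly above `T`: larger value first, ties in favour of more goods. -/
def RanksAbove (v : Finset G → ℝ≥0) (S T : Finset G) : Prop :=
  v T < v S ∨ (v T = v S ∧ T.card ≤ S.card)

/-- `S` is an admissible value of `NextBest` on the list `Y` of bundles: it comes second in some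
ordering of `Y` that agrees with the ranking (remaining ties are broken arbitrarily). -/
def IsNextBest (v : Finset G → ℝ≥0) (Y : List (Finset G)) (S : Finset G) : Prop :=
  ∃ (T : Finset G) (L : List (Finset G)),
    (T :: S :: L).Perm Y ∧ (T :: S :: L).Pairwise (RanksAbove v)

/-- Remove the good `x` from the bundle `X p`, then add it to the bundle with index `q`. -/
def moveGood {k : ℕ} (X : Fin k → Finset G) (p q : Fin k) (x : G) : Fin k → Finset G :=
  let X₁ := Function.update X p ((X p).erase x)
  Function.update X₁ q (insert x (X₁ q))

end Notions

section Associations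

variable {G : Type*} {n k : ℕ}

/-- `f` associates each bundle with at most one agent (`none`: the bundle is free), and no agent
with two bundles. -/
def IsAssociation (f : Fin k → Option (Fin n)) : Prop :=
  ∀ ℓ z, ℓ ≠ z → f ℓ ≠ f z ∨ (f ℓ = none ∧ f z = none)

/-- Every bundle is associated with an agent. -/
def IsFull (f : Fin k → Option (Fin n)) : Prop :=
  ∀ ℓ, f ℓ ≠ none

/-- `f` is a full MXS+EFL association function for `X`. -/
def FullFairAssociation [Fintype G] [DecidableEq G] (v : Fin n → Finset G → ℝ≥0)
    (X : Fin k → Finset G) (f : Fin k → Option (Fin n)) : Prop :=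
  IsAssociation f ∧ IsFull f ∧
    ∀ ℓ i, f ℓ = some i → MXSFeasible (v i) X ℓ ∧ EFLFeasible (v i) X ℓ

/-- `X` has a full MXS+EFL association function. -/
def HasFairAssociation [Fintype G] [DecidableEq G] (v : Fin n → Finset G → ℝ≥0)
    (X : Fin k → Finset G) : Prop :=
  ∃ f, FullFairAssociation v X f

/-- `(X, f)` is a complete allocation of the goods to the `n` agents (a partition of all goods into
`n` bundles, each bundle associated with one agent, different bundles with different agents) that
is MXS and EFL for every agent. -/
def IsMXSEFLAllocation [Fintype G] [DecidableEq G] (v : Fin n → Finset G → ℝ≥0)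
    (X : Fin n → Finset G) (f : Fin n → Option (Fin n)) : Prop :=
  IsPartition Finset.univ X ∧ IsAssociation f ∧ IsFull f ∧
    ∀ i, ∃ ℓ, f ℓ = some i ∧ MXSFeasible (v i) X ℓ ∧ EFLFeasible (v i) X ℓ

/-- The generalized envy graph: there is an edge from bundle `a` to bundle `b` if `a` is associated
with an agent who strictly prefers `X b` to `X a`. -/
def Edge (v : Fin n → Finset G → ℝ≥0) (X : Fin k → Finset G) (f : Fin k → Option (Fin n))
    (a b : Fin k) : Prop :=
  ∃ i, f a = some i ∧ v i (X a) < v i (X b)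

/-- `c = [q₁, …, qₛ]` is a (simple) cycle `q_s → q_{s-1} → … → q₁ → q_s` of the envy graph, with
`a = q₁`. Paths and cycles are listed against the direction of the edges. -/
def IsCycle (v : Fin n → Finset G → ℝ≥0) (X : Fin k → Finset G) (f : Fin k → Option (Fin n))
    (a : Fin k) (c : List (Fin k)) : Prop :=
  c.head? = some a ∧ c.Nodup ∧ c.IsChain (fun y z => Edge v X f z y) ∧
    ∃ b, c.getLast? = some b ∧ Edge v X f a b

/-- The envy graph has no cycle. -/
def NoCycle (v : Fin n → Finset G → ℝ≥0) (X : Fin k → Finset G)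
    (f : Fin k → Option (Fin n)) : Prop :=
  ∀ a c, ¬ IsCycle v X f a c

/-- `c = [q₀, …, qₛ]` is a chain from `r = qₛ` to `q = q₀`: a simple path
`qₛ → q_{s-1} → … → q₀` of the envy graph whose first vertex `r` has no incoming edge. -/
def IsChainTo (v : Fin n → Finset G → ℝ≥0) (X : Fin k → Finset G) (f : Fin k → Option (Fin n))
    (r q : Fin k) (c : List (Fin k)) : Prop :=
  c.head? = some q ∧ c.getLast? = some r ∧ c.Nodup ∧ c.IsChain (fun y z => Edge v X f z y) ∧
    ∀ a, ¬ Edge v X f a r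

/-- On a list `[q₀, …, qₛ]`: for `ℓ = 0, …, s - 1` put `f(q_ℓ) ← f(q_{ℓ+1})`,
then `f(qₛ) ← o`. -/
def passAlong (o : Option (Fin n)) :
    List (Fin k) → (Fin k → Option (Fin n)) → (Fin k → Option (Fin n))
  | [], f => f
  | [q], f => Function.update f q o
  | q :: q' :: t, f => passAlong o (q' :: t) (Function.update f q (f q'))

/-- Shift the association along a path, freeing its first bundle. -/
def shiftSubChain (f : Fin k → Option (Fin n)) (c : List (Fin k)) : Fin k → Option (Fin n) :=
  passAlong none c f

/-- Rotate the association along the cycle `c = [q₁, …, qₛ]`, where `a = q₁`. -/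
def rotate (f : Fin k → Option (Fin n)) (a : Fin k) (c : List (Fin k)) :
    Fin k → Option (Fin n) :=
  passAlong (f a) c f

end Associations

/-- An implementation of the subroutine `FindMins`: from a nonempty bundle `S` and two agents
`i`, `j` it returns goods of smallest marginal value for `i` and for `j`, and the same good for both
if they share one. How it breaks ties is arbitrary, but equal arguments give equal results. -/
structure FindMins {G : Type*} [DecidableEq G] {n : ℕ} (v : Fin n → Finset G → ℝ≥0) where
  pick : (S : Finset G) → S.Nonempty → Fin n → Fin n → G × G
  fst_mem : ∀ S hS i j, (pick S hS i j).1 ∈ minGoods (v i) S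
  snd_mem : ∀ S hS i j, (pick S hS i j).2 ∈ minGoods (v j) S
  common : ∀ S hS i j, (minGoods (v i) S ∩ minGoods (v j) S).Nonempty →
    (pick S hS i j).1 = (pick S hS i j).2

/-- Such implementations exist. -/
theorem FindMins.exists {G : Type*} [DecidableEq G] {n : ℕ} (v : Fin n → Finset G → ℝ≥0) :
    Nonempty (FindMins v) := by
  classical
  have key : ∀ (S : Finset G) (_ : S.Nonempty) (i j : Fin n), ∃ z : G × G,
      z.1 ∈ minGoods (v i) S ∧ z.2 ∈ minGoods (v j) S ∧
        ((minGoods (v i) S ∩ minGoods (v j) S).Nonempty → z.1 = z.2) := by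
    intro S hS i j
    by_cases h : (minGoods (v i) S ∩ minGoods (v j) S).Nonempty
    · obtain ⟨g, hg⟩ := h
      exact ⟨(g, g), hg.1, hg.2, fun _ => rfl⟩
    · obtain ⟨a, ha, ha'⟩ := S.exists_max_image (fun g => v i (S.erase g)) hS
      obtain ⟨b, hb, hb'⟩ := S.exists_max_image (fun g => v j (S.erase g)) hS
      exact ⟨(a, b), ⟨ha, ha'⟩, ⟨hb, hb'⟩, fun h' => absurd h' h⟩
  choose f h1 h2 h3 using key
  exact ⟨⟨f, h1, h2, h3⟩⟩

/-- The control states of the procedure `ReBalance` on `k` bundles, with its variables: the bundles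
`X`, the association function `f`, agents `i`, `j`, goods `x`, `y` (smallest for `i`, for `j`),
indices `p`, `q`, `r`, a bundle `R`, and a chain `c` that starts at `q` (Phase 1) or at `r`
(Phase 2). -/
inductive RState (G : Type*) (n k : ℕ) where
  /-- top of the Phase 1 loop -/
  | test (X : Fin k → Finset G) (f : Fin k → Option (Fin n))
  /-- about to choose a free agent `i` and an EFX-best bundle `p` for `i` -/
  | pick (X : Fin k → Finset G) (f : Fin k → Option (Fin n))
  /-- about to read `j = f(p)` and to compare -/
  | compare (X : Fin k → Finset G) (f : Fin k → Option (Fin n)) (i : Fin n) (p : Fin k)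
  /-- about to choose a chain to the last bundle -/
  | chain1 (X : Fin k → Finset G) (f : Fin k → Option (Fin n)) (i j : Fin n) (p : Fin k) (x y : G)
  /-- about to move a good or to leave Phase 1 -/
  | move1 (X : Fin k → Finset G) (f : Fin k → Option (Fin n)) (i j : Fin n) (p : Fin k) (x y : G)
      (q : Fin k) (c : List (Fin k))
  /-- eliminating envy cycles at the end of an iteration of Phase 1 -/
  | elim1 (X : Fin k → Finset G) (f : Fin k → Option (Fin n))
  /-- top of the Phase 2 loop: eliminating envy cycles -/
  | elim2 (X : Fin k → Finset G) (f : Fin k → Option (Fin n)) (R : Finset G) (p q : Fin k)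
      (i j : Fin n)
  /-- about to choose a chain to bundle `q` -/
  | chain2 (X : Fin k → Finset G) (f : Fin k → Option (Fin n)) (R : Finset G) (p q : Fin k)
      (i j : Fin n)
  /-- about to choose the goods -/
  | goods2 (X : Fin k → Finset G) (f : Fin k → Option (Fin n)) (R : Finset G) (p q : Fin k)
      (i j : Fin n) (r : Fin k) (c : List (Fin k))
  /-- about to test the two alternative partitions -/
  | test2 (X : Fin k → Finset G) (f : Fin k → Option (Fin n)) (R : Finset G) (p q : Fin k)
      (i j : Fin n) (r : Fin k) (c : List (Fin k)) (x y : G)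
  /-- both alternatives failed and `R` has been updated; about to update `f`, `p`, `q` and `X` -/
  | update2 (X : Fin k → Finset G) (f : Fin k → Option (Fin n)) (R : Finset G) (p q : Fin k)
      (i j : Fin n) (r : Fin k) (c : List (Fin k)) (x y : G)
  /-- returned `(X, f)` -/
  | ret (X : Fin k → Finset G) (f : Fin k → Option (Fin n))

/-- One step of `ReBalance`. Every choice that the procedure leaves open (agents, bundles, chains,
cycles, tie-breaking, the fair association returned) is nondeterministic. A state in which the
next instruction is undefined has no successor. -/
inductive RStep {G : Type*} [Fintype G] [DecidableEq G] {n k : ℕ} (v : Fin n → Finset G → ℝ≥0)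
    (fm : FindMins v) : RState G n k → RState G n k → Prop where
  | test_ret {X f f'} (h : FullFairAssociation v X f') :
      RStep v fm (.test X f) (.ret X f')
  | test_fail {X f} (h : ¬ HasFairAssociation v X) :
      RStep v fm (.test X f) (.pick X f)
  | pick {X f i p} (hi : ∀ ℓ, f ℓ ≠ some i) (hp : EFXBest (v i) X p) :
      RStep v fm (.pick X f) (.compare X f i p)
  | compare_swap {X f i p j} (hj : f p = some j) (hp : ¬ EFXBest (v j) X p) :
      RStep v fm (.compare X f i p) (.test X (Function.update f p (some i)))
  | compare_keep {X f i p j} (hj : f p = some j) (hp : EFXBest (v j) X p) (hX : (X p).Nonempty) :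
      RStep v fm (.compare X f i p)
        (.chain1 X f i j p (fm.pick (X p) hX i j).1 (fm.pick (X p) hX i j).2)
  | chain1 {X f i j p x y z q c} (hz : z.val + 1 = k) (hc : IsChainTo v X f q z c) :
      RStep v fm (.chain1 X f i j p x y) (.move1 X f i j p x y q c)
  | move1_i {X f i j p x y q c} (h : v i (insert x (X q)) ≤ v i ((X p).erase x)) :
      RStep v fm (.move1 X f i j p x y q c)
        (.elim1 (moveGood X p q x) (Function.update f p (some i)))
  | move1_j {X f i j p x y q c} (h : v j (insert y (X q)) ≤ v j ((X p).erase y)) :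
      RStep v fm (.move1 X f i j p x y q c)
        (.elim1 (moveGood X p q y) (Function.update f p (some j)))
  | move1_break {X f i j p x y q c} (hi : ¬ v i (insert x (X q)) ≤ v i ((X p).erase x))
      (hj : ¬ v j (insert y (X q)) ≤ v j ((X p).erase y)) :
      RStep v fm (.move1 X f i j p x y q c)
        (.elim2 X (Function.update (shiftSubChain f c) p none) ((X p).erase y) p q i j)
  | elim1_rotate {X f a c} (h : IsCycle v X f a c) :
      RStep v fm (.elim1 X f) (.elim1 X (rotate f a c))
  | elim1_done {X f} (h : NoCycle v X f) :
      RStep v fm (.elim1 X f) (.test X f)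
  | elim2_rotate {X f R p q i j a c} (h : IsCycle v X f a c) :
      RStep v fm (.elim2 X f R p q i j) (.elim2 X (rotate f a c) R p q i j)
  | elim2_done {X f R p q i j} (h : NoCycle v X f) :
      RStep v fm (.elim2 X f R p q i j) (.chain2 X f R p q i j)
  | chain2 {X f R p q i j r c} (hc : IsChainTo v X f r q c) :
      RStep v fm (.chain2 X f R p q i j) (.goods2 X f R p q i j r c)
  | goods2 {X f R p q i j r c} (hX : (X p).Nonempty) :
      RStep v fm (.goods2 X f R p q i j r c)
        (.test2 X f R p q i j r c (fm.pick (X p) hX i j).1 (fm.pick (X p) hX i j).2)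
  | test2_ret_j {X f R p q i j r c x y f'} (h : FullFairAssociation v (moveGood X p r y) f') :
      RStep v fm (.test2 X f R p q i j r c x y) (.ret (moveGood X p r y) f')
  | test2_ret_i {X f R p q i j r c x y f'} (hj : ¬ HasFairAssociation v (moveGood X p r y))
      (h : FullFairAssociation v (moveGood X p r x) f') :
      RStep v fm (.test2 X f R p q i j r c x y) (.ret (moveGood X p r x) f')
  | test2_fail {X f R p q i j r c x y R'} (hj : ¬ HasFairAssociation v (moveGood X p r y))
      (hi : ¬ HasFairAssociation v (moveGood X p r x))
      (hR : IsNextBest (v j) [R, moveGood X p r y p, moveGood X p r y r] R') :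
      RStep v fm (.test2 X f R p q i j r c x y) (.update2 X f R' p q i j r c x y)
  | update2_j {X f R p q i j r c x y} (hj : v j (moveGood X p r y p) < v j (moveGood X p r y r)) :
      RStep v fm (.update2 X f R p q i j r c x y)
        (.elim2 (moveGood X p r y) (shiftSubChain f c) R r p i j)
  | update2_i {X f R p q i j r c x y}
      (hj : ¬ v j (moveGood X p r y p) < v j (moveGood X p r y r))
      (hi : v i (X q) ≤ v i (moveGood X p r y r)) :
      RStep v fm (.update2 X f R p q i j r c x y)
        (.elim2 (moveGood X p r y) (shiftSubChain f c) R p r i j)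
  | update2_none {X f R p q i j r c x y}
      (hj : ¬ v j (moveGood X p r y p) < v j (moveGood X p r y r))
      (hi : ¬ v i (X q) ≤ v i (moveGood X p r y r)) :
      RStep v fm (.update2 X f R p q i j r c x y)
        (.elim2 (moveGood X p r y) f R p q i j)

/-- The control states of the main algorithm. Only the values of `f` on the current `k` bundles are
stored; further bundles do not exist yet and are free. -/
inductive Config (G : Type*) (n : ℕ) where
  /-- `k` bundles have been built -/
  | loop (k : ℕ) (X : Fin k → Finset G) (f : Fin k → Option (Fin n))
  /-- eliminating envy cycles before an empty bundle is added -/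
  | elim (k : ℕ) (X : Fin k → Finset G) (f : Fin k → Option (Fin n))
  /-- running `ReBalance` on `k` bundles -/
  | rebalance (k : ℕ) (s : RState G n k)
  /-- the algorithm has returned `(X, f)` -/
  | halt (X : Fin n → Finset G) (f : Fin n → Option (Fin n))

/-- One step of Algorithm MXS+EFL. -/
inductive Step {G : Type*} [Fintype G] [DecidableEq G] {n : ℕ} (v : Fin n → Finset G → ℝ≥0)
    (fm : FindMins v) : Config G n → Config G n → Prop where
  | enter {k X f} (hk : k < n) : Step v fm (.loop k X f) (.elim k X f)
  | rotate {k X f a c} (h : IsCycle v X f a c) :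
      Step v fm (.elim k X f) (.elim k X (rotate f a c))
  | grow {k X f} (h : NoCycle v X f) :
      Step v fm (.elim k X f)
        (.rebalance (k + 1) (.test (Fin.snoc (α := fun _ => Finset G) X ∅)
          (Fin.snoc (α := fun _ => Option (Fin n)) f none)))
  | inner {k s s'} (h : RStep v fm s s') : Step v fm (.rebalance k s) (.rebalance k s')
  | leave {k X f} : Step v fm (.rebalance k (.ret X f)) (.loop k X f)
  | halt {X f} : Step v fm (.loop n X f) (.halt X f)

/-- The algorithm starts with one bundle that holds all goods, associated with the first agent. -/
def start (G : Type*) [Fintype G] {n : ℕ} (hn : 0 < n) : Config G n :=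
  .loop 1 (fun _ => Finset.univ) (fun _ => some ⟨0, hn⟩)

/-- However the open choices are made, the algorithm makes only finitely many steps. -/
def AlwaysTerminates {G : Type*} [Fintype G] [DecidableEq G] {n : ℕ} (hn : 0 < n)
    (v : Fin n → Finset G → ℝ≥0) (fm : FindMins v) : Prop :=
  ¬ ∃ σ : ℕ → Config G n, σ 0 = start G hn ∧ ∀ t, Step v fm (σ t) (σ (t + 1))

/-- Whenever an execution cannot be continued, the algorithm has returned (it is never stuck at an
undefined instruction), and what it has returned is an MXS and EFL allocation. -/
def AlwaysCorrect {G : Type*} [Fintype G] [DecidableEq G] {n : ℕ} (hn : 0 < n)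
    (v : Fin n → Finset G → ℝ≥0) (fm : FindMins v) : Prop :=
  ∀ s, Relation.ReflTransGen (Step v fm) (start G hn) s → (∀ s', ¬ Step v fm s s') →
    ∃ X f, s = .halt X f ∧ IsMXSEFLAllocation v X f

end FairDivision

open FairDivision

/-! Correctness and termination are proved together: `RGood` and `CGood` are the inductive
predicates "the run can go on unless it has returned well, and every continuation is good", and each
loop is a well-founded induction carrying an invariant.

The combinatorial engine is the acceptance graph: `a → b` if the owner of `a` would find `b` fair.
Fairness passes to more valuable bundles (`Fair.mono`), so envy edges are acceptance edges.
Reassigning agents along a path that ends in a free bundle moves the vacancy to the start of the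
path (`PartialFair.reroute`). Hence, while no full fair association exists, no free agent accepts a
bundle from which the free bundle can be reached.

Phase 1 has one free bundle `z`. By the above, neither the free agent `i` nor the owner `j` of the
bundle that is EFX-best for `i` accepts an ancestor of `z`. Ancestors of `z` therefore never lose
goods, and an agent who is handed a bundle, possibly without its smallest good, does not envy them.
So the ancestors, layered by their distance to `z`, descend lexicographically (`Progress.layers`). A
reassignment without a move may leave this rank unchanged, but then fewer bundles fail to be
EFX-best for their owners.

Phase 2 has free bundles `p`, `q` and free agents `i`, `j`. For `j` the invariant says that `R`
bounds every bundle other than `p` after a removal, and that some bundle `o` worth at least `R` can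
be left vacant together with `p`. For `i`, either `q` gives such a bound, or there is a bundle `C`
too cheap for MXS that gives one. Both free agents then accept `p`, and the lack of a full fair
association forces `p` to stay valuable. When `p` and the target of the move exchange roles, the
failure of both test partitions either keeps a bound or produces such a `C`
(`Ready.leftInvariant_swap`); `C` survives later moves because otherwise its goods could be repacked
so that `C` becomes EFX-feasible (`mxsValue_of_cover`). The value of `R` for `j` never falls, and
whenever it stagnates `X p` loses a good. -/

namespace FairDivision

/-! ### Valuations, fairness and repacking bundles. -/

section Valuations

variable {G : Type*} [DecidableEq G]

/-- Whatever good is removed from `S`, the rest is worth at most `a`. -/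
def RemovalBound (v : Finset G → ℝ≥0) (S : Finset G) (a : ℝ≥0) : Prop :=
  ∀ g ∈ S, v (S.erase g) ≤ a

theorem RemovalBound.mono {v : Finset G → ℝ≥0} {S : Finset G} {a b : ℝ≥0}
    (h : RemovalBound v S a) (hab : a ≤ b) : RemovalBound v S b :=
  fun g hg => (h g hg).trans hab

theorem RemovalBound.of_le {v : Finset G → ℝ≥0} (hv : Monotone v) {S : Finset G} {a : ℝ≥0}
    (h : v S ≤ a) : RemovalBound v S a :=
  fun g _ => (hv (Finset.erase_subset g S)).trans h

theorem removalBound_of_mem_minGoods {v : Finset G → ℝ≥0} {S : Finset G} {g : G}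
    (h : g ∈ minGoods v S) : RemovalBound v S (v (S.erase g)) :=
  fun x hx => h.2 x hx

theorem efxFeasible_iff {k : ℕ} {v : Finset G → ℝ≥0} {X : Fin k → Finset G} {ℓ : Fin k} :
    EFXFeasible v X ℓ ↔ ∀ z, z ≠ ℓ → RemovalBound v (X z) (v (X ℓ)) := by
  simp only [EFXFeasible, EFXEnvies, RemovalBound]
  push Not
  rfl

/-- All members of `minGoods` attain the same maximum, so the comparison in `EFXBest`, made with
some pair of smallest goods, is valid for every choice. -/
theorem EFXBest.removalBound {k : ℕ} {v : Finset G → ℝ≥0} {X : Fin k → Finset G} {p : Fin k}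
    (h : EFXBest v X p) {y : G} (hy : y ∈ minGoods v (X p)) (ℓ : Fin k) :
    RemovalBound v (X ℓ) (v ((X p).erase y)) := by
  intro g hg
  by_cases hℓ : ℓ = p
  · subst hℓ; exact hy.2 g hg
  rcases h ℓ hℓ with h | ⟨a, ha, b, hb, hab⟩
  · simp [h] at hg
  · exact (hb.2 g hg).trans (hab.trans (hy.2 a ha.1))

theorem minGoods_nonempty (v : Finset G → ℝ≥0) {S : Finset G} (hS : S.Nonempty) :
    (minGoods v S).Nonempty := by
  obtain ⟨a, ha, ha'⟩ := S.exists_max_image (fun g => v (S.erase g)) hS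
  exact ⟨a, ha, ha'⟩

theorem EFXBest.nonempty {k : ℕ} {v : Finset G → ℝ≥0} {X : Fin k → Finset G} {p : Fin k}
    (h : EFXBest v X p) {ℓ : Fin k} (hℓ : (X ℓ).Nonempty) : (X p).Nonempty := by
  by_cases he : ℓ = p
  · exact he ▸ hℓ
  rcases h ℓ he with h | ⟨a, ha, _⟩
  · simp [h] at hℓ
  · exact ⟨a, ha.1⟩

theorem EFXBest.efxFeasible {k : ℕ} {v : Finset G → ℝ≥0} (hv : Monotone v)
    {X : Fin k → Finset G} {p : Fin k} (h : EFXBest v X p) : EFXFeasible v X p := by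
  rw [efxFeasible_iff]
  intro z hz g hg
  obtain ⟨y, hy⟩ := minGoods_nonempty v (h.nonempty ⟨g, hg⟩)
  exact (h.removalBound hy z g hg).trans (hv (Finset.erase_subset _ _))

theorem exists_efxBest {k : ℕ} (v : Finset G → ℝ≥0) (X : Fin k → Finset G) (hk : 0 < k) :
    ∃ p, EFXBest v X p := by
  classical
  by_cases hX : ∀ ℓ, X ℓ = ∅
  · exact ⟨⟨0, hk⟩, fun ℓ _ => Or.inl (hX ℓ)⟩
  push Not at hX
  obtain ⟨ℓ₀, h₀⟩ := hX
  let w : Fin k → ℝ≥0 := fun ℓ => (X ℓ).sup fun g => v ((X ℓ).erase g)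
  -- Empty bundles must not compete: their supremum is 0 and could tie, but they have no good to
  -- remove.
  obtain ⟨p, hp, hmax⟩ := (Finset.univ.filter fun ℓ => (X ℓ).Nonempty).exists_max_image w
    ⟨ℓ₀, by simpa [Finset.nonempty_iff_ne_empty] using h₀⟩
  simp only [Finset.mem_filter, Finset.mem_univ, true_and] at hp hmax
  refine ⟨p, fun ℓ _ => ?_⟩
  by_cases hℓ : X ℓ = ∅
  · exact Or.inl hℓ
  have hℓ' := Finset.nonempty_iff_ne_empty.2 hℓ
  obtain ⟨a, ha⟩ := minGoods_nonempty v hp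
  obtain ⟨b, hb⟩ := minGoods_nonempty v hℓ'
  refine Or.inr ⟨a, ha, b, hb, ?_⟩
  calc v ((X ℓ).erase b) ≤ w ℓ := Finset.le_sup (f := fun g => v ((X ℓ).erase g)) hb.1
    _ ≤ w p := hmax ℓ hℓ'
    _ ≤ v ((X p).erase a) := Finset.sup_le fun g hg => ha.2 g hg

/-- `a` is at least the value of an EFX-feasible bundle of some partition into `k` bundles. -/
def MXSValue [Fintype G] (v : Finset G → ℝ≥0) (k : ℕ) (a : ℝ≥0) : Prop :=
  ∃ (Y : Fin k → Finset G) (ℓ : Fin k),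
    IsPartition Finset.univ Y ∧ EFXFeasible v Y ℓ ∧ v (Y ℓ) ≤ a

theorem MXSValue.mono [Fintype G] {v : Finset G → ℝ≥0} {k : ℕ} {a b : ℝ≥0}
    (h : MXSValue v k a) (hab : a ≤ b) : MXSValue v k b := by
  obtain ⟨Y, ℓ, h1, h2, h3⟩ := h
  exact ⟨Y, ℓ, h1, h2, h3.trans hab⟩

theorem IsPartition.comp_equiv {k : ℕ} {S : Finset G} {X : Fin k → Finset G}
    (h : IsPartition S X) (e : Equiv.Perm (Fin k)) : IsPartition S (fun ℓ => X (e ℓ)) := by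
  refine ⟨fun ℓ z hℓz => h.1 _ _ (e.injective.ne hℓz), ?_⟩
  rw [← h.2]
  ext g
  simp only [Finset.mem_biUnion, Finset.mem_univ, true_and]
  exact ⟨fun ⟨a, ha⟩ => ⟨e a, ha⟩, fun ⟨a, ha⟩ => ⟨e.symm a, by simpa using ha⟩⟩

/-- Permuting the witnessing partition brings its EFX-feasible bundle to any index, so
MXS-feasibility depends only on the value of the bundle. -/
theorem mxsFeasible_iff [Fintype G] {k : ℕ} {v : Finset G → ℝ≥0} {X : Fin k → Finset G}
    {ℓ : Fin k} : MXSFeasible v X ℓ ↔ MXSValue v k (v (X ℓ)) := by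
  constructor
  · rintro ⟨Y, h1, h2, h3⟩
    exact ⟨Y, ℓ, h1, h2, h3⟩
  · rintro ⟨Y, a, h1, h2, h3⟩
    refine ⟨fun z => Y (Equiv.swap ℓ a z), h1.comp_equiv _, ?_, by simpa using h3⟩
    rw [efxFeasible_iff] at h2 ⊢
    intro z hz
    have := h2 (Equiv.swap ℓ a z) (by
      intro h
      apply hz
      have := congrArg (Equiv.swap ℓ a) h
      simpa using this)
    simpa using this

/-- Both fairness notions at once. -/
def Fair [Fintype G] {k : ℕ} (v : Finset G → ℝ≥0) (X : Fin k → Finset G) (ℓ : Fin k) : Prop :=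
  MXSFeasible v X ℓ ∧ EFLFeasible v X ℓ

theorem eflFeasible_iff {k : ℕ} {v : Finset G → ℝ≥0} {X : Fin k → Finset G} {ℓ : Fin k} :
    EFLFeasible v X ℓ ↔ ∀ z, 1 < (X z).card →
      ∃ g ∈ X z, v ((X z).erase g) ≤ v (X ℓ) ∧ v {g} ≤ v (X ℓ) := by
  simp only [EFLFeasible, EFLEnvies]
  push Not
  rfl

theorem singleton_le_erase {v : Finset G → ℝ≥0} (hv : Monotone v) {S : Finset G} {g x : G}
    (hg : g ∈ S) (h : g ≠ x) : v {g} ≤ v (S.erase x) :=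
  hv (by simpa using ⟨h, hg⟩)

/-- A bundle that is worth at least the rest of `S` after any removal is not EFL-envious of `S`. -/
theorem RemovalBound.efl {v : Finset G → ℝ≥0} (hv : Monotone v) {S : Finset G} {a : ℝ≥0}
    (h : RemovalBound v S a) (hS : 1 < S.card) :
    ∃ g ∈ S, v (S.erase g) ≤ a ∧ v {g} ≤ a := by
  obtain ⟨g, hg⟩ := Finset.card_pos.1 (by omega : 0 < S.card)
  -- `g` survives the removal of a different good `x`, so the bound also covers `{g}`.
  obtain ⟨x, hx, hxg⟩ := Finset.exists_mem_ne hS g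
  exact ⟨g, hg, h g hg, (singleton_le_erase hv hg hxg.symm).trans (h x hx)⟩

theorem EFXFeasible.fair [Fintype G] {k : ℕ} {v : Finset G → ℝ≥0} (hv : Monotone v)
    {X : Fin k → Finset G} (hX : IsPartition Finset.univ X) {ℓ : Fin k}
    (h : EFXFeasible v X ℓ) : Fair v X ℓ := by
  refine ⟨⟨X, hX, h, le_rfl⟩, ?_⟩
  rw [eflFeasible_iff]
  intro z hz
  by_cases hzℓ : z = ℓ
  · subst hzℓ
    exact (RemovalBound.of_le hv le_rfl).efl hv hz
  · exact (efxFeasible_iff.1 h z hzℓ).efl hv hz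

/-- Both notions compare one number with thresholds that do not depend on the index; EFL ranges over
all bundles, including the agent's own. -/
theorem Fair.mono [Fintype G] {k : ℕ} {v : Finset G → ℝ≥0} {X : Fin k → Finset G} {a b : Fin k}
    (h : Fair v X a) (hab : v (X a) ≤ v (X b)) : Fair v X b := by
  refine ⟨?_, ?_⟩
  · rw [mxsFeasible_iff]
    exact (mxsFeasible_iff.1 h.1).mono hab
  · have := h.2
    rw [eflFeasible_iff] at this ⊢
    intro z hz
    obtain ⟨g, hg, h1, h2⟩ := this z hz
    exact ⟨g, hg, h1.trans hab, h2.trans hab⟩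

/-- The definition transported to an arbitrary nonempty index set, so that it applies to a subfamily
of the bundles. -/
theorem RestrictedMMSFeasible.exists_le {v : Finset G → ℝ≥0} (hv : RestrictedMMSFeasible v)
    {ι : Type*} {J : Finset ι} (hJ : J.Nonempty) {X Z : ι → Finset G}
    (hX : ∀ a ∈ J, ∀ b ∈ J, a ≠ b → Disjoint (X a) (X b))
    (hZ : ∀ a ∈ J, ∀ b ∈ J, a ≠ b → Disjoint (Z a) (Z b))
    (h : J.biUnion X = J.biUnion Z) : ∃ a ∈ J, ∃ b ∈ J, v (Z b) ≤ v (X a) := by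
  obtain ⟨m, hm⟩ : ∃ m, J.card = m + 1 := ⟨J.card - 1, by have := hJ.card_pos; omega⟩
  let e : Fin (m + 1) ≃ J := (J.equivFinOfCardEq hm).symm
  have part : ∀ W : ι → Finset G, (∀ a ∈ J, ∀ b ∈ J, a ≠ b → Disjoint (W a) (W b)) →
      IsPartition (J.biUnion W) fun ℓ => W (e ℓ) := by
    intro W hW
    refine ⟨fun ℓ z hne => hW _ (e ℓ).2 _ (e z).2 fun h => hne (e.injective (Subtype.ext h)), ?_⟩
    ext g
    simp only [Finset.mem_biUnion, Finset.mem_univ, true_and]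
    constructor
    · rintro ⟨ℓ, hℓ⟩; exact ⟨_, (e ℓ).2, hℓ⟩
    · rintro ⟨a, ha, hg⟩; exact ⟨e.symm ⟨a, ha⟩, by simpa using hg⟩
  have key := hv _ m _ _ (part X hX) (h ▸ part Z hZ)
  obtain ⟨a, -, ha⟩ := Finset.exists_mem_eq_sup' Finset.univ_nonempty (fun ℓ => v (X (e ℓ)))
  obtain ⟨b, -, hb⟩ := Finset.exists_mem_eq_inf' Finset.univ_nonempty (fun ℓ => v (Z (e ℓ)))
  rw [ha, hb] at key
  exact ⟨_, (e a).2, _, (e b).2, key⟩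

/-- Restricted MMS-feasibility for partitions into two bundles. -/
theorem RestrictedMMSFeasible.pair {v : Finset G → ℝ≥0} (hv : RestrictedMMSFeasible v)
    {A B C D : Finset G} (hAB : Disjoint A B) (hCD : Disjoint C D) (h : A ∪ B = C ∪ D)
    {t : ℝ≥0} (hC : t ≤ v C) (hD : t ≤ v D) : t ≤ v A ∨ t ≤ v B := by
  obtain ⟨a, -, b, -, hab⟩ := hv.exists_le (J := (Finset.univ : Finset Bool)) (by simp)
    (X := fun b => if b then A else B) (Z := fun b => if b then C else D)
    (by simp [hAB, hAB.symm]) (by simp [hCD, hCD.symm])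
    (by
      ext g
      have := congrArg (g ∈ ·) h
      simpa using this)
  cases a <;> cases b <;> simp at hab
  · exact Or.inr (hD.trans hab)
  · exact Or.inr (hC.trans hab)
  · exact Or.inl (hD.trans hab)
  · exact Or.inl (hC.trans hab)

/-- Bag filling: `U` can be divided so that all bags reach the value `t`, or no bag exceeds it after
a removal. -/
theorem exists_bagFilling {v : Finset G → ℝ≥0} (hv : Monotone v) {ι : Type*} [DecidableEq ι]
    (t : ℝ≥0) {J : Finset ι} (hJ : J.Nonempty) : ∀ U : Finset G, ∃ D : ι → Finset G,
      (∀ a ∈ J, ∀ b ∈ J, a ≠ b → Disjoint (D a) (D b)) ∧ J.biUnion D = U ∧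
      ((∀ a ∈ J, t ≤ v (D a)) ∨ ∀ a ∈ J, RemovalBound v (D a) t) := by
  induction hJ using Finset.Nonempty.cons_induction with
  | singleton a =>
    intro U
    refine ⟨fun _ => U, by simp +contextual, by simp, ?_⟩
    rcases le_total t (v U) with h | h
    · exact Or.inl fun _ _ => h
    · exact Or.inr fun _ _ => .of_le hv h
  | cons a J ha hJ ih =>
    intro U
    by_cases hU : v U < t
    · refine ⟨fun b => if b = a then U else ∅, ?_, ?_, Or.inr ?_⟩
      · intro b _ c _ hbc
        by_cases h : b = a
        · subst h; simp [hbc.symm]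
        · simp [h]
      · ext g
        simp only [Finset.mem_biUnion, Finset.mem_cons]
        constructor
        · rintro ⟨b, -, hb⟩
          split_ifs at hb with h
          · exact hb
          · simp at hb
        · exact fun hg => ⟨a, Or.inl rfl, by simpa using hg⟩
      · intro b _
        apply RemovalBound.of_le hv
        change v (if b = a then U else ∅) ≤ t
        split_ifs
        · exact hU.le
        · exact (hv (Finset.empty_subset U)).trans hU.le
    · rw [not_lt] at hU
      -- A subset of least cardinality reaching `t` falls below `t` when any good is removed. It
      -- thus fits both alternatives, and whichever holds for the rest extends.
      obtain ⟨T, hT, hmin⟩ := (U.powerset.filter fun T => t ≤ v T).exists_min_image Finset.card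
        ⟨U, by simpa using hU⟩
      simp only [Finset.mem_filter, Finset.mem_powerset] at hT hmin
      obtain ⟨D, hD1, hD2, hD3⟩ := ih (U \ T)
      have hne : ∀ b ∈ J, b ≠ a := fun b hb h => ha (h ▸ hb)
      have hdisj : ∀ b ∈ J, Disjoint T (D b) := fun b hb =>
        Finset.disjoint_sdiff.mono_right (hD2 ▸ Finset.subset_biUnion_of_mem D hb)
      have hTb : RemovalBound v T t := by
        intro g hg
        by_contra hlt
        have := hmin (T.erase g)
          ⟨(Finset.erase_subset _ _).trans hT.1, (not_le.1 hlt).le⟩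
        have := Finset.card_erase_lt_of_mem hg
        omega
      have hval : ∀ b ∈ J, Function.update D a T b = D b := fun b hb =>
        Function.update_of_ne (hne b hb) _ _
      refine ⟨Function.update D a T, ?_, ?_, ?_⟩
      · intro b hb c hc hbc
        rw [Finset.mem_cons] at hb hc
        rcases hb with rfl | hb <;> rcases hc with rfl | hc
        · exact absurd rfl hbc
        · rw [hval c hc, Function.update_self]; exact hdisj c hc
        · rw [hval b hb, Function.update_self]; exact (hdisj b hb).symm
        · rw [hval b hb, hval c hc]; exact hD1 b hb c hc hbc
      · rw [Finset.cons_eq_insert, Finset.biUnion_insert, Function.update_self,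
          Finset.biUnion_congr rfl hval, hD2]
        exact Finset.union_sdiff_of_subset hT.1
      · rcases hD3 with h | h
        · left
          intro b hb
          rcases Finset.mem_cons.1 hb with rfl | hb
          · rw [Function.update_self]; exact hT.2
          · rw [hval b hb]; exact h b hb
        · right
          intro b hb
          rcases Finset.mem_cons.1 hb with rfl | hb
          · rw [Function.update_self]; exact hTb
          · rw [hval b hb]; exact h b hb

/-- If the bundles worth less than `C` cover `C`, and all other bundles are worth at most `v C`
after any removal, then `v C` is the value of an EFX-feasible bundle of some partition. -/
theorem mxsValue_of_cover [Fintype G] {k : ℕ} {v : Finset G → ℝ≥0} (hv : Monotone v)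
    (hr : RestrictedMMSFeasible v) {X : Fin k → Finset G} (hX : IsPartition Finset.univ X)
    {C : Finset G} (hC : ∀ g ∈ C, ∃ ℓ, g ∈ X ℓ ∧ v (X ℓ) < v C)
    (hb : ∀ ℓ, v (X ℓ) < v C ∨ RemovalBound v (X ℓ) (v C)) {ℓ₀ : Fin k}
    (h₀ : v (X ℓ₀) < v C) : MXSValue v k (v C) := by
  classical
  set O : Finset (Fin k) := Finset.univ.filter fun ℓ => v (X ℓ) < v C with hO
  have memO : ∀ ℓ, ℓ ∈ O ↔ v (X ℓ) < v C := fun ℓ => by simp [hO]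
  have hCO : C ⊆ O.biUnion X := fun g hg => by
    obtain ⟨ℓ, h1, h2⟩ := hC g hg
    exact Finset.mem_biUnion.2 ⟨ℓ, (memO ℓ).2 h2, h1⟩
  have hJ : (O.erase ℓ₀).Nonempty := by
    by_contra hJ
    rw [Finset.not_nonempty_iff_eq_empty] at hJ
    refine absurd (hv (?_ : C ⊆ X ℓ₀)) (not_le.2 h₀)
    intro g hg
    obtain ⟨ℓ, h1, h2⟩ := hC g hg
    by_cases h : ℓ = ℓ₀
    · exact h ▸ h1
    · have : ℓ ∈ O.erase ℓ₀ := Finset.mem_erase.2 ⟨h, (memO ℓ).2 h2⟩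
      simp [hJ] at this
  -- `C` replaces the cheap bundle `ℓ₀`; the remaining goods of the cheap bundles are packed into
  -- the other cheap positions.
  obtain ⟨D, hD1, hD2, hD3⟩ := exists_bagFilling hv (v C) hJ (O.biUnion X \ C)
  let Y : Fin k → Finset G := fun ℓ => if ℓ = ℓ₀ then C else if ℓ ∈ O then D ℓ else X ℓ
  have hY₀ : Y ℓ₀ = C := by simp [Y]
  have hYD : ∀ ℓ ∈ O.erase ℓ₀, Y ℓ = D ℓ := fun ℓ h => by
    simp [Y, Finset.ne_of_mem_erase h, Finset.mem_of_mem_erase h]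
  have hYX : ∀ ℓ, ℓ ∉ O → Y ℓ = X ℓ := fun ℓ h => by
    have : ℓ ≠ ℓ₀ := fun e => h (e ▸ (memO _).2 h₀)
    simp [Y, this, h]
  have hDsub : ∀ ℓ ∈ O.erase ℓ₀, D ℓ ⊆ O.biUnion X \ C := fun ℓ h =>
    hD2 ▸ Finset.subset_biUnion_of_mem D h
  have hYO : ∀ ℓ ∈ O, Y ℓ ⊆ O.biUnion X := by
    intro ℓ h
    by_cases e : ℓ = ℓ₀
    · rw [e, hY₀]; exact hCO
    · have h' := Finset.mem_erase.2 ⟨e, h⟩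
      rw [hYD ℓ h']; exact (hDsub ℓ h').trans Finset.sdiff_subset
  have hdO : ∀ a ∈ O, ∀ b ∈ O, a ≠ b → Disjoint (Y a) (Y b) := by
    have aux : ∀ b ∈ O.erase ℓ₀, Disjoint C (D b) := fun b hb =>
      Finset.disjoint_sdiff.mono_right (hDsub b hb)
    intro a ha b hb hab
    by_cases ea : a = ℓ₀
    · have hb' := Finset.mem_erase.2 ⟨ea ▸ hab.symm, hb⟩
      rw [ea, hY₀, hYD b hb']
      exact aux b hb'
    · have ha' := Finset.mem_erase.2 ⟨ea, ha⟩
      by_cases eb : b = ℓ₀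
      · rw [eb, hY₀, hYD a ha']; exact (aux a ha').symm
      · have hb' := Finset.mem_erase.2 ⟨eb, hb⟩
        rw [hYD a ha', hYD b hb']
        exact hD1 a ha' b hb' hab
  have hdXO : ∀ a ∈ O, ∀ b, b ∉ O → Disjoint (Y a) (X b) := by
    intro a ha b hb
    refine Disjoint.mono_left (hYO a ha) ?_
    rw [Finset.disjoint_biUnion_left]
    exact fun c hc => hX.1 c b fun h => hb (h ▸ hc)
  have hUO : O.biUnion Y = O.biUnion X := by
    refine subset_antisymm (Finset.biUnion_subset.2 hYO) fun g hg => ?_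
    by_cases hgC : g ∈ C
    · exact Finset.mem_biUnion.2 ⟨ℓ₀, (memO _).2 h₀, hY₀ ▸ hgC⟩
    · have : g ∈ (O.erase ℓ₀).biUnion D := hD2 ▸ Finset.mem_sdiff.2 ⟨hg, hgC⟩
      obtain ⟨ℓ, hℓ, hgℓ⟩ := Finset.mem_biUnion.1 this
      exact Finset.mem_biUnion.2 ⟨ℓ, Finset.mem_of_mem_erase hℓ, (hYD ℓ hℓ).symm ▸ hgℓ⟩
  have hpart : IsPartition Finset.univ Y := by
    refine ⟨fun a b hab => ?_, Finset.eq_univ_of_forall fun g => ?_⟩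
    · by_cases ha : a ∈ O <;> by_cases hb' : b ∈ O
      · exact hdO a ha b hb' hab
      · rw [hYX b hb']; exact hdXO a ha b hb'
      · rw [hYX a ha]; exact (hdXO b hb' a ha).symm
      · rw [hYX a ha, hYX b hb']; exact hX.1 a b hab
    · have : g ∈ Finset.univ.biUnion X := hX.2 ▸ Finset.mem_univ g
      obtain ⟨ℓ, -, hℓ⟩ := Finset.mem_biUnion.1 this
      by_cases h : ℓ ∈ O
      · have : g ∈ O.biUnion Y := hUO ▸ Finset.mem_biUnion.2 ⟨ℓ, h, hℓ⟩
        obtain ⟨z, -, hz⟩ := Finset.mem_biUnion.1 this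
        exact Finset.mem_biUnion.2 ⟨z, Finset.mem_univ z, hz⟩
      · exact Finset.mem_biUnion.2 ⟨ℓ, Finset.mem_univ ℓ, (hYX ℓ h).symm ▸ hℓ⟩
  rcases hD3 with hD3 | hD3
  -- If all bags reached `v C`, the goods of the cheap bundles would split into equally many parts
  -- worth at least `v C`, while the original parts are all worth less.
  · exfalso
    obtain ⟨a, ha, b, hb', hab⟩ := hr.exists_le ⟨ℓ₀, (memO _).2 h₀⟩ (X := X) (Z := Y)
      (fun a _ b _ hab => hX.1 a b hab) hdO hUO.symm
    have h1 : v C ≤ v (Y b) := by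
      by_cases e : b = ℓ₀
      · rw [e, hY₀]
      · have := Finset.mem_erase.2 ⟨e, hb'⟩
        rw [hYD b this]; exact hD3 b this
    exact absurd ((memO a).1 ha) (not_lt.2 (h1.trans hab))
  · refine ⟨Y, ℓ₀, hpart, efxFeasible_iff.2 fun z hz => ?_, hY₀ ▸ le_rfl⟩
    rw [hY₀]
    by_cases h : z ∈ O
    · have := Finset.mem_erase.2 ⟨hz, h⟩
      rw [hYD z this]; exact hD3 z this
    · rw [hYX z h]
      exact (hb z).resolve_left fun h' => h ((memO z).2 h')

end Valuations

/-! ### Additive valuations. -/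

section AdditiveValuations

theorem IsAdditive.monotone {G : Type*} {v : Finset G → ℝ≥0} (h : IsAdditive v) : Monotone v := by
  intro S T hST
  rw [h S, h T]
  exact Finset.sum_le_sum_of_subset hST

/-- Both partitions have the total value of `S`, so some part of `Z` is worth at most the part of
`X` with the same index. -/
theorem IsAdditive.restrictedMMSFeasible {G : Type*} [DecidableEq G] {v : Finset G → ℝ≥0}
    (h : IsAdditive v) :
    RestrictedMMSFeasible v := by
  intro S k X Z hX hZ
  have total : ∀ W : Fin (k + 1) → Finset G, IsPartition S W → ∑ ℓ, v (W ℓ) = v S := by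
    intro W hW
    rw [h S, ← hW.2, Finset.sum_biUnion fun a _ b _ hab => hW.1 a b hab]
    exact Finset.sum_congr rfl fun ℓ _ => h (W ℓ)
  have hsum : ∑ ℓ, v (Z ℓ) ≤ ∑ ℓ, v (X ℓ) := by rw [total X hX, total Z hZ]
  obtain ⟨ℓ, hℓ, hle⟩ := Finset.exists_le_of_sum_le Finset.univ_nonempty hsum
  exact (Finset.inf'_le (fun ℓ => v (Z ℓ)) hℓ).trans
    (hle.trans (Finset.le_sup' (fun ℓ => v (X ℓ)) hℓ))

end AdditiveValuations

/-! ### Simple paths and their cyclic permutations. -/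

section Paths

/-- A relation path from `a` to `b` can be made simple. -/
theorem exists_nodup_isChain {α : Type*} {r : α → α → Prop} {a b : α}
    (h : Relation.ReflTransGen r a b) :
    ∃ c : List α, c.head? = some a ∧ c.getLast? = some b ∧ c.Nodup ∧ c.IsChain r := by
  induction h using Relation.ReflTransGen.head_induction_on with
  | refl => exact ⟨[b], by simp⟩
  | @head x y hxy _ ih =>
    obtain ⟨c, h1, h2, h3, h4⟩ := ih
    by_cases hx : x ∈ c
    · obtain ⟨s, t, rfl⟩ := List.append_of_mem hx
      exact ⟨x :: t, by simp, by simpa using h2, (List.nodup_append.1 h3).2.1,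
        (List.isChain_append.1 h4).2.1⟩
    · cases c with
      | nil => simp at h1
      | cons z c =>
        obtain rfl : z = y := by simpa using h1
        exact ⟨x :: z :: c, by simp, by simpa using h2, List.nodup_cons.2 ⟨hx, h3⟩,
          List.isChain_cons_cons.2 ⟨hxy, h4⟩⟩

theorem reflTransGen_of_isChain {α : Type*} {r : α → α → Prop} {a b : α} {c : List α}
    (h : c.IsChain r) (ha : c.head? = some a) (hb : c.getLast? = some b) :
    Relation.ReflTransGen r a b := by
  induction c generalizing a with
  | nil => simp at ha
  | cons x c ih =>
    obtain rfl : x = a := by simpa using ha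
    cases c with
    | nil =>
      obtain rfl : x = b := by simpa using hb
      exact .refl
    | cons y c =>
      rw [List.isChain_cons_cons] at h
      exact .head h.1 (ih h.2 rfl (by simpa using hb))

variable {n k : ℕ}

/-- Passing agents along a list is composition with its cyclic permutation, except that the head's
agent is first overwritten by `o`, which ends up at the last index. With `o = f q` it is a pure
permutation; this covers rotations and also shifts along a chain whose end is free. -/
theorem passAlong_eq_comp (o : Option (Fin n)) (t : List (Fin k)) :
    ∀ (q : Fin k) (f : Fin k → Option (Fin n)), (q :: t).Nodup →
      passAlong o (q :: t) f = Function.update f q o ∘ (q :: t).formPerm := by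
  induction t with
  | nil => intro q f _; ext; simp [passAlong]
  | cons q' t ih =>
    intro q f h
    have hne : q ≠ q' := fun e => by simp [e] at h
    rw [passAlong, ih q' _ (List.nodup_cons.1 h).2, List.formPerm_cons_cons]
    funext ℓ
    simp only [Function.comp_apply, Equiv.Perm.coe_mul]
    generalize (q' :: t).formPerm ℓ = z
    by_cases h1 : z = q'
    · subst h1; simp
    · by_cases h2 : z = q
      · subst h2; simp [hne, hne.symm]
      · rw [Function.update_of_ne h1, Function.update_of_ne h2,
          Equiv.swap_apply_of_ne_of_ne h2 h1, Function.update_of_ne h2]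

theorem passAlong_head {f : Fin k → Option (Fin n)} {q : Fin k} {c : List (Fin k)}
    (hq : c.head? = some q) (hc : c.Nodup) : passAlong (f q) c f = f ∘ c.formPerm := by
  cases c with
  | nil => simp at hq
  | cons z t =>
    obtain rfl : z = q := by simpa using hq
    rw [passAlong_eq_comp _ _ _ _ hc, Function.update_eq_self]

/-- The cyclic permutation of a list moves each element along the chain, or the last element to the
first. -/
theorem formPerm_apply_of_isChain {r : Fin k → Fin k → Prop} {l : List (Fin k)} {q z : Fin k}
    (hc : l.Nodup) (h : l.IsChain r) (hq : l.head? = some q) (hz : l.getLast? = some z)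
    (ℓ : Fin k) :
    (ℓ ∉ l ∧ l.formPerm ℓ = ℓ) ∨ (ℓ = z ∧ l.formPerm ℓ = q) ∨
      (ℓ ∈ l ∧ ℓ ≠ z ∧ r ℓ (l.formPerm ℓ)) := by
  by_cases hℓ : ℓ ∈ l
  · right
    obtain ⟨i, hi, rfl⟩ := List.getElem_of_mem hℓ
    have hz' : l[l.length - 1] = z := by
      rw [List.getLast?_eq_getElem?, List.getElem?_eq_getElem (by omega)] at hz
      simpa using hz
    by_cases hi' : i + 1 < l.length
    · right
      refine ⟨hℓ, fun e => ?_, ?_⟩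
      · rw [← hz', hc.getElem_inj_iff] at e
        omega
      · rw [List.formPerm_apply_lt_getElem _ hc _ hi']
        exact List.isChain_iff_getElem.1 h i hi'
    · left
      have hi'' : i = l.length - 1 := by omega
      subst hi''
      refine ⟨hz', ?_⟩
      cases l with
      | nil => simp at hq
      | cons x t =>
        obtain rfl : x = q := by simpa using hq
        simp
  · exact Or.inl ⟨hℓ, List.formPerm_apply_of_notMem hℓ⟩

theorem formPerm_symm_mem {l : List (Fin k)} {ℓ : Fin k} (h : ℓ ∈ l) : l.formPerm.symm ℓ ∈ l := by
  by_contra hc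
  have := List.formPerm_apply_of_notMem hc
  rw [Equiv.apply_symm_apply] at this
  exact hc (this ▸ h)

/-- The vacancy travels from `q` to the start `o` of the path. Every other vertex receives the agent
of its predecessor on the path, which exists because only associated bundles have outgoing edges. -/
theorem comp_formPerm_eq_none {r : Fin k → Fin k → Prop} {l : List (Fin k)} {q o : Fin k}
    {f : Fin k → Option (Fin n)} (hl : l.Nodup) (h : l.IsChain fun y z => r z y)
    (hq : l.head? = some q) (ho : l.getLast? = some o) (hr : ∀ a b, r a b → f a ≠ none)
    (hfq : f q = none) (ℓ : Fin k) :
    (f ∘ l.formPerm) ℓ = none ↔ ℓ = o ∨ (ℓ ≠ q ∧ f ℓ = none) := by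
  have key := formPerm_apply_of_isChain hl h hq ho
  rw [Function.comp_apply]
  rcases key ℓ with e | e | ⟨hmem, hne, e⟩
  · have h1 : ℓ ≠ o := fun h => e.1 (h ▸ List.mem_of_getLast? ho)
    have h2 : ℓ ≠ q := fun h => e.1 (h ▸ List.mem_of_head? hq)
    simp [e.2, h1, h2]
  · rw [e.2, hfq]; simp [e.1]
  · simp only [hr _ _ e, hne, false_or, false_iff, not_and]
    intro hℓq
    rcases key (l.formPerm.symm ℓ) with e | e | ⟨-, -, e⟩
    · exact absurd (formPerm_symm_mem hmem) e.1
    · rw [Equiv.apply_symm_apply] at e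
      exact absurd e.2 hℓq
    · rw [Equiv.apply_symm_apply] at e
      exact hr _ _ e

/-- Every vertex of a walk that can be continued to `c` reaches `c`, so the two relations need to be
compared only there. -/
theorem transGen_of_restrict {α : Type*} {r s : α → α → Prop} {c : α}
    (h : ∀ a b, r a b → Relation.ReflTransGen r a c → s a b) {a b : α}
    (hab : Relation.TransGen r a b) (hb : Relation.ReflTransGen r b c) :
    Relation.TransGen s a b := by
  induction hab using Relation.TransGen.head_induction_on with
  | single hab => exact .single (h _ _ hab (hb.head hab))
  | head had hdb ih => exact .head (h _ _ had ((hdb.to_reflTransGen.trans hb).head had)) ih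

end Paths

/-! ### Envy graph: acyclicity, chains, rotations and shifts. -/

section EnvyGraph

variable {G : Type*} {n k : ℕ} {v : Fin n → Finset G → ℝ≥0} {X : Fin k → Finset G}
  {f : Fin k → Option (Fin n)}

theorem Edge.ne_none {a b : Fin k} (h : Edge v X f a b) : f a ≠ none := by
  obtain ⟨w, hw, -⟩ := h
  simp [hw]

theorem NoCycle.not_transGen (h : NoCycle v X f) (a : Fin k) :
    ¬ Relation.TransGen (Edge v X f) a a := by
  intro ha
  obtain ⟨b, hb, hba⟩ := Relation.TransGen.head'_iff.1 ha
  obtain ⟨c, h1, h2, h3, h4⟩ :=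
    exists_nodup_isChain (r := fun y z => Edge v X f z y) (Relation.reflTransGen_swap.1 hba)
  exact h a c ⟨h1, h3, h4, b, h2, hb⟩

/-- No envy cycle can reach the bundle `z`. -/
def AcyclicTo (v : Fin n → Finset G → ℝ≥0) (X : Fin k → Finset G) (f : Fin k → Option (Fin n))
    (z : Fin k) : Prop :=
  ∀ a, Relation.ReflTransGen (Edge v X f) a z → ¬ Relation.TransGen (Edge v X f) a a

/-- Changing the agent of a bundle that is not connected to `z` keeps the ancestors of `z`
acyclic. -/
theorem AcyclicTo.update {z : Fin k} (hac : AcyclicTo v X f z) {p : Fin k} {o : Option (Fin n)}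
    (hp : ¬ Relation.ReflTransGen (Edge v X (Function.update f p o)) p z) :
    AcyclicTo v X (Function.update f p o) z := by
  -- Only edges leaving `p` have changed, and `p` is not an ancestor of `z` in the new graph.
  have key : ∀ a b, Edge v X (Function.update f p o) a b →
      Relation.ReflTransGen (Edge v X (Function.update f p o)) a z → Edge v X f a b := by
    rintro a b ⟨w, hw, hlt⟩ ha
    refine ⟨w, ?_, hlt⟩
    rwa [Function.update_of_ne] at hw
    rintro rfl
    exact hp ha
  intro a ha hcyc
  refine hac a ?_ (transGen_of_restrict key hcyc ha)
  rcases Relation.reflTransGen_iff_eq_or_transGen.1 ha with e | h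
  · exact e ▸ .refl
  · exact (transGen_of_restrict key h .refl).to_reflTransGen

/-- An ancestor of `z` with fewest ancestors has no incoming edge: by acyclicity, the tail of such
an edge would lose that vertex from its ancestors. -/
theorem AcyclicTo.exists_isChainTo {z : Fin k} (h : AcyclicTo v X f z) :
    ∃ r c, IsChainTo v X f r z c := by
  classical
  let anc : Fin k → Finset (Fin k) := fun r =>
    Finset.univ.filter fun a => Relation.ReflTransGen (Edge v X f) a r
  have mem : ∀ a r, a ∈ anc r ↔ Relation.ReflTransGen (Edge v X f) a r := fun a r => by simp [anc]
  obtain ⟨r, hr, hmin⟩ := (anc z).exists_min_image (fun r => (anc r).card)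
    ⟨z, (mem z z).2 .refl⟩
  rw [mem] at hr
  obtain ⟨c, h1, h2, h3, h4⟩ :=
    exists_nodup_isChain (r := fun y z => Edge v X f z y) (Relation.reflTransGen_swap.1 hr)
  refine ⟨r, c, h1, h2, h3, h4, fun a ha => ?_⟩
  have hle := hmin a ((mem a z).2 (.head ha hr))
  refine absurd (Finset.card_lt_card (?_ : anc a ⊂ anc r)) (not_lt.2 hle)
  rw [Finset.ssubset_iff_of_subset fun b hb => (mem b r).2 (((mem b a).1 hb).tail ha)]
  refine ⟨r, (mem r r).2 .refl, fun hra => h r hr ?_⟩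
  exact Relation.TransGen.tail' ((mem r a).1 hra) ha

theorem IsChainTo.reflTransGen {r q : Fin k} {c : List (Fin k)} (h : IsChainTo v X f r q c) :
    Relation.ReflTransGen (Edge v X f) r q :=
  Relation.reflTransGen_swap.1 (reflTransGen_of_isChain h.2.2.2.1 h.1 h.2.1)

/-- `f'` arises from `f` by permuting bundles so that no agent is moved to a bundle that is not
strictly better for this agent. -/
def Improves (v : Fin n → Finset G → ℝ≥0) (X : Fin k → Finset G)
    (f f' : Fin k → Option (Fin n)) : Prop :=
  ∃ π : Equiv.Perm (Fin k), f' = f ∘ π ∧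
    ∀ ℓ w, f (π ℓ) = some w → π ℓ = ℓ ∨ v w (X (π ℓ)) < v w (X ℓ)

theorem improves_of_edges {f' : Fin k → Option (Fin n)} {π : Equiv.Perm (Fin k)} (hf : f' = f ∘ π)
    (h : ∀ ℓ, f (π ℓ) = none ∨ π ℓ = ℓ ∨ Edge v X f (π ℓ) ℓ) : Improves v X f f' := by
  refine ⟨π, hf, fun ℓ w hw => ?_⟩
  rcases h ℓ with h | h | ⟨u, hu, hlt⟩
  · simp [h] at hw
  · exact Or.inl h
  · rw [hw] at hu
    exact Or.inr (Option.some_injective _ hu ▸ hlt)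

theorem IsCycle.rotate_eq {a : Fin k} {c : List (Fin k)} (h : IsCycle v X f a c) :
    rotate f a c = f ∘ c.formPerm :=
  passAlong_head h.1 h.2.1

theorem IsCycle.edge {a : Fin k} {c : List (Fin k)} (h : IsCycle v X f a c) {ℓ : Fin k}
    (hℓ : ℓ ∈ c) : Edge v X f (c.formPerm ℓ) ℓ := by
  obtain ⟨h1, h2, h3, b, h4, h5⟩ := id h
  rcases formPerm_apply_of_isChain h2 h3 h1 h4 ℓ with h | ⟨h, h'⟩ | h
  · exact absurd hℓ h.1
  · rw [h', h]; exact h5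
  · exact h.2.2

theorem IsCycle.improves {a : Fin k} {c : List (Fin k)} (h : IsCycle v X f a c) :
    Improves v X f (rotate f a c) := by
  refine improves_of_edges h.rotate_eq fun ℓ => ?_
  by_cases hℓ : ℓ ∈ c
  · exact Or.inr (Or.inr (h.edge hℓ))
  · exact Or.inr (Or.inl (List.formPerm_apply_of_notMem hℓ))

theorem IsChainTo.shift_eq {r q : Fin k} {c : List (Fin k)} (h : IsChainTo v X f r q c)
    (hq : f q = none) : shiftSubChain f c = f ∘ c.formPerm := by
  rw [shiftSubChain, ← hq]
  exact passAlong_head h.1 h.2.2.1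

theorem IsChainTo.shift_eq_none {r q : Fin k} {c : List (Fin k)} (h : IsChainTo v X f r q c)
    (hq : f q = none) (ℓ : Fin k) :
    shiftSubChain f c ℓ = none ↔ ℓ = r ∨ (ℓ ≠ q ∧ f ℓ = none) := by
  rw [h.shift_eq hq]
  exact comp_formPerm_eq_none h.2.2.1 h.2.2.2.1 h.1 h.2.1 (fun _ _ => Edge.ne_none) hq ℓ

theorem IsChainTo.improves {r q : Fin k} {c : List (Fin k)} (h : IsChainTo v X f r q c)
    (hq : f q = none) : Improves v X f (shiftSubChain f c) := by
  refine improves_of_edges (h.shift_eq hq) fun ℓ => ?_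
  rcases formPerm_apply_of_isChain h.2.2.1 h.2.2.2.1 h.1 h.2.1 ℓ with h | ⟨-, h'⟩ | h
  · exact Or.inr (Or.inl h.2)
  · rw [h']; exact Or.inl hq
  · exact Or.inr (Or.inr h.2.2)

theorem IsCycle.rotate_eq_none {a : Fin k} {c : List (Fin k)} (h : IsCycle v X f a c) (ℓ : Fin k) :
    rotate f a c ℓ = none ↔ f ℓ = none := by
  rw [h.rotate_eq, Function.comp_apply]
  by_cases hℓ : ℓ ∈ c
  · have h1 := h.edge (formPerm_symm_mem hℓ)
    rw [Equiv.apply_symm_apply] at h1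
    obtain ⟨w, hw, -⟩ := h.edge hℓ
    obtain ⟨u, hu, -⟩ := h1
    simp [hw, hu]
  · rw [List.formPerm_apply_of_notMem hℓ]

theorem IsAssociation.comp (hf : IsAssociation f) (π : Equiv.Perm (Fin k)) :
    IsAssociation (f ∘ π) :=
  fun _ _ h => hf _ _ (π.injective.ne h)

theorem IsAssociation.eq_of_eq_some (hf : IsAssociation f) {a b : Fin k} {w : Fin n}
    (ha : f a = some w) (hb : f b = some w) : a = b := by
  by_contra h
  rcases hf a b h with h | h
  · exact h (ha.trans hb.symm)
  · simp [h.1] at ha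

theorem IsAssociation.update (hf : IsAssociation f) {w : Fin n} (hw : ∀ ℓ, f ℓ ≠ some w)
    (p : Fin k) : IsAssociation (Function.update f p (some w)) := by
  intro a b hab
  by_cases ha : a = p
  · subst ha
    rw [Function.update_self, Function.update_of_ne hab.symm]
    exact Or.inl (hw b).symm
  · by_cases hb : b = p
    · subst hb
      rw [Function.update_self, Function.update_of_ne hab]
      exact Or.inl (hw a)
    · rw [Function.update_of_ne ha, Function.update_of_ne hb]
      exact hf a b hab

theorem IsAssociation.update_none (hf : IsAssociation f) (p : Fin k) :
    IsAssociation (Function.update f p none) := by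
  intro a b hab
  by_cases ha : a = p
  · subst ha
    rw [Function.update_self, Function.update_of_ne hab.symm]
    by_cases hb : f b = none
    · exact Or.inr ⟨rfl, hb⟩
    · exact Or.inl (Ne.symm hb)
  · by_cases hb : b = p
    · subst hb
      rw [Function.update_self, Function.update_of_ne hab]
      by_cases ha : f a = none
      · exact Or.inr ⟨ha, rfl⟩
      · exact Or.inl ha
    · rw [Function.update_of_ne ha, Function.update_of_ne hb]
      exact hf a b hab

/-- Agents can be permuted along envy cycles only finitely often: to prove `Q f` for all `f` with
property `K`, one may assume `Q` for all rotations of `f`. -/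
theorem rotate_induction [Fintype G] {K Q : (Fin k → Option (Fin n)) → Prop}
    (hK : ∀ f, K f → IsAssociation f)
    (hrot : ∀ f a c, K f → IsCycle v X f a c → K (rotate f a c))
    (step : ∀ f, K f → (∀ a c, IsCycle v X f a c → Q (rotate f a c)) → Q f) :
    ∀ f, K f → Q f := by
  classical
  -- The pairs of an associated agent and a set of goods it likes at least as much as its bundle.
  -- Under a rotation nobody loses and each agent on the cycle gains, so this set shrinks strictly.
  let D : (Fin k → Option (Fin n)) → Finset (Fin n × Finset G) := fun f =>
    Finset.univ.filter fun z => ∃ a, f a = some z.1 ∧ v z.1 (X a) ≤ v z.1 z.2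
  have memD : ∀ f w S, (w, S) ∈ D f ↔ ∃ a, f a = some w ∧ v w (X a) ≤ v w S :=
    fun f w S => by simp [D]
  intro f
  induction hm : (D f).card using Nat.strong_induction_on generalizing f with
  | _ m ih =>
    intro hf
    refine step f hf fun a c hc => ih _ ?_ _ rfl (hrot f a c hf hc)
    subst hm
    obtain ⟨π, hπ, himp⟩ := hc.improves
    apply Finset.card_lt_card
    rw [Finset.ssubset_iff_of_subset]
    · obtain ⟨h1, h2, h3, b, h4, w, hw, hlt⟩ := id hc
      refine ⟨(w, X a), (memD _ _ _).2 ⟨a, hw, le_rfl⟩, fun hmem => ?_⟩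
      obtain ⟨ℓ, hℓ, hle⟩ := (memD _ _ _).1 hmem
      have hb : rotate f a c b = some w := by
        rw [hc.rotate_eq, Function.comp_apply]
        rcases formPerm_apply_of_isChain h2 h3 h1 h4 b with h | h | h
        · exact absurd (List.mem_of_getLast? h4) h.1
        · rw [h.2, hw]
        · exact absurd rfl h.2.1
      obtain rfl := (hK _ (hrot f a c hf hc)).eq_of_eq_some hℓ hb
      exact absurd hlt (not_lt.2 hle)
    · rintro ⟨w, S⟩ hmem
      obtain ⟨ℓ, hℓ, hle⟩ := (memD _ _ _).1 hmem
      rw [hπ] at hℓ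
      refine (memD _ _ _).2 ⟨π ℓ, hℓ, le_trans ?_ hle⟩
      rcases himp ℓ w hℓ with h | h
      · rw [h]
      · exact h.le

theorem ne_of_reach {r : Fin k → Fin k → Prop} (hr : ∀ a b, r a b → f a ≠ none) {a p q : Fin k}
    (hp : f p = none) (hpq : p ≠ q) (h : Relation.ReflTransGen r a q) : a ≠ p := by
  rintro rfl
  rcases Relation.ReflTransGen.cases_head h with e | ⟨b, hb, -⟩
  · exact hpq e
  · exact hr _ _ hb hp

theorem le_of_source {r a : Fin k} {w : Fin n} (hr : ∀ a, ¬ Edge v X f a r) (hw : f a = some w) :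
    v w (X r) ≤ v w (X a) :=
  not_lt.1 fun hlt => hr a ⟨w, hw, hlt⟩

/-- A bundle that nobody envies stays so. -/
theorem Improves.source {f' : Fin k → Option (Fin n)} (h : Improves v X f f') {r : Fin k}
    (hr : ∀ a, ¬ Edge v X f a r) (b : Fin k) : ¬ Edge v X f' b r := by
  rintro ⟨w, hw, hlt⟩
  obtain ⟨π, rfl, himp⟩ := h
  have := le_of_source hr hw
  rcases himp b w hw with e | e
  · rw [e] at this; exact absurd hlt (not_lt.2 this)
  · exact absurd hlt (not_lt.2 (this.trans e.le))

end EnvyGraph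

/-! ### Moving one good between bundles. -/

section Moves

variable {G : Type*} [DecidableEq G] {k : ℕ} {X : Fin k → Finset G} {p q : Fin k} {x : G}

theorem erase_union_insert {A B : Finset G} (hx : x ∈ A) : A.erase x ∪ insert x B = A ∪ B := by
  rw [Finset.union_insert, ← Finset.insert_union, Finset.insert_erase hx]

theorem disjoint_erase_insert {A B : Finset G} (h : Disjoint A B) :
    Disjoint (A.erase x) (insert x B) := by
  rw [Finset.disjoint_insert_right]
  exact ⟨Finset.notMem_erase _ _, h.mono_left (Finset.erase_subset _ _)⟩

theorem moveGood_target (h : p ≠ q) : moveGood X p q x q = insert x (X q) := by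
  simp [moveGood, h.symm]

theorem moveGood_source (h : p ≠ q) : moveGood X p q x p = (X p).erase x := by
  simp [moveGood, h]

theorem moveGood_other {ℓ : Fin k} (hp : ℓ ≠ p) (hq : ℓ ≠ q) : moveGood X p q x ℓ = X ℓ := by
  simp [moveGood, hp, hq]

theorem subset_moveGood {ℓ : Fin k} (h : p ≠ q) (hp : ℓ ≠ p) : X ℓ ⊆ moveGood X p q x ℓ := by
  by_cases hq : ℓ = q
  · subst hq; rw [moveGood_target h]; exact Finset.subset_insert _ _
  · rw [moveGood_other hp hq]

theorem IsPartition.notMem {S : Finset G} (hX : IsPartition S X) (h : p ≠ q) (hx : x ∈ X p) :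
    x ∉ X q :=
  Finset.disjoint_left.1 (hX.1 p q h) hx

theorem IsPartition.moveGood {S : Finset G} (hX : IsPartition S X) (h : p ≠ q) (hx : x ∈ X p) :
    IsPartition S (moveGood X p q x) := by
  have key : ∀ g ℓ, g ∈ FairDivision.moveGood X p q x ℓ ↔
      (g = x ∧ ℓ = q) ∨ (g ≠ x ∧ g ∈ X ℓ) := by
    intro g ℓ
    by_cases hp : ℓ = p
    · subst hp
      rw [moveGood_source h, Finset.mem_erase]
      simp [h]
    by_cases hq : ℓ = q
    · subst hq
      rw [moveGood_target h, Finset.mem_insert]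
      by_cases hg : g = x <;> simp [hg]
    · rw [moveGood_other hp hq]
      by_cases hg : g = x
      · subst hg
        simp only [hq, and_false, ne_eq, not_true, false_and, or_false, iff_false]
        exact hX.notMem (Ne.symm hp) hx
      · simp [hg]
  refine ⟨fun a b hab => Finset.disjoint_left.2 fun g ha hb => ?_, ?_⟩
  · rw [key] at ha hb
    rcases ha with ⟨rfl, rfl⟩ | ⟨h1, h2⟩ <;> rcases hb with ⟨h3, h4⟩ | ⟨h3, h4⟩
    · exact hab h4.symm
    · exact h3 rfl
    · exact h1 h3
    · exact Finset.disjoint_left.1 (hX.1 a b hab) h2 h4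
  · rw [← hX.2]
    ext g
    simp only [Finset.mem_biUnion, Finset.mem_univ, true_and, key]
    constructor
    · rintro ⟨a, ⟨rfl, -⟩ | ⟨-, h2⟩⟩
      · exact ⟨p, hx⟩
      · exact ⟨a, h2⟩
    · rintro ⟨a, ha⟩
      by_cases hg : g = x
      · exact ⟨q, Or.inl ⟨hg, rfl⟩⟩
      · exact ⟨a, Or.inr ⟨hg, ha⟩⟩

/-- An agent whose bundle is fair and who does not envy the bundle `q` tolerates that a good is
moved to `q` from a bundle with at least two goods. -/
theorem Fair.moveGood [Fintype G] {v : Finset G → ℝ≥0} (hv : Monotone v) {b : Fin k}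
    (h : Fair v X b) (hpq : p ≠ q) (hx : x ∈ X p) (hb : b ≠ p) (hcard : 1 < (X p).card)
    (hle : v (X q) ≤ v (X b)) : Fair v (moveGood X p q x) b := by
  have hval : v (X b) ≤ v (FairDivision.moveGood X p q x b) := hv (subset_moveGood hpq hb)
  refine ⟨?_, ?_⟩
  · rw [mxsFeasible_iff]
    exact (mxsFeasible_iff.1 h.1).mono hval
  · have hefl := eflFeasible_iff.1 h.2
    obtain ⟨g, hg, h1, h2⟩ := hefl p hcard
    rw [eflFeasible_iff]
    intro z hz
    suffices ∃ g ∈ FairDivision.moveGood X p q x z,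
        v ((FairDivision.moveGood X p q x z).erase g) ≤ v (X b) ∧ v {g} ≤ v (X b) by
      obtain ⟨g, hg, h1, h2⟩ := this
      exact ⟨g, hg, h1.trans hval, h2.trans hval⟩
    by_cases hzp : z = p
    · subst hzp
      rw [moveGood_source hpq] at hz ⊢
      by_cases hgx : g = x
      · subst hgx
        exact RemovalBound.efl hv (.of_le hv h1) hz
      · exact ⟨g, Finset.mem_erase.2 ⟨hgx, hg⟩,
          (hv (Finset.erase_subset_erase _ (Finset.erase_subset _ _))).trans h1, h2⟩
    by_cases hzq : z = q
    · subst hzq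
      rw [moveGood_target hpq] at hz ⊢
      by_cases hxz : x ∈ X z
      · rw [Finset.insert_eq_of_mem hxz] at hz ⊢
        exact hefl z hz
      · refine ⟨x, Finset.mem_insert_self _ _, by rwa [Finset.erase_insert hxz], ?_⟩
        -- The moved good is itself affordable: it is the EFL witness `g` of `X p`, or it survives
        -- the removal of `g`.
        by_cases hgx : g = x
        · exact hgx ▸ h2
        · exact (singleton_le_erase hv hx (Ne.symm hgx)).trans h1
    · rw [moveGood_other hzp hzq] at hz ⊢
      exact hefl z hz

end Moves

/-! ### Partial fair associations and the acceptance graph. -/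

section Associations

variable {G : Type*} [Fintype G] [DecidableEq G] {n k : ℕ} {v : Fin n → Finset G → ℝ≥0}
  {X : Fin k → Finset G} {f : Fin k → Option (Fin n)}

/-- All associated bundles are fair for their agents. -/
structure PartialFair (v : Fin n → Finset G → ℝ≥0) (X : Fin k → Finset G)
    (f : Fin k → Option (Fin n)) : Prop where
  assoc : IsAssociation f
  fair : ∀ ℓ w, f ℓ = some w → Fair (v w) X ℓ

theorem PartialFair.hasFair (h : PartialFair v X f) (hf : IsFull f) : HasFairAssociation v X :=
  ⟨f, h.assoc, hf, h.fair⟩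

theorem PartialFair.update (h : PartialFair v X f) {w : Fin n} (hw : ∀ ℓ, f ℓ ≠ some w) {p : Fin k}
    (hp : Fair (v w) X p) : PartialFair v X (Function.update f p (some w)) := by
  refine ⟨h.assoc.update hw p, fun ℓ u hu => ?_⟩
  by_cases hℓ : ℓ = p
  · subst hℓ
    rw [Function.update_self] at hu
    exact Option.some_injective _ hu ▸ hp
  · rw [Function.update_of_ne hℓ] at hu
    exact h.fair ℓ u hu

theorem PartialFair.update_none (h : PartialFair v X f) (p : Fin k) :
    PartialFair v X (Function.update f p none) := by
  refine ⟨h.assoc.update_none p, fun ℓ u hu => ?_⟩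
  by_cases hℓ : ℓ = p
  · subst hℓ; simp at hu
  · rw [Function.update_of_ne hℓ] at hu
    exact h.fair ℓ u hu

theorem PartialFair.improves (h : PartialFair v X f) {f' : Fin k → Option (Fin n)}
    (hf : Improves v X f f') : PartialFair v X f' := by
  obtain ⟨π, rfl, himp⟩ := hf
  refine ⟨h.assoc.comp π, fun ℓ w hw => ?_⟩
  have := h.fair _ _ hw
  rcases himp ℓ w hw with e | e
  · exact e ▸ this
  · exact this.mono e.le

/-- The owner of the bundle `a` would be treated fairly by the bundle `b`. -/
def Accepts (v : Fin n → Finset G → ℝ≥0) (X : Fin k → Finset G) (f : Fin k → Option (Fin n))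
    (a b : Fin k) : Prop :=
  ∃ w, f a = some w ∧ Fair (v w) X b

theorem Accepts.ne_none {a b : Fin k} (h : Accepts v X f a b) : f a ≠ none := by
  obtain ⟨w, hw, -⟩ := h
  simp [hw]

theorem PartialFair.accepts (h : PartialFair v X f) {a b : Fin k} (hab : Edge v X f a b) :
    Accepts v X f a b := by
  obtain ⟨w, hw, hlt⟩ := hab
  exact ⟨w, hw, (h.fair a w hw).mono hlt.le⟩

theorem PartialFair.accepts_reach (h : PartialFair v X f) {a b : Fin k}
    (hab : Relation.ReflTransGen (Edge v X f) a b) : Relation.ReflTransGen (Accepts v X f) a b :=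
  Relation.ReflTransGen.mono (fun _ _ => h.accepts) _ _ hab

/-- If the free bundle `q` can be reached from `o` through acceptable bundles, then the same agents
can be associated in such a way that `o` is free instead. -/
theorem PartialFair.reroute (h : PartialFair v X f) {q o : Fin k} (hq : f q = none)
    (ho : Relation.ReflTransGen (Accepts v X f) o q) :
    ∃ g, PartialFair v X g ∧ (∀ ℓ, g ℓ = none ↔ ℓ = o ∨ (ℓ ≠ q ∧ f ℓ = none)) ∧
      ∀ ℓ w, g ℓ = some w → ∃ a, f a = some w := by
  obtain ⟨c, h1, h2, h3, h4⟩ :=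
    exists_nodup_isChain (r := fun y z => Accepts v X f z y) (Relation.reflTransGen_swap.1 ho)
  refine ⟨f ∘ c.formPerm, ⟨h.assoc.comp _, fun ℓ w hw => ?_⟩,
    comp_formPerm_eq_none h3 h4 h1 h2 (fun _ _ => Accepts.ne_none) hq, fun ℓ w hw => ⟨_, hw⟩⟩
  rw [Function.comp_apply] at hw
  rcases formPerm_apply_of_isChain h3 h4 h1 h2 ℓ with e | e | ⟨-, -, u, hu, hfair⟩
  · exact h.fair ℓ w (e.2 ▸ hw)
  · rw [e.2, hq] at hw; simp at hw
  · rw [hw] at hu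
    exact Option.some_injective _ hu ▸ hfair

/-- There is a fair association of agents of `f` with all bundles except `p` and `o`. -/
def CanFree (v : Fin n → Finset G → ℝ≥0) (X : Fin k → Finset G) (f : Fin k → Option (Fin n))
    (p o : Fin k) : Prop :=
  ∃ g, PartialFair v X g ∧ (∀ ℓ, g ℓ = none ↔ ℓ = p ∨ ℓ = o) ∧
    ∀ ℓ w, g ℓ = some w → ∃ a, f a = some w

/-- Only the set of agents of `f` matters, so rotations and shifts are harmless. -/
theorem CanFree.of_agents {p o : Fin k} (h : CanFree v X f p o) {f' : Fin k → Option (Fin n)}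
    (hf : ∀ ℓ w, f ℓ = some w → ∃ a, f' a = some w) : CanFree v X f' p o := by
  obtain ⟨g, h1, h2, h3⟩ := h
  refine ⟨g, h1, h2, fun ℓ w hw => ?_⟩
  obtain ⟨a, ha⟩ := h3 ℓ w hw
  exact hf a w ha

theorem CanFree.comp {p o : Fin k} (h : CanFree v X f p o) (π : Equiv.Perm (Fin k)) :
    CanFree v X (f ∘ π) p o :=
  h.of_agents fun ℓ _ hw => ⟨π.symm ℓ, by simpa using hw⟩

/-- The source of the contradictions in Phase 2: the two vacancies are filled by the two agents left
over. -/
theorem CanFree.hasFair {p o : Fin k} (h : CanFree v X f p o) (hpo : p ≠ o) {i j : Fin n}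
    (hij : i ≠ j) (hi : ∀ ℓ, f ℓ ≠ some i) (hj : ∀ ℓ, f ℓ ≠ some j) (hip : Fair (v i) X p)
    (hjo : Fair (v j) X o) : HasFairAssociation v X := by
  obtain ⟨g, h1, h2, h3⟩ := h
  have avoid : ∀ w, (∀ ℓ, f ℓ ≠ some w) → ∀ ℓ, g ℓ ≠ some w := fun w hw ℓ hℓ => by
    obtain ⟨a, ha⟩ := h3 ℓ w hℓ
    exact hw a ha
  refine ((h1.update (avoid i hi) hip).update (w := j) (fun ℓ => ?_) hjo).hasFair fun ℓ => ?_
  · by_cases hℓ : ℓ = p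
    · subst hℓ; simpa using hij
    · rw [Function.update_of_ne hℓ]; exact avoid j hj ℓ
  · by_cases hℓ : ℓ = o
    · subst hℓ; simp
    · rw [Function.update_of_ne hℓ]
      by_cases hℓ' : ℓ = p
      · subst hℓ'; simp
      · rw [Function.update_of_ne hℓ']
        exact fun e => ((h2 ℓ).1 e).elim hℓ' hℓ

theorem PartialFair.canFree_self (h : PartialFair v X f) {p q : Fin k}
    (hfree : ∀ ℓ, f ℓ = none ↔ ℓ = p ∨ ℓ = q) : CanFree v X f p q :=
  ⟨f, h, hfree, fun ℓ _ hw => ⟨ℓ, hw⟩⟩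

theorem PartialFair.canFree (h : PartialFair v X f) {p q o : Fin k} (hpq : p ≠ q)
    (hfree : ∀ ℓ, f ℓ = none ↔ ℓ = p ∨ ℓ = q)
    (ho : Relation.ReflTransGen (Accepts v X f) o q) : CanFree v X f p o := by
  obtain ⟨g, h1, h2, h3⟩ := h.reroute ((hfree q).2 (Or.inr rfl)) ho
  refine ⟨g, h1, fun ℓ => ?_, h3⟩
  rw [h2, hfree]
  constructor
  · rintro (e | ⟨e, e' | e'⟩)
    · exact Or.inr e
    · exact Or.inl e'
    · exact absurd e' e
  · rintro (rfl | e)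
    · exact Or.inr ⟨hpq, Or.inl rfl⟩
    · exact Or.inl e

/-- Conversely, if the agents of `f` can be associated such that `p` and `o` are free, then the free
bundle `q` can be reached from `o` through acceptable bundles. -/
theorem CanFree.reach {p q o : Fin k} (h : CanFree v X f p o) (hpq : p ≠ q)
    (hfree : ∀ ℓ, f ℓ = none ↔ ℓ = p ∨ ℓ = q) :
    Relation.ReflTransGen (Accepts v X f) o q := by
  classical
  obtain ⟨g, h1, h2, h3⟩ := h
  by_contra ho
  -- Pigeonhole: if `o` were outside `U`, then `g` would fill all of `U`. An agent placed in `U` by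
  -- `g` accepts that bundle, hence its bundle under `f` also lies in `U`, and it is not the free
  -- bundle `q`. There are too few such bundles.
  set U : Finset (Fin k) :=
    Finset.univ.filter fun a => Relation.ReflTransGen (Accepts v X f) a q with hU
  have memU : ∀ a, a ∈ U ↔ Relation.ReflTransGen (Accepts v X f) a q := fun a => by simp [hU]
  have hp : f p = none := (hfree p).2 (Or.inl rfl)
  have hq : f q = none := (hfree q).2 (Or.inr rfl)
  have owner : ∀ b ∈ U, ∃ a ∈ U.erase q, ∃ w, f a = some w ∧ g b = some w := by
    intro b hb
    rw [memU] at hb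
    have hbp : b ≠ p := ne_of_reach (fun _ _ => Accepts.ne_none) hp hpq hb
    have hbo : b ≠ o := fun e => ho (e ▸ hb)
    have : g b ≠ none := fun e => ((h2 b).1 e).elim hbp hbo
    obtain ⟨w, hw⟩ := Option.ne_none_iff_exists'.1 this
    obtain ⟨a, ha⟩ := h3 b w hw
    refine ⟨a, Finset.mem_erase.2 ⟨fun e => ?_, (memU a).2 (.head ⟨w, ha, h1.fair b w hw⟩ hb)⟩,
      w, ha, hw⟩
    rw [e, hq] at ha
    simp at ha
  choose! φ hφ w hw1 hw2 using owner
  have hcard : (U.erase q).card < U.card := Finset.card_erase_lt_of_mem ((memU q).2 .refl)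
  obtain ⟨a, ha, b, hb, hab, he⟩ := Finset.exists_ne_map_eq_of_card_lt_of_maps_to hcard hφ
  apply hab
  refine h1.assoc.eq_of_eq_some (hw2 a ha) ?_
  rw [hw2 b hb, ← hw1 b hb, ← he, hw1 a ha]

theorem PartialFair.moveGood (hv : ∀ w, Monotone (v w)) (h : PartialFair v X f) {p r : Fin k}
    {x : G} (hp : f p = none) (hpr : p ≠ r) (hx : x ∈ X p) (hcard : 1 < (X p).card)
    (hr : ∀ a, ¬ Edge v X f a r) : PartialFair v (moveGood X p r x) f := by
  refine ⟨h.assoc, fun ℓ w hw => (h.fair ℓ w hw).moveGood (hv w) hpr hx ?_ hcard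
    (le_of_source hr hw)⟩
  rintro rfl
  simp [hp] at hw

/-- Acceptable paths to the free bundle `q` survive when a good is moved from the free bundle `p` to
an unenvied bundle `r` from which `q` can be reached. -/
theorem PartialFair.reach_moveGood (hv : ∀ w, Monotone (v w)) (h : PartialFair v X f)
    {p q r o : Fin k} {x : G} (hp : f p = none) (hpq : p ≠ q) (hx : x ∈ X p)
    (hcard : 1 < (X p).card) (hr : ∀ a, ¬ Edge v X f a r)
    (hrq : Relation.ReflTransGen (Edge v X f) r q)
    (ho : Relation.ReflTransGen (Accepts v X f) o q) :
    Relation.ReflTransGen (Accepts v (FairDivision.moveGood X p r x) f) o q := by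
  have hrp : r ≠ p := ne_of_reach (fun _ _ => Edge.ne_none) hp hpq hrq
  -- Along an envy path the agents do not envy `r` and prefer the next bundle to their own, so the
  -- enlargement of `r` does not spoil that next bundle.
  have hedge : ∀ a, Relation.ReflTransGen (Edge v X f) a q →
      Relation.ReflTransGen (Accepts v (FairDivision.moveGood X p r x) f) a q := by
    intro a ha
    induction ha using Relation.ReflTransGen.head_induction_on with
    | refl => exact .refl
    | @head a b hab hbq ih =>
      have hbp : b ≠ p := ne_of_reach (fun _ _ => Edge.ne_none) hp hpq hbq
      obtain ⟨w, hw, hlt⟩ := hab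
      refine .head ⟨w, hw, ?_⟩ ih
      exact ((h.fair a w hw).mono hlt.le).moveGood (hv w) hrp.symm hx hbp hcard
        ((le_of_source hr hw).trans hlt.le)
  induction ho using Relation.ReflTransGen.head_induction_on with
  | refl => exact .refl
  | @head a b hab hbq ih =>
    have hbp : b ≠ p := ne_of_reach (fun _ _ => Accepts.ne_none) hp hpq hbq
    obtain ⟨w, hw, hfair⟩ := hab
    -- An agent who prefers `X r` to the accepted bundle accepts `r` instead, and the path continues
    -- from there along envy edges.
    rcases le_or_gt (v w (X r)) (v w (X b)) with hle | hlt
    · exact .head ⟨w, hw, hfair.moveGood (hv w) hrp.symm hx hbp hcard hle⟩ ih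
    · exact .head ⟨w, hw, (hfair.mono hlt.le).moveGood (hv w) hrp.symm hx hrp hcard le_rfl⟩
        (hedge r hrq)

/-- The association that frees `o` may be spoiled by the move. It is therefore converted into an
acceptance path, which can be repaired, and back. -/
theorem CanFree.moveGood (hv : ∀ w, Monotone (v w)) (h : PartialFair v X f)
    {p q r o : Fin k} {x : G} (hpq : p ≠ q) (hfree : ∀ ℓ, f ℓ = none ↔ ℓ = p ∨ ℓ = q)
    (hx : x ∈ X p) (hcard : 1 < (X p).card) (hr : ∀ a, ¬ Edge v X f a r)
    (hrq : Relation.ReflTransGen (Edge v X f) r q) (ho : CanFree v X f p o) :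
    CanFree v (FairDivision.moveGood X p r x) f p o := by
  have hp : f p = none := (hfree p).2 (Or.inl rfl)
  have hrp : r ≠ p := ne_of_reach (fun _ _ => Edge.ne_none) hp hpq hrq
  exact (h.moveGood hv hp hrp.symm hx hcard hr).canFree hpq hfree
    (h.reach_moveGood hv hp hpq hx hcard hr hrq (ho.reach hpq hfree))

end Associations

/-! ### The subroutine NextBest. -/

section NextBest

variable {G : Type*}

theorem exists_isNextBest (v : Finset G → ℝ≥0) (A B C : Finset G) :
    ∃ S, IsNextBest v [A, B, C] S := by
  classical
  have : Std.Total (RanksAbove v) := ⟨fun S T => by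
    unfold RanksAbove
    rcases lt_trichotomy (v S) (v T) with h | h | h
    · exact Or.inr (Or.inl h)
    · rcases le_total S.card T.card with h' | h'
      · exact Or.inr (Or.inr ⟨h, h'⟩)
      · exact Or.inl (Or.inr ⟨h.symm, h'⟩)
    · exact Or.inl (Or.inl h)⟩
  have : IsTrans _ (RanksAbove v) := ⟨fun S T U h1 h2 => by
    unfold RanksAbove at *
    rcases h1 with h1 | ⟨h1, h1'⟩ <;> rcases h2 with h2 | ⟨h2, h2'⟩
    · exact Or.inl (h2.trans h1)
    · exact Or.inl (h2 ▸ h1)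
    · exact Or.inl (h1 ▸ h2)
    · exact Or.inr ⟨h2.trans h1, h2'.trans h1'⟩⟩
  have h1 := List.perm_insertionSort (RanksAbove v) [A, B, C]
  have h2 := List.pairwise_insertionSort (RanksAbove v) [A, B, C]
  generalize List.insertionSort (RanksAbove v) [A, B, C] = Y at h1 h2
  match Y, h1, h2 with
  | [], h1, _ => simpa using h1.length_eq
  | [_], h1, _ => simpa using h1.length_eq
  | T :: S :: L, h1, h2 => exact ⟨S, T, L, h1, h2⟩

theorem RanksAbove.le {v : Finset G → ℝ≥0} {S T : Finset G} (h : RanksAbove v S T) : v T ≤ v S :=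
  h.elim le_of_lt fun h => h.1.le

/-- The value of the second bundle, if the bundle `T` is a best one. -/
theorem IsNextBest.value {v : Finset G → ℝ≥0} {Y : List (Finset G)} {T U W S : Finset G}
    (h : IsNextBest v Y S) (hY : Y.Perm [T, U, W]) (hU : v U ≤ v T) (hW : v W ≤ v T) :
    v S = max (v U) (v W) := by
  obtain ⟨T', L, hp, hs⟩ := h
  -- Tie-breaking does not affect the value of the second bundle, so it suffices to compare lists of
  -- values.
  have hp := (hp.trans hY).map v
  obtain ⟨L', rfl⟩ : ∃ L', L = [L'] := by
    have := hp.length_eq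
    simp only [List.map_cons, List.map_nil, List.length_cons, List.length_map,
      List.length_nil] at this
    exact List.length_eq_one_iff.1 (by omega)
  simp only [List.pairwise_cons, List.mem_cons, List.not_mem_nil] at hs
  have h1 := (hs.1 S (by simp)).le
  have h2 := (hs.1 L' (by simp)).le
  have h3 := (hs.2.1 L' (by simp)).le
  simp only [List.map_cons, List.map_nil] at hp
  have hT : v T' = v T := by
    apply le_antisymm
    · have := hp.subset (List.mem_cons_self)
      simp only [List.mem_cons, List.not_mem_nil, or_false] at this
      rcases this with e | e | e
      · exact e.le
      · exact e.le.trans hU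
      · exact e.le.trans hW
    · have := hp.symm.subset (List.mem_cons_self)
      simp only [List.mem_cons, List.not_mem_nil, or_false] at this
      rcases this with e | e | e
      · exact e.le
      · exact e.le.trans h1
      · exact e.le.trans h2
  rw [hT] at hp
  have hp := (List.perm_cons _).1 hp
  have hS := hp.subset List.mem_cons_self
  have hU' : v U ∈ [v S, v L'] := hp.symm.subset List.mem_cons_self
  have hW' : v W ∈ [v S, v L'] := hp.symm.subset (by simp)
  simp only [List.mem_cons, List.not_mem_nil, or_false] at hS hU' hW'
  apply le_antisymm
  · rcases hS with e | e
    · exact e.le.trans (le_max_left _ _)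
    · exact e.le.trans (le_max_right _ _)
  · apply max_le
    · rcases hU' with e | e
      · exact e.le
      · exact e.le.trans h3
    · rcases hW' with e | e
      · exact e.le
      · exact e.le.trans h3

/-- Used with `A` the bundle `R`, `B` the source and `C` the target after a move, when `p` and the
target exchange roles. -/
theorem nextBest_swap {u : Finset G → ℝ≥0} {A B C S : Finset G} (h : IsNextBest u [A, B, C] S)
    (hAB : u A ≤ u B) (hBC : u B ≤ u C) : u S = u B := by
  rw [h.value (T := C) (U := A) (W := B) ?_ (hAB.trans hBC) hBC, max_eq_right hAB]
  exact (List.Perm.cons A (List.Perm.swap C B [])).trans (List.Perm.swap C A [B])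

theorem nextBest_keep {u : Finset G → ℝ≥0} {A B C S : Finset G} (h : IsNextBest u [A, B, C] S)
    (hAB : u A ≤ u B) (hCB : u C ≤ u B) : u S = max (u A) (u C) :=
  h.value (List.Perm.swap B A [C]) hAB hCB

end NextBest

/-! ### Runs of ReBalance. -/

section Executions

variable {G : Type*} [Fintype G] [DecidableEq G] {n k : ℕ} {v : Fin n → Finset G → ℝ≥0}
  {fm : FindMins v}

/-- Every execution of `ReBalance` from the given state is finite and returns a partition with a
full fair association. -/
inductive RGood (v : Fin n → Finset G → ℝ≥0) (fm : FindMins v) : RState G n k → Prop where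
  | ret {X f} (hX : IsPartition Finset.univ X) (hf : FullFairAssociation v X f) :
      RGood v fm (.ret X f)
  | step {s} (h : ∃ s', RStep v fm s s') (h' : ∀ s', RStep v fm s s' → RGood v fm s') :
      RGood v fm s

/-- Any invariant preserved by rotations may be carried through cycle elimination, which therefore
adds nothing to the termination measure of Phase 2. -/
theorem rgood_elim2_of {X : Fin k → Finset G} {R : Finset G} {p q : Fin k} {i j : Fin n}
    {K : (Fin k → Option (Fin n)) → Prop} (hK : ∀ f, K f → IsAssociation f)
    (hrot : ∀ f a c, K f → IsCycle v X f a c → K (rotate f a c))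
    (h : ∀ f, K f → NoCycle v X f → RGood v fm (.chain2 X f R p q i j)) :
    ∀ f, K f → RGood v fm (.elim2 X f R p q i j) := by
  refine rotate_induction hK hrot fun f hf ih => .step ?_ ?_
  · by_cases hc : NoCycle v X f
    · exact ⟨_, .elim2_done hc⟩
    · simp only [NoCycle, not_forall, not_not] at hc
      obtain ⟨a, c, hc⟩ := hc
      exact ⟨_, .elim2_rotate hc⟩
  · intro s' hs
    cases hs with
    | elim2_rotate hc => exact ih _ _ hc
    | elim2_done hc => exact h f hf hc

theorem rgood_elim1_of {X : Fin k → Finset G}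
    {K : (Fin k → Option (Fin n)) → Prop} (hK : ∀ f, K f → IsAssociation f)
    (hrot : ∀ f a c, K f → IsCycle v X f a c → K (rotate f a c))
    (h : ∀ f, K f → NoCycle v X f → RGood v fm (.test X f)) :
    ∀ f, K f → RGood v fm (.elim1 X f) := by
  refine rotate_induction hK hrot fun f hf ih => .step ?_ ?_
  · by_cases hc : NoCycle v X f
    · exact ⟨_, .elim1_done hc⟩
    · simp only [NoCycle, not_forall, not_not] at hc
      obtain ⟨a, c, hc⟩ := hc
      exact ⟨_, .elim1_rotate hc⟩
  · intro s' hs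
    cases hs with
    | elim1_rotate hc => exact ih _ _ hc
    | elim1_done hc => exact h f hf hc

/-- One iteration of Phase 2. -/
theorem rgood_chain2_of {X : Fin k → Finset G} {f : Fin k → Option (Fin n)} {R : Finset G}
    {p q : Fin k} {i j : Fin n} (hX : IsPartition Finset.univ X) (hp : f p = none) (hpq : p ≠ q)
    (hne : (X p).Nonempty) (hc : NoCycle v X f)
    (next : ∀ r c R' f' p' q', IsChainTo v X f r q c →
      ¬ HasFairAssociation v (moveGood X p r (fm.pick (X p) hne i j).2) →
      ¬ HasFairAssociation v (moveGood X p r (fm.pick (X p) hne i j).1) →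
      IsNextBest (v j) [R, moveGood X p r (fm.pick (X p) hne i j).2 p,
        moveGood X p r (fm.pick (X p) hne i j).2 r] R' →
      ((v j (moveGood X p r (fm.pick (X p) hne i j).2 p) <
            v j (moveGood X p r (fm.pick (X p) hne i j).2 r) ∧
          f' = shiftSubChain f c ∧ p' = r ∧ q' = p) ∨
        (v j (moveGood X p r (fm.pick (X p) hne i j).2 r) ≤
            v j (moveGood X p r (fm.pick (X p) hne i j).2 p) ∧
          v i (X q) ≤ v i (moveGood X p r (fm.pick (X p) hne i j).2 r) ∧
          f' = shiftSubChain f c ∧ p' = p ∧ q' = r) ∨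
        (v j (moveGood X p r (fm.pick (X p) hne i j).2 r) ≤
            v j (moveGood X p r (fm.pick (X p) hne i j).2 p) ∧
          v i (moveGood X p r (fm.pick (X p) hne i j).2 r) < v i (X q) ∧
          f' = f ∧ p' = p ∧ q' = q)) →
      RGood v fm (.elim2 (moveGood X p r (fm.pick (X p) hne i j).2) f' R' p' q' i j)) :
    RGood v fm (.chain2 X f R p q i j) := by
  refine .step ?_ fun s' hs => ?_
  · obtain ⟨r, c, h⟩ := AcyclicTo.exists_isChainTo (z := q) fun a _ => hc.not_transGen a
    exact ⟨_, .chain2 h⟩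
  cases hs with
  | @chain2 _ _ _ _ _ _ _ r c hchain =>
  have hrp : p ≠ r := (ne_of_reach (fun _ _ => Edge.ne_none) hp hpq hchain.reflTransGen).symm
  refine .step ⟨_, .goods2 hne⟩ fun s' hs => ?_
  cases hs with
  | goods2 hne' =>
  have hmemi := (fm.fst_mem (X p) hne i j).1
  have hmemj := (fm.snd_mem (X p) hne i j).1
  refine .step ?_ fun s' hs => ?_
  · by_cases hj : HasFairAssociation v (moveGood X p r (fm.pick (X p) hne i j).2)
    · exact ⟨_, .test2_ret_j hj.choose_spec⟩
    by_cases hi : HasFairAssociation v (moveGood X p r (fm.pick (X p) hne i j).1)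
    · exact ⟨_, .test2_ret_i hj hi.choose_spec⟩
    obtain ⟨R', hR'⟩ := exists_isNextBest (v j) R
      (moveGood X p r (fm.pick (X p) hne i j).2 p) (moveGood X p r (fm.pick (X p) hne i j).2 r)
    exact ⟨_, .test2_fail hj hi hR'⟩
  cases hs with
  | test2_ret_j h => exact .ret (hX.moveGood hrp hmemj) h
  | test2_ret_i hj h => exact .ret (hX.moveGood hrp hmemi) h
  | @test2_fail _ _ _ _ _ _ _ _ _ _ _ R' hj hi hR =>
  have next' := fun f' p' q' h => next r c R' f' p' q' hchain hj hi hR h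
  refine .step ?_ fun s' hs => ?_
  · by_cases h1 : v j (moveGood X p r (fm.pick (X p) hne i j).2 p) <
        v j (moveGood X p r (fm.pick (X p) hne i j).2 r)
    · exact ⟨_, .update2_j h1⟩
    by_cases h2 : v i (X q) ≤ v i (moveGood X p r (fm.pick (X p) hne i j).2 r)
    · exact ⟨_, .update2_i h1 h2⟩
    · exact ⟨_, .update2_none h1 h2⟩
  cases hs with
  | update2_j h1 => exact next' _ _ _ (Or.inl ⟨h1, rfl, rfl, rfl⟩)
  | update2_i h1 h2 => exact next' _ _ _ (Or.inr (Or.inl ⟨not_lt.1 h1, h2, rfl, rfl, rfl⟩))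
  | update2_none h1 h2 =>
    exact next' _ _ _ (Or.inr (Or.inr ⟨not_lt.1 h1, not_le.1 h2, rfl, rfl, rfl⟩))

end Executions

/-! ### Phase 2: invariants and one iteration. -/

section SecondPhase

variable {G : Type*} [Fintype G] [DecidableEq G] {n k : ℕ} {v : Fin n → Finset G → ℝ≥0}
  {X : Fin k → Finset G} {f : Fin k → Option (Fin n)} {p q r : Fin k} {i j : Fin n}
  {R : Finset G} {x y : G}

/-- Precisely the bundles `p` and `q` are free, the agents `i` and `j` are free, and no full fair
association exists. -/
structure TwoFree (v : Fin n → Finset G → ℝ≥0) (X : Fin k → Finset G) (f : Fin k → Option (Fin n))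
    (p q : Fin k) (i j : Fin n) : Prop where
  part : IsPartition Finset.univ X
  fair : PartialFair v X f
  ne : p ≠ q
  free : ∀ ℓ, f ℓ = none ↔ ℓ = p ∨ ℓ = q
  agents_ne : i ≠ j
  left_free : ∀ ℓ, f ℓ ≠ some i
  right_free : ∀ ℓ, f ℓ ≠ some j
  unfair : ¬ HasFairAssociation v X

theorem TwoFree.rotate (h : TwoFree v X f p q i j) {a : Fin k} {c : List (Fin k)}
    (hc : IsCycle v X f a c) : TwoFree v X (rotate f a c) p q i j where
  part := h.part
  fair := h.fair.improves hc.improves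
  ne := h.ne
  free ℓ := (hc.rotate_eq_none ℓ).trans (h.free ℓ)
  agents_ne := h.agents_ne
  left_free ℓ := by rw [hc.rotate_eq]; exact h.left_free _
  right_free ℓ := by rw [hc.rotate_eq]; exact h.right_free _
  unfair := h.unfair

theorem TwoFree.shift (h : TwoFree v X f p q i j) {c : List (Fin k)}
    (hc : IsChainTo v X f r q c) : TwoFree v X (shiftSubChain f c) p r i j := by
  have hq : f q = none := (h.free q).2 (Or.inr rfl)
  refine ⟨h.part, h.fair.improves (hc.improves hq), ?_, fun ℓ => ?_, h.agents_ne, ?_, ?_, h.unfair⟩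
  · exact (ne_of_reach (fun _ _ => Edge.ne_none) ((h.free p).2 (Or.inl rfl)) h.ne
      hc.reflTransGen).symm
  · rw [hc.shift_eq_none hq, h.free]
    constructor
    · rintro (e | ⟨e, e' | e'⟩)
      · exact Or.inr e
      · exact Or.inl e'
      · exact absurd e' e
    · rintro (rfl | e)
      · exact Or.inr ⟨h.ne, Or.inl rfl⟩
      · exact Or.inl e
  · rw [hc.shift_eq hq]; exact fun ℓ => h.left_free _
  · rw [hc.shift_eq hq]; exact fun ℓ => h.right_free _

theorem TwoFree.symm (h : TwoFree v X f p q i j) : TwoFree v X f q p i j :=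
  ⟨h.part, h.fair, h.ne.symm, fun ℓ => (h.free ℓ).trans or_comm, h.agents_ne, h.left_free,
    h.right_free, h.unfair⟩

theorem TwoFree.source_none (h : TwoFree v X f p q i j) : f p = none := (h.free p).2 (Or.inl rfl)

theorem TwoFree.ne_chain (h : TwoFree v X f p q i j) {c : List (Fin k)}
    (hc : IsChainTo v X f r q c) : p ≠ r :=
  (ne_of_reach (fun _ _ => Edge.ne_none) h.source_none h.ne hc.reflTransGen).symm

theorem TwoFree.canFree_chain (h : TwoFree v X f p q i j) {c : List (Fin k)}
    (hc : IsChainTo v X f r q c) : CanFree v X f p r :=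
  h.fair.canFree h.ne h.free (h.fair.accepts_reach hc.reflTransGen)

theorem TwoFree.not_fair_left (h : TwoFree v X f p q i j) {o : Fin k} (ho : CanFree v X f p o)
    (hpo : p ≠ o) (hj : Fair (v j) X p) : ¬ Fair (v i) X o := fun hi =>
  h.unfair (ho.hasFair hpo h.agents_ne.symm h.right_free h.left_free hj hi)

theorem TwoFree.not_fair_right (h : TwoFree v X f p q i j) {o : Fin k} (ho : CanFree v X f p o)
    (hpo : p ≠ o) (hi : Fair (v i) X p) : ¬ Fair (v j) X o := fun hj =>
  h.unfair (ho.hasFair hpo h.agents_ne h.left_free h.right_free hi hj)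

/-- Moving a good from `p` to an unenvied bundle keeps all properties but the last. -/
theorem TwoFree.moveGood (hv : ∀ w, Monotone (v w)) (h : TwoFree v X f p q i j) {c : List (Fin k)}
    (hc : IsChainTo v X f r q c) (hx : x ∈ X p) (hcard : 1 < (X p).card)
    (hn : ¬ HasFairAssociation v (moveGood X p r x)) :
    TwoFree v (FairDivision.moveGood X p r x) f p q i j :=
  ⟨h.part.moveGood (h.ne_chain hc) hx,
    h.fair.moveGood hv h.source_none (h.ne_chain hc) hx hcard hc.2.2.2.2, h.ne, h.free,
    h.agents_ne, h.left_free, h.right_free, hn⟩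

theorem TwoFree.shift_moveGood (hv : ∀ w, Monotone (v w)) (h : TwoFree v X f p q i j)
    {c : List (Fin k)} (hc : IsChainTo v X f r q c) (hx : x ∈ X p) (hcard : 1 < (X p).card)
    (hn : ¬ HasFairAssociation v (FairDivision.moveGood X p r x)) :
    TwoFree v (FairDivision.moveGood X p r x) (shiftSubChain f c) p r i j := by
  have hs := h.shift hc
  have hq : f q = none := (h.free q).2 (Or.inr rfl)
  refine ⟨h.part.moveGood (h.ne_chain hc) hx, hs.fair.moveGood hv hs.source_none (h.ne_chain hc) hx
    hcard ?_, hs.ne, hs.free, hs.agents_ne, hs.left_free, hs.right_free, hn⟩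
  rintro a ⟨w, hw, hlt⟩
  obtain ⟨π, hπ, himp⟩ := hc.improves hq
  rw [hπ] at hw
  have := le_of_source hc.2.2.2.2 hw
  rcases himp a w hw with e | e
  · rw [e] at this; exact absurd hlt (not_lt.2 this)
  · exact absurd hlt (not_lt.2 (this.trans e.le))

/-- The value of `C` for the agent is too small for MXS, the bundle `p` is worth at least `C`, no
other bundle exceeds this value after a removal, and the goods of `C` lie in `p` and in bundles
worth less than `C`. -/
def Witnessed (u : Finset G → ℝ≥0) (X : Fin k → Finset G) (p : Fin k) (C : Finset G) : Prop :=
  ¬ MXSValue u k (u C) ∧ u C ≤ u (X p) ∧ (∀ ℓ, ℓ ≠ p → RemovalBound u (X ℓ) (u C)) ∧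
    ∀ g ∈ C, ∃ ℓ, g ∈ X ℓ ∧ (ℓ = p ∨ u (X ℓ) < u C)

/-- The invariant of Phase 2 for the agent `i`. -/
def LeftInvariant (u : Finset G → ℝ≥0) (X : Fin k → Finset G) (p q : Fin k) : Prop :=
  (∀ ℓ, ℓ ≠ p → RemovalBound u (X ℓ) (u (X q))) ∨ ∃ C, Witnessed u X p C

/-- The invariant of Phase 2 for the agent `j`. -/
def RightInvariant (v : Fin n → Finset G → ℝ≥0) (X : Fin k → Finset G) (f : Fin k → Option (Fin n))
    (p : Fin k) (R : Finset G) (j : Fin n) : Prop :=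
  v j R ≤ v j (X p) ∧ (∀ ℓ, ℓ ≠ p → RemovalBound (v j) (X ℓ) (v j R)) ∧
    ∃ o, p ≠ o ∧ CanFree v X f p o ∧ v j R ≤ v j (X o)

/-- Were source and target both worth less than `C` after the move, cheap bundles would cover `C`,
and `mxsValue_of_cover` would contradict that `C` is too cheap for MXS. -/
theorem Witnessed.le_of_lt {u : Finset G → ℝ≥0} (hu : Monotone u) (hr : RestrictedMMSFeasible u)
    (hX : IsPartition Finset.univ X) {C : Finset G} (h : Witnessed u X p C) (hpr : p ≠ r)
    (hy : y ∈ X p) (hlt : u (moveGood X p r y p) < u C) : u C ≤ u (moveGood X p r y r) := by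
  by_contra hr'
  rw [not_le] at hr'
  obtain ⟨h1, h2, h3, h4⟩ := h
  refine h1 (mxsValue_of_cover hu hr (hX.moveGood hpr hy) (fun g hg => ?_) (fun ℓ => ?_) hlt)
  · obtain ⟨ℓ, hgℓ, hℓ⟩ := h4 g hg
    by_cases hℓp : ℓ = p
    · by_cases hgy : g = y
      · exact ⟨r, by rw [moveGood_target hpr, hgy]; exact Finset.mem_insert_self _ _, hr'⟩
      · refine ⟨p, ?_, hlt⟩
        rw [moveGood_source hpr]
        exact Finset.mem_erase.2 ⟨hgy, hℓp ▸ hgℓ⟩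
    · refine ⟨ℓ, subset_moveGood hpr hℓp hgℓ, ?_⟩
      by_cases hℓr : ℓ = r
      · rw [hℓr]; exact hr'
      · rw [moveGood_other hℓp hℓr]
        exact hℓ.resolve_left hℓp
  · by_cases hℓp : ℓ = p
    · rw [hℓp]; exact Or.inl hlt
    · by_cases hℓr : ℓ = r
      · rw [hℓr]; exact Or.inl hr'
      · rw [moveGood_other hℓp hℓr]; exact Or.inr (h3 ℓ hℓp)

/-- The invariant for `i` persists when `p` is kept. -/
theorem LeftInvariant.keep {u : Finset G → ℝ≥0} (hu : Monotone u) (hr : RestrictedMMSFeasible u)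
    (hX : IsPartition Finset.univ X) (h : LeftInvariant u X p q) (hpr : p ≠ r) (hy : y ∈ X p)
    {q' : Fin k} (h1 : u (X q) ≤ u (moveGood X p r y q'))
    (h2 : u (moveGood X p r y r) ≤ u (moveGood X p r y q')) :
    LeftInvariant u (moveGood X p r y) p q' := by
  have bound : ∀ a, a ≤ u (moveGood X p r y q') → (∀ ℓ, ℓ ≠ p → RemovalBound u (X ℓ) a) →
      ∀ ℓ, ℓ ≠ p → RemovalBound u (moveGood X p r y ℓ) (u (moveGood X p r y q')) := by
    intro a ha hb ℓ hℓ
    by_cases hℓr : ℓ = r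
    · subst hℓr; exact .of_le hu h2
    · rw [moveGood_other hℓ hℓr]; exact (hb ℓ hℓ).mono ha
  rcases h with h | ⟨C, h⟩
  · exact Or.inl (bound _ h1 h)
  -- Once the target reaches the value of `C`, the bound by `q'` takes over. Until then the target
  -- is cheap, so it may hold goods of `C`, and the source must still be worth `C`.
  · by_cases hC : u C ≤ u (moveGood X p r y r)
    · exact Or.inl (bound _ (hC.trans h2) h.2.2.1)
    · refine Or.inr ⟨C, h.1, ?_, fun ℓ hℓ => ?_, fun g hg => ?_⟩
      · by_contra hlt
        exact hC (h.le_of_lt hu hr hX hpr hy (not_le.1 hlt))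
      · by_cases hℓr : ℓ = r
        · subst hℓr; exact .of_le hu (not_le.1 hC).le
        · rw [moveGood_other hℓ hℓr]; exact h.2.2.1 ℓ hℓ
      · by_cases hgy : g = y
        · exact ⟨r, by rw [moveGood_target hpr, hgy]; exact Finset.mem_insert_self _ _,
            Or.inr (not_le.1 hC)⟩
        obtain ⟨ℓ, hgℓ, hℓ⟩ := h.2.2.2 g hg
        by_cases hℓp : ℓ = p
        · refine ⟨p, ?_, Or.inl rfl⟩
          rw [moveGood_source hpr]
          exact Finset.mem_erase.2 ⟨hgy, hℓp ▸ hgℓ⟩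
        · refine ⟨ℓ, subset_moveGood hpr hℓp hgℓ, Or.inr ?_⟩
          by_cases hℓr : ℓ = r
          · rw [hℓr]; exact not_le.1 hC
          · rw [moveGood_other hℓp hℓr]
            exact hℓ.resolve_left hℓp

/-- What an iteration of Phase 2 relies on. -/
structure Ready (v : Fin n → Finset G → ℝ≥0) (X : Fin k → Finset G) (f : Fin k → Option (Fin n))
    (p q : Fin k) (i j : Fin n) (x y : G) : Prop where
  base : TwoFree v X f p q i j
  left_mem : x ∈ minGoods (v i) (X p)
  right_mem : y ∈ minGoods (v j) (X p)
  common : (minGoods (v i) (X p) ∩ minGoods (v j) (X p)).Nonempty → x = y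
  card : 1 < (X p).card
  right_fair : Fair (v j) X p
  left_bound : (∀ ℓ, ℓ ≠ p → RemovalBound (v i) (X ℓ) (v i ((X p).erase x))) ∨
    ∃ C, Witnessed (v i) X p C
  right_bound : ∀ ℓ, ℓ ≠ p → RemovalBound (v j) (X ℓ) (v j ((X p).erase y))

/-- The invariant for `i` when the roles of `p` and the target of the move are exchanged. -/
theorem Ready.leftInvariant_swap (hv : ∀ w, Monotone (v w)) (hr : ∀ w, RestrictedMMSFeasible (v w))
    (h : Ready v X f p q i j x y) {c : List (Fin k)} (hc : IsChainTo v X f r q c)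
    (hn : ¬ HasFairAssociation v (moveGood X p r x))
    (hlt : v j (moveGood X p r y p) < v j (moveGood X p r y r)) :
    LeftInvariant (v i) (moveGood X p r y) r p := by
  have hpr := h.base.ne_chain hc
  have hx := h.left_mem.1
  have hy := h.right_mem.1
  have hX := h.base.part
  rcases h.left_bound with hb | ⟨C, hC⟩
  · by_cases hbig : ∀ ℓ, ℓ ≠ p → ℓ ≠ r → RemovalBound (v i) (X ℓ) (v i ((X p).erase y))
    · refine Or.inl fun ℓ hℓ => ?_
      rw [moveGood_source hpr]
      by_cases hℓp : ℓ = p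
      · rw [hℓp, moveGood_source hpr]; exact .of_le (hv i) le_rfl
      · rw [moveGood_other hℓp hℓ]; exact hbig ℓ hℓp hℓ
    have hsmall : v i ((X p).erase y) < v i ((X p).erase x) := by
      by_contra hle
      exact hbig fun ℓ hℓ _ => (hb ℓ hℓ).mono (not_lt.1 hle)
    have hxy : x ≠ y := fun e => by simp [e] at hsmall
    -- Otherwise `i` could take `r` while `j` takes `p`.
    have hvr : v i (X r) < v i ((X p).erase x) := by
      by_contra hle
      rw [not_lt] at hle
      refine h.base.not_fair_left (h.base.canFree_chain hc) hpr h.right_fair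
        (EFXFeasible.fair (hv i) hX (efxFeasible_iff.2 fun z _ => ?_))
      by_cases hz : z = p
      · rw [hz]; exact (removalBound_of_mem_minGoods h.left_mem).mono hle
      · exact (hb z hz).mono hle
    -- Otherwise `x` would be smallest for both agents, and the goods returned would coincide.
    have hjx : v j ((X p).erase x) < v j ((X p).erase y) := by
      by_contra hle
      exact hxy (h.common ⟨x, h.left_mem, hx,
        fun g hg => (h.right_mem.2 g hg).trans (not_lt.1 hle)⟩)
    have hdisj := hX.1 p r hpr
    rw [moveGood_source hpr, moveGood_target hpr] at hlt
    -- After moving `y`, both parts of `X p ∪ X r` are worth at least `X p` without `y` to `j`;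
    -- hence one part after moving `x` is too, and it is not the source.
    have hjr : v j ((X p).erase y) ≤ v j (insert x (X r)) :=
      ((hr j).pair (disjoint_erase_insert hdisj) (disjoint_erase_insert hdisj)
        ((erase_union_insert hx).trans (erase_union_insert hy).symm) le_rfl hlt.le).resolve_left
        (not_le.2 hjx)
    have hX' := hX.moveGood hpr hx
    have hjfair : Fair (v j) (moveGood X p r x) r := by
      refine EFXFeasible.fair (hv j) hX' (efxFeasible_iff.2 fun z hz => ?_)
      rw [moveGood_target hpr]
      by_cases hzp : z = p
      · rw [hzp, moveGood_source hpr]; exact .of_le (hv j) (hjx.le.trans hjr)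
      · rw [moveGood_other hzp hz]; exact (h.right_bound z hzp).mono hjr
    have hbase := h.base.moveGood hv hc hx h.card hn
    -- If `x` is moved instead, `j` can take `r`; since that partition has no full fair association,
    -- `i` must reject the source.
    have hifair : ¬ Fair (v i) (moveGood X p r x) p := fun hi =>
      hn ((CanFree.moveGood hv h.base.fair h.base.ne h.base.free hx h.card hc.2.2.2.2
        hc.reflTransGen (h.base.canFree_chain hc)).hasFair hpr h.base.agents_ne h.base.left_free
        h.base.right_free hi hjfair)
    -- EFL holds for the rejected source, so it is MXS that fails.
    have hmxs : ¬ MXSValue (v i) k (v i ((X p).erase x)) := by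
      intro hm
      refine hifair ⟨mxsFeasible_iff.2 (by rwa [moveGood_source hpr]),
        eflFeasible_iff.2 fun z hz => ?_⟩
      rw [moveGood_source hpr]
      by_cases hzp : z = p
      · subst hzp
        rw [moveGood_source hpr] at hz ⊢
        exact RemovalBound.efl (hv i) (.of_le (hv i) le_rfl) hz
      by_cases hzr : z = r
      · subst hzr
        rw [moveGood_target hpr]
        refine ⟨x, Finset.mem_insert_self _ _, ?_,
          (singleton_le_erase (hv i) hx hxy).trans hsmall.le⟩
        rw [Finset.erase_insert (hX.notMem hpr hx)]
        exact hvr.le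
      · rw [moveGood_other hzp hzr] at hz ⊢
        exact (hb z hzp).efl (hv i) hz
    have hir : v i ((X p).erase x) ≤ v i (insert x (X r)) := by
      by_contra hle
      refine hifair (EFXFeasible.fair (hv i) hX' (efxFeasible_iff.2 fun z hz => ?_))
      rw [moveGood_source hpr]
      by_cases hzr : z = r
      · rw [hzr, moveGood_target hpr]; exact .of_le (hv i) (not_le.1 hle).le
      · rw [moveGood_other hz hzr]; exact hb z hz
    have hir' : v i ((X p).erase x) ≤ v i (insert y (X r)) :=
      ((hr i).pair (disjoint_erase_insert hdisj) (disjoint_erase_insert hdisj)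
        ((erase_union_insert hy).trans (erase_union_insert hx).symm) le_rfl hir).resolve_left
        (not_le.2 hsmall)
    -- The witness is `X p` without `x`. After moving `y`, its good `y` lies in the new
    -- distinguished bundle `r`, its other goods in the old source, which is now cheaper than the
    -- witness.
    refine Or.inr ⟨(X p).erase x, hmxs, by rwa [moveGood_target hpr], fun ℓ hℓ => ?_,
      fun g hg => ?_⟩
    · by_cases hℓp : ℓ = p
      · rw [hℓp, moveGood_source hpr]; exact .of_le (hv i) hsmall.le
      · rw [moveGood_other hℓp hℓ]; exact hb ℓ hℓp
    · by_cases hgy : g = y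
      · exact ⟨r, by rw [moveGood_target hpr, hgy]; exact Finset.mem_insert_self _ _, Or.inl rfl⟩
      · refine ⟨p, ?_, Or.inr (by rwa [moveGood_source hpr])⟩
        rw [moveGood_source hpr]
        exact Finset.mem_erase.2 ⟨hgy, Finset.mem_of_mem_erase hg⟩
  · by_cases hbig : v i C ≤ v i (moveGood X p r y p)
    · refine Or.inl fun ℓ hℓ => ?_
      by_cases hℓp : ℓ = p
      · rw [hℓp]; exact .of_le (hv i) le_rfl
      · rw [moveGood_other hℓp hℓ]; exact (hC.2.2.1 ℓ hℓp).mono hbig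
    · rw [not_le] at hbig
      refine Or.inr ⟨C, hC.1, hC.le_of_lt (hv i) (hr i) hX hpr hy hbig, fun ℓ hℓ => ?_,
        fun g hg => ?_⟩
      · by_cases hℓp : ℓ = p
        · rw [hℓp]; exact .of_le (hv i) hbig.le
        · rw [moveGood_other hℓp hℓ]; exact hC.2.2.1 ℓ hℓp
      · by_cases hgy : g = y
        · exact ⟨r, by rw [moveGood_target hpr, hgy]; exact Finset.mem_insert_self _ _, Or.inl rfl⟩
        obtain ⟨ℓ, hgℓ, hℓ⟩ := hC.2.2.2 g hg
        by_cases hℓp : ℓ = p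
        · refine ⟨p, ?_, Or.inr hbig⟩
          rw [moveGood_source hpr]
          exact Finset.mem_erase.2 ⟨hgy, hℓp ▸ hgℓ⟩
        · refine ⟨ℓ, subset_moveGood hpr hℓp hgℓ, ?_⟩
          by_cases hℓr : ℓ = r
          · exact Or.inl hℓr
          · rw [moveGood_other hℓp hℓr]
            exact Or.inr (hℓ.resolve_left hℓp)

/-- The invariant for `j` when the roles of `p` and the target of the move are exchanged. -/
theorem Ready.rightInvariant_swap (hv : ∀ w, Monotone (v w)) (h : Ready v X f p q i j x y)
    {c : List (Fin k)} (hc : IsChainTo v X f r q c)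
    (hn : ¬ HasFairAssociation v (moveGood X p r y))
    (hlt : v j (moveGood X p r y p) < v j (moveGood X p r y r)) {R' : Finset G}
    (hR : v j R' = v j (moveGood X p r y p)) :
    RightInvariant v (moveGood X p r y) (shiftSubChain f c) r R' j := by
  have hpr := h.base.ne_chain hc
  have hs := (h.base.shift_moveGood hv hc h.right_mem.1 h.card hn).symm
  refine ⟨hR.le.trans hlt.le, fun ℓ hℓ => ?_, p, hpr.symm, hs.fair.canFree_self hs.free, hR.le⟩
  rw [hR]
  by_cases hℓp : ℓ = p
  · rw [hℓp]; exact .of_le (hv j) le_rfl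
  · rw [moveGood_other hℓp hℓ, moveGood_source hpr]; exact h.right_bound ℓ hℓp

/-- The invariant for `j` persists when `p` is kept. -/
theorem RightInvariant.keep (hv : ∀ w, Monotone (v w)) (hI : RightInvariant v X f p R j)
    (h : TwoFree v X f p q i j) (hcard : 1 < (X p).card) (hy : y ∈ X p)
    {c : List (Fin k)} (hc : IsChainTo v X f r q c)
    (hle : v j (moveGood X p r y r) ≤ v j (moveGood X p r y p))
    (hRle : v j R ≤ v j (moveGood X p r y p)) {R' : Finset G}
    (hR : v j R' = max (v j R) (v j (moveGood X p r y r))) :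
    RightInvariant v (moveGood X p r y) f p R' j := by
  have hpr := h.ne_chain hc
  obtain ⟨-, h2, o, hpo, ho, hRo⟩ := hI
  refine ⟨hR.le.trans (max_le hRle hle), fun ℓ hℓ => ?_, ?_⟩
  · rw [hR]
    by_cases hℓr : ℓ = r
    · rw [hℓr]; exact .of_le (hv j) (le_max_right _ _)
    · rw [moveGood_other hℓ hℓr]; exact (h2 ℓ hℓ).mono (le_max_left _ _)
  · have move : ∀ o, CanFree v X f p o → CanFree v (moveGood X p r y) f p o := fun o ho =>
      CanFree.moveGood hv h.fair h.ne h.free hy hcard hc.2.2.2.2 hc.reflTransGen ho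
    -- The bundle that can be freed stays `o` while `R` keeps its value; if the target determines
    -- the new value, it becomes `r`.
    rcases le_total (v j (moveGood X p r y r)) (v j R) with e | e
    · exact ⟨o, hpo, move o ho, by
        rw [hR, max_eq_left e]; exact hRo.trans (hv j (subset_moveGood hpr hpo.symm))⟩
    · exact ⟨r, hpr, move r (h.canFree_chain hc), by rw [hR, max_eq_right e]⟩

/-- In the main part of Phase 2 the value of `R` is below that of `p` without its smallest good. -/
theorem TwoFree.lt_erase (hv : ∀ w, Monotone (v w)) (h : TwoFree v X f p q i j)
    (hJ : RightInvariant v X f p R j) (hi : Fair (v i) X p) :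
    ∃ g ∈ X p, v j R < v j ((X p).erase g) := by
  by_contra hcon
  push Not at hcon
  obtain ⟨-, h2, o, hpo, ho, hRo⟩ := hJ
  -- Otherwise `o` would be EFX-feasible for `j`, and could be freed for `j` while `i` takes `p`.
  refine h.not_fair_right ho hpo hi
    (EFXFeasible.fair (hv j) h.part (efxFeasible_iff.2 fun z _ => ?_))
  by_cases hz : z = p
  · rw [hz]; exact fun g hg => (hcon g hg).trans hRo
  · exact (h2 z hz).mono hRo

theorem TwoFree.right_fair (hv : ∀ w, Monotone (v w)) (h : TwoFree v X f p q i j)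
    (hJ : RightInvariant v X f p R j) : Fair (v j) X p :=
  EFXFeasible.fair (hv j) h.part (efxFeasible_iff.2 fun z hz => (hJ.2.1 z hz).mono hJ.1)

/-- Otherwise `q` would be EFX-feasible for `i`, and the free agents could take the free bundles. -/
theorem TwoFree.exists_lt_of_bound (hv : ∀ w, Monotone (v w)) (h : TwoFree v X f p q i j)
    (hj : Fair (v j) X p) (hI : ∀ ℓ, ℓ ≠ p → RemovalBound (v i) (X ℓ) (v i (X q))) :
    ∃ g ∈ X p, v i (X q) < v i ((X p).erase g) := by
  by_contra hcon
  push Not at hcon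
  refine h.not_fair_left (h.fair.canFree_self h.free) h.ne hj
    (EFXFeasible.fair (hv i) h.part (efxFeasible_iff.2 fun z _ => ?_))
  by_cases hz : z = p
  · rw [hz]; exact hcon
  · exact hI z hz

theorem TwoFree.left_fair (hv : ∀ w, Monotone (v w)) (h : TwoFree v X f p q i j)
    (hj : Fair (v j) X p) (hI : LeftInvariant (v i) X p q) : Fair (v i) X p := by
  refine EFXFeasible.fair (hv i) h.part (efxFeasible_iff.2 fun z hz => ?_)
  rcases hI with hI | ⟨C, hC⟩
  · obtain ⟨g, -, hlt⟩ := h.exists_lt_of_bound hv hj hI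
    exact (hI z hz).mono (hlt.le.trans (hv i (Finset.erase_subset _ _)))
  · exact (hC.2.2.1 z hz).mono hC.2.1

theorem TwoFree.ready (hv : ∀ w, Monotone (v w)) (h : TwoFree v X f p q i j)
    (hJ : RightInvariant v X f p R j) (hI : LeftInvariant (v i) X p q)
    (hx : x ∈ minGoods (v i) (X p)) (hy : y ∈ minGoods (v j) (X p))
    (hxy : (minGoods (v i) (X p) ∩ minGoods (v j) (X p)).Nonempty → x = y) :
    Ready v X f p q i j x y ∧ v j R < v j ((X p).erase y) := by
  have hj := h.right_fair hv hJ
  have hi := h.left_fair hv hj hI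
  obtain ⟨g, hg, hlt⟩ := h.lt_erase hv hJ hi
  have hRy : v j R < v j ((X p).erase y) := hlt.trans_le (hy.2 g hg)
  refine ⟨⟨h, hx, hy, hxy, ?_, hj, ?_, fun ℓ hℓ => (hJ.2.1 ℓ hℓ).mono hRy.le⟩, hRy⟩
  · by_contra hcard
    have : (X p).erase g = ∅ := by
      rw [← Finset.card_eq_zero, Finset.card_erase_of_mem hg]; omega
    rw [this] at hlt
    exact absurd hlt (not_lt.2 (hv j (Finset.empty_subset R)))
  · rcases hI with hI | hI
    · obtain ⟨g, hg, hlt⟩ := h.exists_lt_of_bound hv hj hI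
      exact Or.inl fun ℓ hℓ => (hI ℓ hℓ).mono (hlt.le.trans (hx.2 g hg))
    · exact Or.inr hI

end SecondPhase

/-! ### Phase 2: the loop and its termination. -/

section SecondPhase

variable {G : Type*} [Fintype G] [DecidableEq G] {n k : ℕ} {v : Fin n → Finset G → ℝ≥0}
  {fm : FindMins v} {i j : Fin n}

theorem RightInvariant.rotate {X : Fin k → Finset G} {f : Fin k → Option (Fin n)} {p a : Fin k}
    {R : Finset G} {c : List (Fin k)} (h : RightInvariant v X f p R j) (hc : IsCycle v X f a c) :
    RightInvariant v X (rotate f a c) p R j := by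
  obtain ⟨h1, h2, o, h3, h4, h5⟩ := h
  refine ⟨h1, h2, o, h3, ?_, h5⟩
  rw [hc.rotate_eq]
  exact h4.comp _

/-- Phase 2 after its first iteration. -/
theorem rgood_elim2_of_invariants (hv : ∀ w, Monotone (v w))
    (hr : ∀ w, RestrictedMMSFeasible (v w)) (d : ℕ) :
    ∀ (m : ℕ) (X : Fin k → Finset G) (R : Finset G) (p q : Fin k),
      (Finset.univ.filter fun S => v j R < v j S).card = d → (X p).card = m →
      LeftInvariant (v i) X p q → ∀ f, TwoFree v X f p q i j ∧ RightInvariant v X f p R j →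
      RGood v fm (.elim2 X f R p q i j) := by
  -- Lexicographic descent: first the number of sets that `j` values above `R`, then the size of `X
  -- p`. An exchange raises the value of `R` strictly; if `p` is kept, that value does not fall and
  -- `X p` loses a good.
  induction d using Nat.strong_induction_on with
  | _ d ihd =>
  intro m
  induction m using Nat.strong_induction_on with
  | _ m ihm =>
  intro X R p q hd hm hI
  refine rgood_elim2_of (fun f h => h.1.fair.assoc)
    (fun f a c h hc => ⟨h.1.rotate hc, h.2.rotate hc⟩) ?_
  rintro f ⟨h, hJ⟩ hcyc
  have hne : (X p).Nonempty := by
    obtain ⟨g, hg, -⟩ := h.lt_erase hv hJ (h.left_fair hv (h.right_fair hv hJ) hI)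
    exact ⟨g, hg⟩
  refine rgood_chain2_of h.part h.source_none h.ne hne hcyc ?_
  intro r c R' f' p' q' hc hnj hni hR' hcase
  obtain ⟨hready, hRy⟩ := h.ready hv hJ hI (fm.fst_mem (X p) hne i j) (fm.snd_mem (X p) hne i j)
    (fm.common (X p) hne i j)
  generalize (fm.pick (X p) hne i j).1 = x at *
  generalize (fm.pick (X p) hne i j).2 = y at *
  have hpr := h.ne_chain hc
  have hy := hready.right_mem.1
  have hRp : v j R < v j (moveGood X p r y p) := by rwa [moveGood_source hpr]
  have drop : ∀ R', v j R < v j R' → (Finset.univ.filter fun S => v j R' < v j S).card < d := by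
    intro R' hlt
    subst hd
    apply Finset.card_lt_card
    rw [Finset.ssubset_iff_of_subset fun S hS => by
      simp only [Finset.mem_filter, Finset.mem_univ, true_and] at hS ⊢
      exact hlt.trans hS]
    exact ⟨R', by simpa using hlt, by simp⟩
  have keep : ∀ f' q', TwoFree v (moveGood X p r y) f' p q' i j →
      RightInvariant v (moveGood X p r y) f' p R' j →
      v j (moveGood X p r y r) ≤ v j (moveGood X p r y p) →
      v i (X q) ≤ v i (moveGood X p r y q') →
      v i (moveGood X p r y r) ≤ v i (moveGood X p r y q') →
      RGood v fm (.elim2 (moveGood X p r y) f' R' p q' i j) := by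
    intro f' q' hT hJ' hle h1 h2
    have hI' := hI.keep (hv i) (hr i) h.part hpr hy h1 h2
    have hval := nextBest_keep hR' hRp.le hle
    rcases lt_or_ge (v j R) (v j R') with hlt | hge
    · exact ihd _ (drop R' hlt) _ _ R' p q' rfl rfl hI' f' ⟨hT, hJ'⟩
    · have heq : v j R' = v j R := le_antisymm hge ((le_max_left _ _).trans hval.ge)
      refine ihm _ ?_ _ R' p q' (by rw [heq]; exact hd) rfl hI' f' ⟨hT, hJ'⟩
      rw [moveGood_source hpr, ← hm]
      exact Finset.card_erase_lt_of_mem hy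
  rcases hcase with ⟨hlt, rfl, rfl, rfl⟩ | ⟨hle, hi, rfl, rfl, rfl⟩ | ⟨hle, hi, rfl, rfl, rfl⟩
  · have hval := nextBest_swap hR' hRp.le hlt.le
    exact ihd _ (drop R' (hRp.trans_eq hval.symm)) _ _ R' p' q' rfl rfl
      (hready.leftInvariant_swap hv hr hc hni hlt) _
      ⟨(h.shift_moveGood hv hc hy hready.card hnj).symm,
        hready.rightInvariant_swap hv hc hnj hlt hval⟩
  · have hJ' := hJ.keep hv h hready.card hy hc hle hRp.le (nextBest_keep hR' hRp.le hle)
    refine keep _ _ (h.shift_moveGood hv hc hy hready.card hnj) ⟨hJ'.1, hJ'.2.1, ?_⟩ hle hi le_rfl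
    obtain ⟨o, h1, h2, h3⟩ := hJ'.2.2
    refine ⟨o, h1, ?_, h3⟩
    rw [hc.shift_eq ((h.free q).2 (Or.inr rfl))]
    exact h2.comp _
  -- If the target were the free bundle itself, it would have grown, and `i` could not value it less
  -- than before.
  · have hrq : r ≠ q' := by
      rintro rfl
      rw [moveGood_target hpr] at hi
      exact absurd hi (not_lt.2 (hv i (Finset.subset_insert _ _)))
    have hq : moveGood X p' r y q' = X q' := moveGood_other h.ne.symm hrq.symm
    exact keep _ _ (h.moveGood hv hc hy hready.card hnj)
      (hJ.keep hv h hready.card hy hc hle hRp.le (nextBest_keep hR' hRp.le hle)) hle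
      (by rw [hq]) (by rw [hq]; exact hi.le)

/-- Phase 2 from its beginning. -/
theorem rgood_elim2 (hv : ∀ w, Monotone (v w)) (hr : ∀ w, RestrictedMMSFeasible (v w))
    {X : Fin k → Finset G} {p q : Fin k} (hne : (X p).Nonempty) (hi : EFXBest (v i) X p)
    (hj : EFXBest (v j) X p)
    (hlt : v j ((X p).erase (fm.pick (X p) hne i j).2) <
      v j (insert (fm.pick (X p) hne i j).2 (X q))) :
    ∀ f, TwoFree v X f p q i j ∧ (∀ a, ¬ Edge v X f a q) →
      RGood v fm (.elim2 X f ((X p).erase (fm.pick (X p) hne i j).2) p q i j) := by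
  refine rgood_elim2_of (fun f h => h.1.fair.assoc)
    (fun f a c h hc => ⟨h.1.rotate hc, hc.improves.source h.2⟩) ?_
  rintro f ⟨h, hsource⟩ hcyc
  refine rgood_chain2_of h.part h.source_none h.ne hne hcyc ?_
  intro r c R' f' p' q' hc hnj hni hR' hcase
  have hx := fm.fst_mem (X p) hne i j
  have hy := fm.snd_mem (X p) hne i j
  have hxy := fm.common (X p) hne i j
  generalize (fm.pick (X p) hne i j).1 = x at *
  generalize (fm.pick (X p) hne i j).2 = y at *
  -- Nobody envies `q`, so the first chain is trivial, and the exit condition of Phase 1 forces an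
  -- exchange. This iteration is separate because `R` starts with exactly the value of `X p` without
  -- its smallest good, not strictly below it.
  obtain rfl : r = q := by
    rcases Relation.ReflTransGen.cases_tail hc.reflTransGen with e | ⟨b, -, hb⟩
    · exact e.symm
    · exact absurd hb (hsource b)
  have hpr := h.ne
  have hlt' : v j (moveGood X p r y p) < v j (moveGood X p r y r) := by
    rwa [moveGood_source hpr, moveGood_target hpr]
  have hif := (hi.efxFeasible (hv i)).fair (hv i) h.part
  have hcard : 1 < (X p).card := by
    by_contra hcard
    have he : (X p).erase y = ∅ := by
      rw [← Finset.card_eq_zero, Finset.card_erase_of_mem hy.1]; omega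
    refine h.not_fair_right (h.fair.canFree_self h.free) hpr hif
      (EFXFeasible.fair (hv j) h.part (efxFeasible_iff.2 fun z _ => ?_))
    exact (hj.removalBound hy z).mono (he ▸ hv j (Finset.empty_subset _))
  have hready : Ready v X f p r i j x y :=
    ⟨h, hx, hy, hxy, hcard, (hj.efxFeasible (hv j)).fair (hv j) h.part,
      Or.inl fun ℓ _ => hi.removalBound hx ℓ, fun ℓ _ => hj.removalBound hy ℓ⟩
  rcases hcase with ⟨-, rfl, rfl, rfl⟩ | ⟨hle, -⟩ | ⟨hle, -⟩
  · have hval := nextBest_swap hR' (by rw [moveGood_source hpr]) hlt'.le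
    exact rgood_elim2_of_invariants hv hr _ _ _ R' p' q' rfl rfl
      (hready.leftInvariant_swap hv hr hc hni hlt') _
      ⟨(h.shift_moveGood hv hc hy.1 hcard hnj).symm,
        hready.rightInvariant_swap hv hc hnj hlt' hval⟩
  · exact absurd hlt' (not_lt.2 hle)
  · exact absurd hlt' (not_lt.2 hle)

end SecondPhase

/-! ### Phase 1: the layered termination measure. -/

section Layers

variable {G : Type*} {n k : ℕ} {v : Fin n → Finset G → ℝ≥0}
  {X X' : Fin k → Finset G} {f f' : Fin k → Option (Fin n)} {z : Fin k}

/-- There is a path of length at most `e` from `a` to `z` in the envy graph. -/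
def Within (v : Fin n → Finset G → ℝ≥0) (X : Fin k → Finset G) (f : Fin k → Option (Fin n))
    (z : Fin k) : ℕ → Fin k → Prop
  | 0, a => a = z
  | e + 1, a => Within v X f z e a ∨ ∃ b, Within v X f z e b ∧ Edge v X f a b

theorem Within.reach {e : ℕ} {a : Fin k} (h : Within v X f z e a) :
    Relation.ReflTransGen (Edge v X f) a z := by
  induction e generalizing a with
  | zero => exact h ▸ .refl
  | succ e ih =>
    rcases h with h | ⟨b, h, hab⟩
    · exact ih h
    · exact (ih h).head hab

theorem within_getElem {l : List (Fin k)} (hz : l.head? = some z)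
    (hl : l.IsChain fun y z => Edge v X f z y) (m : ℕ) (hm : m < l.length) :
    Within v X f z m l[m] := by
  induction m with
  | zero =>
    cases l with
    | nil => simp at hm
    | cons a l => simpa [Within] using hz
  | succ m ih => exact Or.inr ⟨_, ih (by omega), List.isChain_iff_getElem.1 hl m hm⟩

/-- A simple path has fewer than `k` edges, so its vertices occur in the layers below `k`, which are
those recorded by `rank`. -/
theorem IsChainTo.exists_within {q : Fin k} {c : List (Fin k)} (h : IsChainTo v X f q z c)
    {a : Fin k} (ha : a ∈ c) : ∃ e < k, Within v X f z e a := by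
  obtain ⟨m, hm, rfl⟩ := List.mem_iff_getElem.1 ha
  exact ⟨m, hm.trans_le (by simpa using h.2.2.1.length_le_card), within_getElem h.1 h.2.2.2.1 m hm⟩

/-- The change from `(X, f)` to `(X', f')`: bundles from which `z` can be reached do not shrink, and
every agent keeps a bundle or gets a better one, or gets one at least as good as all the bundles
from which `z` could be reached. -/
structure Progress (v : Fin n → Finset G → ℝ≥0) (z : Fin k) (X : Fin k → Finset G)
    (f : Fin k → Option (Fin n)) (X' : Fin k → Finset G) (f' : Fin k → Option (Fin n)) : Prop where
  subset : ∀ b, Relation.ReflTransGen (Edge v X f) b z → X b ⊆ X' b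
  agent : ∀ a w, f' a = some w →
    (∃ a₀, f a₀ = some w ∧ v w (X a₀) ≤ v w (X' a) ∧ (a₀ ≠ a → v w (X a₀) < v w (X' a))) ∨
    ∀ b, Relation.ReflTransGen (Edge v X f) b z → v w (X b) ≤ v w (X' a)

theorem Progress.improves (h : Progress v z X f X' f') {g : Fin k → Option (Fin n)}
    (hg : Improves v X' f' g) : Progress v z X f X' g := by
  obtain ⟨π, rfl, himp⟩ := hg
  refine ⟨h.subset, fun a w hw => ?_⟩
  rcases h.agent (π a) w hw with ⟨a₀, h1, h2, h3⟩ | h1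
  · refine Or.inl ⟨a₀, h1, ?_⟩
    rcases himp a w hw with e | e
    · rw [e] at h2 h3; exact ⟨h2, h3⟩
    · exact ⟨(h2.trans_lt e).le, fun _ => h2.trans_lt e⟩
  · refine Or.inr fun b hb => (h1 b hb).trans ?_
    rcases himp a w hw with e | e
    · rw [e]
    · exact e.le

variable [Fintype G]

open Classical in
/-- The agents with a bundle in the layer `e`, together with all bundles that are at least as
good. -/
noncomputable def layerAgents (v : Fin n → Finset G → ℝ≥0) (X : Fin k → Finset G)
    (f : Fin k → Option (Fin n)) (z : Fin k) (e : ℕ) : Finset (Fin n × Finset G) :=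
  Finset.univ.filter fun s => ∃ a, Within v X f z e a ∧ f a = some s.1 ∧ v s.1 (X a) ≤ v s.1 s.2

open Classical in
/-- The goods outside of the bundles in the layer `e`. -/
noncomputable def layerGoods (v : Fin n → Finset G → ℝ≥0) (X : Fin k → Finset G)
    (f : Fin k → Option (Fin n)) (z : Fin k) (e : ℕ) : Finset (Fin k × G) :=
  Finset.univ.filter fun s => Within v X f z e s.1 ∧ s.2 ∉ X s.1

/-- The layers of `(X, f)`, ranked lexicographically from `z` upwards. -/
noncomputable def layerRank (v : Fin n → Finset G → ℝ≥0) (X : Fin k → Finset G)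
    (f : Fin k → Option (Fin n)) (z : Fin k) (e : ℕ) : ℕ ×ₗ ℕ :=
  toLex ((layerAgents v X f z e).card, (layerGoods v X f z e).card)

theorem mem_layerAgents {e : ℕ} {w : Fin n} {S : Finset G} : (w, S) ∈ layerAgents v X f z e ↔
    ∃ a, Within v X f z e a ∧ f a = some w ∧ v w (X a) ≤ v w S := by
  simp [layerAgents]

theorem mem_layerGoods {e : ℕ} {a : Fin k} {g : G} : (a, g) ∈ layerGoods v X f z e ↔
    Within v X f z e a ∧ g ∉ X a := by
  simp [layerGoods]

theorem lex_card_cases {α β : Type*} {A A' : Finset α} {B B' : Finset β} (hA : A' ⊆ A)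
    (hB : A' = A → B' ⊆ B) :
    (A' = A ∧ B' = B) ∨ toLex (A'.card, B'.card) < toLex (A.card, B.card) := by
  rw [Prod.Lex.toLex_lt_toLex]
  by_cases hA' : A' = A
  · by_cases hB' : B' = B
    · exact Or.inl ⟨hA', hB'⟩
    · exact Or.inr (Or.inr ⟨by rw [hA'], Finset.card_lt_card ((hB hA').ssubset_of_ne hB')⟩)
  · exact Or.inr (Or.inl (Finset.card_lt_card (hA.ssubset_of_ne hA')))

/-- Along a change, either some layer descends and all lower ones are unchanged, or all layers up to
`e` are unchanged. -/
theorem Progress.layers (h : Progress v z X f X' f') (hf : IsAssociation f)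
    (hf' : IsAssociation f') (hz : ∀ ℓ, f ℓ = none ↔ ℓ = z) (hz' : ∀ ℓ, f' ℓ = none ↔ ℓ = z)
    (e : ℕ) :
    (∃ d ≤ e, layerRank v X' f' z d < layerRank v X f z d ∧
      ∀ d' < d, layerRank v X' f' z d' = layerRank v X f z d') ∨
    ((∀ d ≤ e, layerRank v X' f' z d = layerRank v X f z d) ∧
      ∀ a, (Within v X' f' z e a ↔ Within v X f z e a) ∧
        (Within v X f z e a → f' a = f a ∧ X' a = X a)) := by
  have goods : ∀ e, (∀ a, Within v X' f' z e a ↔ Within v X f z e a) →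
      layerGoods v X' f' z e ⊆ layerGoods v X f z e := by
    rintro e he ⟨a, g⟩ hag
    rw [mem_layerGoods] at hag ⊢
    have := (he a).1 hag.1
    exact ⟨this, fun hg => hag.2 (h.subset a this.reach hg)⟩
  have bundles : ∀ e, (∀ a, Within v X' f' z e a ↔ Within v X f z e a) →
      layerGoods v X' f' z e = layerGoods v X f z e → ∀ a, Within v X f z e a → X' a = X a := by
    intro e he hG a ha
    refine (Finset.Subset.antisymm (h.subset a ha.reach) fun g hg => ?_).symm
    by_contra hg'
    have := mem_layerGoods.2 ⟨ha, hg'⟩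
    rw [← hG, mem_layerGoods] at this
    exact this.2 hg
  induction e with
  | zero =>
    -- Layer 0 is the free bundle alone and has no agents.
    have hA : ∀ {Y g}, (∀ ℓ, g ℓ = none ↔ ℓ = z) → layerAgents v Y g z 0 = ∅ := by
      intro Y g hg
      refine Finset.eq_empty_of_forall_notMem fun s hs => ?_
      obtain ⟨a, ha, hw, -⟩ := mem_layerAgents.1 hs
      rw [(hg a).2 ha] at hw
      simp at hw
    have he : ∀ a, Within v X' f' z 0 a ↔ Within v X f z 0 a := fun a => Iff.rfl
    rcases lex_card_cases (A := layerAgents v X f z 0) (A' := layerAgents v X' f' z 0)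
      (by rw [hA hz, hA hz']) fun _ => goods 0 he with ⟨h1, h2⟩ | hlt
    · refine Or.inr ⟨fun d hd => ?_, fun a => ⟨he a, fun ha => ⟨?_, bundles 0 he h2 a ha⟩⟩⟩
      · obtain rfl : d = 0 := by omega
        rw [layerRank, layerRank, h1, h2]
      · rw [(hz a).2 ha, (hz' a).2 ha]
    · exact Or.inl ⟨0, le_rfl, hlt, fun d' hd' => by omega⟩
  | succ e ih =>
    rcases ih with ⟨d, hd, h1⟩ | ⟨hrank, heq⟩
    · exact Or.inl ⟨d, by omega, h1⟩
    -- An agent newly linked to layer `e` envies an unchanged bundle there, so it is not as well off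
    -- as all ancestors of `z` require. By `Progress.agent` its old bundle was no better, so it
    -- envied the same bundle before.
    have origin : ∀ a w, Within v X' f' z (e + 1) a → f' a = some w →
        ∃ a₀, Within v X f z (e + 1) a₀ ∧ f a₀ = some w ∧ v w (X a₀) ≤ v w (X' a) ∧
          (a₀ ≠ a → v w (X a₀) < v w (X' a)) := by
      intro a w ha hw
      rcases ha with ha | ⟨b, hb, u, hu, hlt⟩
      · have ha' := (heq a).1.1 ha
        obtain ⟨h1, h2⟩ := (heq a).2 ha'
        exact ⟨a, Or.inl ha', h1 ▸ hw, by rw [h2], fun h => absurd rfl h⟩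
      · obtain rfl : u = w := by rw [hw] at hu; exact (Option.some_injective _ hu).symm
        have hb' := (heq b).1.1 hb
        rw [((heq b).2 hb').2] at hlt
        rcases h.agent a u hw with ⟨a₀, h1, h2, h3⟩ | h1
        · exact ⟨a₀, Or.inr ⟨b, hb', u, h1, h2.trans_lt hlt⟩, h1, h2, h3⟩
        · exact absurd hlt (not_lt.2 (h1 b hb'.reach))
    have hA : layerAgents v X' f' z (e + 1) ⊆ layerAgents v X f z (e + 1) := by
      rintro ⟨w, S⟩ hs
      obtain ⟨a, ha, hw, hle⟩ := mem_layerAgents.1 hs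
      obtain ⟨a₀, h1, h2, h3, -⟩ := origin a w ha hw
      exact mem_layerAgents.2 ⟨a₀, h1, h2, h3.trans hle⟩
    -- If the agent sets agree, nobody in the layer has improved; as changing bundles means strict
    -- improvement here, each agent has kept its bundle.
    have same : layerAgents v X' f' z (e + 1) = layerAgents v X f z (e + 1) →
        ∀ a w, Within v X f z (e + 1) a → f a = some w →
          Within v X' f' z (e + 1) a ∧ f' a = some w := by
      intro hA a w ha hw
      have := mem_layerAgents.2 ⟨a, ha, hw, le_refl (v w (X a))⟩
      rw [← hA, mem_layerAgents] at this
      obtain ⟨a', ha', hw', hle⟩ := this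
      obtain ⟨a₀, h1, h2, h3, h4⟩ := origin a' w ha' hw'
      obtain rfl := hf.eq_of_eq_some h2 hw
      obtain rfl : a₀ = a' := by
        by_contra hne
        exact absurd (h4 hne) (not_lt.2 hle)
      exact ⟨ha', hw'⟩
    have within : ∀ {Y g} m, Within v Y g z m z := by
      intro Y g m
      induction m with
      | zero => rfl
      | succ m ih => exact Or.inl ih
    have keep : layerAgents v X' f' z (e + 1) = layerAgents v X f z (e + 1) →
        ∀ a, (Within v X' f' z (e + 1) a ↔ Within v X f z (e + 1) a) ∧
          (Within v X f z (e + 1) a → f' a = f a) := by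
      intro hA a
      by_cases haz : a = z
      · subst haz
        exact ⟨iff_of_true (within _) (within _), fun _ => by rw [(hz a).2 rfl, (hz' a).2 rfl]⟩
      obtain ⟨w, hw⟩ := Option.ne_none_iff_exists'.1 (mt (hz a).1 haz)
      obtain ⟨w', hw'⟩ := Option.ne_none_iff_exists'.1 (mt (hz' a).1 haz)
      refine ⟨⟨fun ha => ?_, fun ha => (same hA a w ha hw).1⟩, fun ha => ?_⟩
      · obtain ⟨a₀, h1, h2, -⟩ := origin a w' ha hw'
        obtain rfl := hf'.eq_of_eq_some (same hA a₀ w' h1 h2).2 hw'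
        exact h1
      · rw [(same hA a w ha hw).2, hw]
    rcases lex_card_cases hA fun hA => goods (e + 1) fun a => (keep hA a).1 with ⟨h1, h2⟩ | hlt
    · refine Or.inr ⟨fun d hd => ?_, fun a => ⟨(keep h1 a).1, fun ha => ⟨(keep h1 a).2 ha,
        bundles _ (fun a => (keep h1 a).1) h2 a ha⟩⟩⟩
      rcases Nat.le_succ_iff.1 hd with hd | rfl
      · exact hrank d hd
      · rw [layerRank, layerRank, h1, h2]
    · exact Or.inl ⟨e + 1, le_rfl, hlt, fun d' hd' => hrank d' (by omega)⟩

/-- The lexicographic rank of all layers. -/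
noncomputable def rank (v : Fin n → Finset G → ℝ≥0) (X : Fin k → Finset G)
    (f : Fin k → Option (Fin n)) (z : Fin k) : Lex (Fin k → ℕ ×ₗ ℕ) :=
  toLex fun e => layerRank v X f z e

theorem rank_lt {d : ℕ} (hd : d < k) (hlt : layerRank v X' f' z d < layerRank v X f z d)
    (heq : ∀ d' < d, layerRank v X' f' z d' = layerRank v X f z d') :
    rank v X' f' z < rank v X f z :=
  ⟨⟨d, hd⟩, fun d' hd' => heq d' hd', hlt⟩

theorem Progress.rank_le (h : Progress v z X f X' f') (hf : IsAssociation f)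
    (hf' : IsAssociation f') (hz : ∀ ℓ, f ℓ = none ↔ ℓ = z) (hz' : ∀ ℓ, f' ℓ = none ↔ ℓ = z) :
    rank v X' f' z ≤ rank v X f z := by
  have hk := z.isLt
  rcases h.layers hf hf' hz hz' (k - 1) with ⟨d, hd, hlt, heq⟩ | ⟨heq, -⟩
  · exact (rank_lt (by omega) hlt heq).le
  · refine le_of_eq (congrArg toLex (funext fun e : Fin k => heq e ?_))
    omega

theorem Progress.rank_lt (h : Progress v z X f X' f') (hf : IsAssociation f)
    (hf' : IsAssociation f') (hz : ∀ ℓ, f ℓ = none ↔ ℓ = z) (hz' : ∀ ℓ, f' ℓ = none ↔ ℓ = z)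
    {e : ℕ} (he : e < k) {a : Fin k} (ha : Within v X f z e a) (hne : X' a ≠ X a) :
    rank v X' f' z < rank v X f z := by
  rcases h.layers hf hf' hz hz' e with ⟨d, hd, hlt, heq⟩ | ⟨-, heq⟩
  · exact FairDivision.rank_lt (by omega) hlt heq
  · exact absurd ((heq a).2 ha).2 hne

end Layers

/-! ### Phase 1: the secondary measure. -/

section NotBest

variable {G : Type*} [DecidableEq G] {n k : ℕ} {v : Fin n → Finset G → ℝ≥0}
  {X : Fin k → Finset G} {f : Fin k → Option (Fin n)}

open Classical in
/-- The bundles that are not EFX-best for their agents. -/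
noncomputable def notBest (v : Fin n → Finset G → ℝ≥0) (X : Fin k → Finset G)
    (f : Fin k → Option (Fin n)) : Finset (Fin k) :=
  Finset.univ.filter fun ℓ => ∃ w, f ℓ = some w ∧ ¬ EFXBest (v w) X ℓ

theorem notBest_update {p : Fin k} {i j : Fin n} (hi : EFXBest (v i) X p) (hj : f p = some j)
    (hn : ¬ EFXBest (v j) X p) :
    (notBest v X (Function.update f p (some i))).card < (notBest v X f).card := by
  refine Finset.card_lt_card ((Finset.ssubset_iff_of_subset fun ℓ hℓ => ?_).2 ⟨p, ?_, ?_⟩)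
  · simp only [notBest, Finset.mem_filter, Finset.mem_univ, true_and] at hℓ ⊢
    obtain ⟨w, hw, hb⟩ := hℓ
    by_cases h : ℓ = p
    · subst h
      rw [Function.update_self] at hw
      exact absurd (Option.some_injective _ hw ▸ hi) hb
    · rw [Function.update_of_ne h] at hw
      exact ⟨w, hw, hb⟩
  · simpa [notBest, hj] using hn
  · simpa [notBest] using hi

end NotBest

/-! ### Phase 1: invariants and correctness of ReBalance. -/

section FirstPhase

variable {G : Type*} [Fintype G] [DecidableEq G] {n k : ℕ} {v : Fin n → Finset G → ℝ≥0}
  {fm : FindMins v} {X : Fin k → Finset G} {f : Fin k → Option (Fin n)} {z : Fin k}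

/-- Precisely the bundle `z` is free. -/
structure OneFree (v : Fin n → Finset G → ℝ≥0) (X : Fin k → Finset G) (f : Fin k → Option (Fin n))
    (z : Fin k) : Prop where
  part : IsPartition Finset.univ X
  fair : PartialFair v X f
  free : ∀ ℓ, f ℓ = none ↔ ℓ = z

theorem OneFree.rotate (h : OneFree v X f z) {a : Fin k} {c : List (Fin k)}
    (hc : IsCycle v X f a c) : OneFree v X (rotate f a c) z where
  part := h.part
  fair := h.fair.improves hc.improves
  free ℓ := (hc.rotate_eq_none ℓ).trans (h.free ℓ)

/-- A bundle that a free agent accepts is not connected to the free bundle. -/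
theorem OneFree.not_reach (h : OneFree v X f z) (hn : ¬ HasFairAssociation v X) {w : Fin n}
    (hw : ∀ ℓ, f ℓ ≠ some w) {p : Fin k} (hp : Fair (v w) X p) :
    ¬ Relation.ReflTransGen (Accepts v X f) p z := by
  intro hpz
  obtain ⟨g, h1, h2, h3⟩ := h.fair.reroute ((h.free z).2 rfl) hpz
  refine hn ((h1.update (w := w) (fun ℓ hℓ => ?_) hp).hasFair fun ℓ => ?_)
  · obtain ⟨a, ha⟩ := h3 ℓ w hℓ
    exact hw a ha
  · by_cases hℓ : ℓ = p
    · simp [hℓ]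
    · rw [Function.update_of_ne hℓ, Ne, h2, h.free]
      rintro (e | ⟨e, e'⟩)
      · exact hℓ e
      · exact e e'

/-- The remainder of an EFX-best bundle without its smallest good bounds every bundle after a
removal. Hence an agent who rejects a bundle values it strictly below this remainder. -/
theorem EFXBest.fair_of_lt {u : Finset G → ℝ≥0} (hu : Monotone u)
    (hX : IsPartition Finset.univ X) {p b : Fin k} (h : EFXBest u X p) {x : G}
    (hx : x ∈ minGoods u (X p)) (hb : u ((X p).erase x) ≤ u (X b)) : Fair u X b :=
  EFXFeasible.fair hu hX (efxFeasible_iff.2 fun ℓ _ => (h.removalBound hx ℓ).mono hb)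

/-- Moving a good to an unenvied bundle from the EFX-best bundle of an agent `u` who gets this
bundle and does not accept the ancestors of the free bundle. -/
theorem OneFree.moveGood (hv : ∀ w, Monotone (v w)) (h : OneFree v X f z) {p q : Fin k} {x : G}
    {u : Fin n} (hu : ∀ b, Relation.ReflTransGen (Edge v X f) b z → ¬ Fair (v u) X b)
    (hp : ¬ Relation.ReflTransGen (Edge v X f) p z) (hother : ∀ ℓ, ℓ ≠ p → f ℓ ≠ some u)
    (hbest : EFXBest (v u) X p) (hx : x ∈ minGoods (v u) (X p))
    (hq : Relation.ReflTransGen (Edge v X f) q z) (hsource : ∀ a, ¬ Edge v X f a q)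
    (hle : v u (insert x (X q)) ≤ v u ((X p).erase x)) :
    OneFree v (moveGood X p q x) (Function.update f p (some u)) z ∧
      Progress v z X f (moveGood X p q x) (Function.update f p (some u)) := by
  have hpq : p ≠ q := fun e => hp (e ▸ hq)
  have hpz : p ≠ z := fun e => hp (e ▸ .refl)
  -- If `x` were the only good of `X p`, the remainder would be empty, and `u` would accept the free
  -- bundle.
  have hcard : 1 < (X p).card := by
    by_contra hcard
    have he : (X p).erase x = ∅ := by
      rw [← Finset.card_eq_zero, Finset.card_erase_of_mem hx.1]; omega
    exact hu z .refl (hbest.fair_of_lt (hv u) h.part hx (he ▸ hv u (Finset.empty_subset _)))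
  have hpart := h.part.moveGood hpq hx.1
  refine ⟨⟨hpart, ?_, fun ℓ => ?_⟩, fun b hb => ?_, fun a w hw => ?_⟩
  · have h0 : PartialFair v (FairDivision.moveGood X p q x) (Function.update f p none) := by
      refine (h.fair.update_none p).moveGood hv (by simp) hpq hx.1 hcard ?_
      rintro a ⟨w, hw, hlt⟩
      by_cases ha : a = p
      · simp [ha] at hw
      · rw [Function.update_of_ne ha] at hw
        exact hsource a ⟨w, hw, hlt⟩
    -- `p` is vacated first, because `u` may already own it and need not be free in `f`.
    rw [← Function.update_idem (a := p) none (some u) f]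
    refine h0.update (fun ℓ => ?_)
      (EFXFeasible.fair (hv u) hpart (efxFeasible_iff.2 fun ℓ hℓ => ?_))
    · by_cases hℓ : ℓ = p
      · simp [hℓ]
      · rw [Function.update_of_ne hℓ]; exact hother ℓ hℓ
    · rw [moveGood_source hpq]
      by_cases hℓq : ℓ = q
      · subst hℓq
        rw [moveGood_target hpq]
        exact RemovalBound.of_le (hv u) hle
      · rw [moveGood_other hℓ hℓq]
        exact hbest.removalBound hx ℓ
  · by_cases hℓ : ℓ = p
    · simp [hℓ, hpz]
    · rw [Function.update_of_ne hℓ, h.free]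
  · exact subset_moveGood hpq fun e => hp (e ▸ hb)
  · by_cases ha : a = p
    · subst ha
      rw [Function.update_self] at hw
      obtain rfl := Option.some_injective _ hw
      refine Or.inr fun b hb => ?_
      rw [moveGood_source hpq]
      by_contra hlt
      exact hu b hb (hbest.fair_of_lt (hv u) h.part hx (not_le.1 hlt).le)
    · rw [Function.update_of_ne ha] at hw
      exact Or.inl ⟨a, hw, hv w (subset_moveGood hpq ha), fun h => absurd rfl h⟩

/-- Giving the EFX-best bundle `p` of a free agent to this agent. -/
theorem OneFree.update (h : OneFree v X f z)
    (hn : ¬ HasFairAssociation v X) {i : Fin n} (hi : ∀ ℓ, f ℓ ≠ some i) {p : Fin k}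
    (hp : Fair (v i) X p) :
    OneFree v X (Function.update f p (some i)) z ∧
      Progress v z X f X (Function.update f p (some i)) := by
  have hpz : p ≠ z := fun e => h.not_reach hn hi hp (e ▸ .refl)
  refine ⟨⟨h.part, h.fair.update hi hp, fun ℓ => ?_⟩, fun _ _ => Finset.Subset.rfl,
    fun a w hw => ?_⟩
  · by_cases hℓ : ℓ = p
    · simp [hℓ, hpz]
    · rw [Function.update_of_ne hℓ, h.free]
  · by_cases ha : a = p
    · subst ha
      rw [Function.update_self] at hw
      obtain rfl := Option.some_injective _ hw
      refine Or.inr fun b hb => ?_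
      by_contra hlt
      exact h.not_reach hn hi (hp.mono (not_le.1 hlt).le) (h.fair.accepts_reach hb)
    · rw [Function.update_of_ne ha] at hw
      exact Or.inl ⟨a, hw, le_rfl, fun h => absurd rfl h⟩

/-- The state after Phase 1. -/
theorem OneFree.twoFree (h : OneFree v X f z) (hn : ¬ HasFairAssociation v X) {i j : Fin n}
    (hi : ∀ ℓ, f ℓ ≠ some i) {p q : Fin k} {c : List (Fin k)} (hj : f p = some j)
    (hp : ¬ Relation.ReflTransGen (Edge v X f) p z) (hc : IsChainTo v X f q z c) :
    TwoFree v X (Function.update (shiftSubChain f c) p none) p q i j ∧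
      ∀ a, ¬ Edge v X (Function.update (shiftSubChain f c) p none) a q := by
  have hz : f z = none := (h.free z).2 rfl
  have hpq : p ≠ q := fun e => hp (e ▸ hc.reflTransGen)
  have himp := hc.improves hz
  refine ⟨⟨h.part, (h.fair.improves himp).update_none p, hpq, fun ℓ => ?_, ?_, fun ℓ => ?_,
    fun ℓ => ?_, hn⟩, ?_⟩
  · by_cases hℓ : ℓ = p
    · simp [hℓ]
    · rw [Function.update_of_ne hℓ, hc.shift_eq_none hz, h.free]
      constructor
      · rintro (e | ⟨e, e'⟩)
        · exact Or.inr e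
        · exact absurd e' e
      · rintro (e | e)
        · exact absurd e hℓ
        · exact Or.inl e
  · rintro rfl
    exact hi p hj
  · by_cases hℓ : ℓ = p
    · simp [hℓ]
    · rw [Function.update_of_ne hℓ, hc.shift_eq hz]
      exact hi _
  · by_cases hℓ : ℓ = p
    · simp [hℓ]
    rw [Function.update_of_ne hℓ, hc.shift_eq hz, Function.comp_apply]
    intro hw
    -- `j` owned only `p`, which is not an ancestor of `z`; so no bundle receives `j` by the shift.
    have e := h.fair.assoc.eq_of_eq_some hw hj
    rcases formPerm_apply_of_isChain hc.2.2.1 hc.2.2.2.1 hc.1 hc.2.1 ℓ with ⟨-, h'⟩ | ⟨-, h'⟩ | h'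
    · exact hℓ (h'.symm.trans e)
    · exact hp (h'.symm.trans e ▸ .refl)
    · obtain ⟨d, -, hd⟩ := hc.exists_within h'.1
      exact hp (hd.reach.head (e ▸ h'.2.2))
  · rintro a ⟨w, hw, hlt⟩
    by_cases ha : a = p
    · simp [ha] at hw
    · rw [Function.update_of_ne ha] at hw
      exact himp.source hc.2.2.2.2 a ⟨w, hw, hlt⟩

/-- Otherwise `n` agents would inject into the `k - 1` associated bundles. -/
theorem OneFree.exists_free_agent (h : OneFree v X f z) (hk : k ≤ n) :
    ∃ i, ∀ ℓ, f ℓ ≠ some i := by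
  by_contra! hall
  choose a ha using hall
  have hinj : Function.Injective a := fun x y hxy => by
    have := ha x
    rw [hxy, ha y] at this
    exact (Option.some_injective _ this).symm
  have : Finset.univ.image a ⊆ Finset.univ.erase z := by
    intro ℓ hℓ
    obtain ⟨i, -, rfl⟩ := Finset.mem_image.1 hℓ
    rw [Finset.mem_erase, Ne, ← h.free, ha]
    simp
  have hcard := Finset.card_le_card this
  rw [Finset.card_image_of_injective _ hinj, Finset.card_erase_of_mem (Finset.mem_univ z)] at hcard
  simp only [Finset.card_univ, Fintype.card_fin] at hcard
  have := z.isLt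
  omega

/-- `ReBalance` is correct. -/
theorem rgood_test (hv : ∀ w, Monotone (v w)) (hr : ∀ w, RestrictedMMSFeasible (v w)) (hk : k ≤ n)
    (hz : z.val + 1 = k) (μ : Lex (Fin k → ℕ ×ₗ ℕ) ×ₗ ℕ) :
    ∀ (X : Fin k → Finset G) (f : Fin k → Option (Fin n)),
      toLex (rank v X f z, (notBest v X f).card) = μ → OneFree v X f z → AcyclicTo v X f z →
      RGood v fm (.test X f) := by
  -- Moving a good into an ancestor of `z` lowers the rank strictly, even after rotations. A
  -- reassignment never raises the rank and lowers the number of bundles that are not EFX-best for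
  -- their owners.
  induction μ using WellFoundedLT.induction with
  | ind μ ih =>
  rintro X f rfl h hac
  refine .step ?_ fun s hs => ?_
  · by_cases hn : HasFairAssociation v X
    · exact ⟨_, .test_ret hn.choose_spec⟩
    · exact ⟨_, .test_fail hn⟩
  cases hs with
  | test_ret hf => exact .ret h.part hf
  | test_fail hn =>
  refine .step ?_ fun s hs => ?_
  · obtain ⟨i, hi⟩ := h.exists_free_agent hk
    obtain ⟨p, hp⟩ := exists_efxBest (v i) X z.pos
    exact ⟨_, .pick hi hp⟩
  cases hs with
  | @pick _ _ i p hi hbest =>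
  have hip := (hbest.efxFeasible (hv i)).fair (hv i) h.part
  have hpacc := h.not_reach hn hi hip
  have hpz : p ≠ z := fun e => hpacc (e ▸ .refl)
  have hpreach : ¬ Relation.ReflTransGen (Edge v X f) p z := fun e => hpacc (h.fair.accepts_reach e)
  obtain ⟨j, hj⟩ := Option.ne_none_iff_exists'.1 (mt (h.free p).1 hpz)
  refine .step ?_ fun s hs => ?_
  · by_cases hbj : EFXBest (v j) X p
    · have hne : (X p).Nonempty := by
        by_contra hne
        -- If an EFX-best bundle is empty, all bundles are, and `i` would accept the free one.
        refine h.not_reach hn hi (EFXFeasible.fair (hv i) h.part (efxFeasible_iff.2 ?_)) .refl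
        intro ℓ _ g hg
        exact absurd (hbest.nonempty ⟨g, hg⟩) hne
      exact ⟨_, .compare_keep hj hbj hne⟩
    · exact ⟨_, .compare_swap hj hbj⟩
  have hjp := h.fair.fair p j hj
  cases hs with
  | @compare_swap _ _ _ _ j' hj' hnb =>
    obtain rfl : j = j' := Option.some_injective _ (hj.symm.trans hj')
    obtain ⟨h', hprog⟩ := h.update hn hi hip
    refine ih _ ?_ _ _ rfl h' (hac.update fun hreach => ?_)
    · rw [Prod.Lex.toLex_lt_toLex]
      rcases (hprog.rank_le h.fair.assoc h'.fair.assoc h.free h'.free).lt_or_eq with hlt | heq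
      · exact Or.inl hlt
      · exact Or.inr ⟨heq, notBest_update hbest hj hnb⟩
    -- No cycles are eliminated after this step. The displaced agent `j` is now free and still
    -- accepts `p`, so `p` is not an ancestor of `z` and the ancestors stay acyclic.
    · refine h'.not_reach hn (w := j) (fun ℓ => ?_) hjp (h'.fair.accepts_reach hreach)
      by_cases hℓ : ℓ = p
      · subst hℓ
        rw [Function.update_self]
        intro e
        exact hi ℓ (e ▸ hj)
      · rw [Function.update_of_ne hℓ]
        exact fun e => hℓ (h.fair.assoc.eq_of_eq_some e hj)
  | @compare_keep _ _ _ _ j' hj' hbj hne =>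
  obtain rfl : j = j' := Option.some_injective _ (hj.symm.trans hj')
  refine .step ?_ fun s hs => ?_
  · obtain ⟨q, c, hc⟩ := hac.exists_isChainTo
    exact ⟨_, .chain1 hz hc⟩
  cases hs with
  | @chain1 _ _ _ _ _ _ _ z' q c hz' hc =>
  obtain rfl : z = z' := Fin.ext (by omega)
  have hpq : p ≠ q := fun e => hpreach (e ▸ hc.reflTransGen)
  obtain ⟨e, he, hwithin⟩ := hc.exists_within (List.mem_of_getLast? hc.2.1)
  have hui : ∀ b, Relation.ReflTransGen (Edge v X f) b z → ¬ Fair (v i) X b := fun b hb hib =>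
    h.not_reach hn hi hib (h.fair.accepts_reach hb)
  have huj : ∀ b, Relation.ReflTransGen (Edge v X f) b z → ¬ Fair (v j) X b := fun b hb hjb =>
    hpacc ((h.fair.accepts_reach hb).head ⟨j, hj, hjb⟩)
  have move : ∀ u x, (∀ b, Relation.ReflTransGen (Edge v X f) b z → ¬ Fair (v u) X b) →
      (∀ ℓ, ℓ ≠ p → f ℓ ≠ some u) → EFXBest (v u) X p → x ∈ minGoods (v u) (X p) →
      v u (insert x (X q)) ≤ v u ((X p).erase x) →
      RGood v fm (.elim1 (moveGood X p q x) (Function.update f p (some u))) := by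
    intro u x hu hother hb hx hle
    refine rgood_elim1_of
      (K := fun g => OneFree v (moveGood X p q x) g z ∧ Progress v z X f (moveGood X p q x) g)
      (fun g hg => hg.1.fair.assoc)
      (fun g a c hg hc => ⟨hg.1.rotate hc, hg.2.improves hc.improves⟩) ?_ _
      (h.moveGood hv hu hpreach hother hb hx hc.reflTransGen hc.2.2.2.2 hle)
    rintro g ⟨hg, hprog⟩ hcyc
    refine ih _ ?_ _ _ rfl hg fun a _ => hcyc.not_transGen a
    rw [Prod.Lex.toLex_lt_toLex]
    refine Or.inl (hprog.rank_lt h.fair.assoc hg.fair.assoc h.free hg.free he hwithin ?_)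
    rw [moveGood_target hpq, Ne, Finset.insert_eq_self]
    exact h.part.notMem hpq hx.1
  refine .step ?_ fun s hs => ?_
  · by_cases h1 : v i (insert (fm.pick (X p) hne i j).1 (X q)) ≤
        v i ((X p).erase (fm.pick (X p) hne i j).1)
    · exact ⟨_, .move1_i h1⟩
    by_cases h2 : v j (insert (fm.pick (X p) hne i j).2 (X q)) ≤
        v j ((X p).erase (fm.pick (X p) hne i j).2)
    · exact ⟨_, .move1_j h2⟩
    · exact ⟨_, .move1_break h1 h2⟩
  cases hs with
  | move1_i h1 => exact move i _ hui (fun ℓ _ => hi ℓ) hbest (fm.fst_mem _ _ _ _) h1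
  | move1_j h1 =>
    exact move j _ huj (fun ℓ hℓ e => hℓ (h.fair.assoc.eq_of_eq_some e hj)) hbj
      (fm.snd_mem _ _ _ _) h1
  | move1_break _ h2 =>
    exact rgood_elim2 hv hr hne hbest hbj (not_le.1 h2) _ (h.twoFree hn hi hj hpreach hc)

end FirstPhase

/-! ### Appending an empty free bundle. -/

section Growth

variable {G : Type*} {n k : ℕ} {v : Fin n → Finset G → ℝ≥0}
  {X : Fin k → Finset G} {f : Fin k → Option (Fin n)}

/-- The bundles `X` and an additional empty bundle. -/
def addEmpty (X : Fin k → Finset G) : Fin (k + 1) → Finset G :=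
  Fin.snoc (α := fun _ => Finset G) X ∅

/-- The additional bundle is free. -/
def addFree (f : Fin k → Option (Fin n)) : Fin (k + 1) → Option (Fin n) :=
  Fin.snoc (α := fun _ => Option (Fin n)) f none

@[simp]
theorem addEmpty_castSucc (X : Fin k → Finset G) (ℓ : Fin k) : addEmpty X ℓ.castSucc = X ℓ :=
  Fin.snoc_castSucc (α := fun _ => Finset G) ..

@[simp]
theorem addEmpty_last (X : Fin k → Finset G) : addEmpty X (Fin.last k) = ∅ :=
  Fin.snoc_last (α := fun _ => Finset G) ..

@[simp]
theorem addFree_castSucc (f : Fin k → Option (Fin n)) (ℓ : Fin k) : addFree f ℓ.castSucc = f ℓ :=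
  Fin.snoc_castSucc (α := fun _ => Option (Fin n)) ..

@[simp]
theorem addFree_last (f : Fin k → Option (Fin n)) : addFree f (Fin.last k) = none :=
  Fin.snoc_last (α := fun _ => Option (Fin n)) ..

theorem addFree_eq_none (hf : IsFull f) (ℓ : Fin (k + 1)) :
    addFree f ℓ = none ↔ ℓ = Fin.last k := by
  induction ℓ using Fin.lastCases with
  | last => simp
  | cast ℓ => simpa using hf ℓ

theorem Edge.of_addEmpty {a b : Fin (k + 1)} (h : Edge v (addEmpty X) (addFree f) a b) :
    ∃ a₀ : Fin k, a = a₀.castSucc ∧ ∀ b₀ : Fin k, b = b₀.castSucc → Edge v X f a₀ b₀ := by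
  obtain ⟨w, hw, hlt⟩ := h
  induction a using Fin.lastCases with
  | last => simp at hw
  | cast a => exact ⟨a, rfl, fun b₀ hb => ⟨w, by simpa using hw, by simpa [hb] using hlt⟩⟩

/-- The new bundle is free, so it has no outgoing edge, and any cycle would already be one of the
old graph. -/
theorem NoCycle.addEmpty (h : NoCycle v X f) (z : Fin (k + 1)) :
    AcyclicTo v (addEmpty X) (addFree f) z := by
  intro a _ hcyc
  have key : ∀ {a : Fin (k + 1)} {b : Fin k},
      Relation.TransGen (Edge v (FairDivision.addEmpty X) (addFree f)) a b.castSucc →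
      ∃ a₀ : Fin k, a = a₀.castSucc ∧ Relation.TransGen (Edge v X f) a₀ b := by
    intro a b hab
    induction hab using Relation.TransGen.head_induction_on with
    | single hab =>
      obtain ⟨a₀, ha, hb⟩ := hab.of_addEmpty
      exact ⟨a₀, ha, .single (hb b rfl)⟩
    | head hac _ ih =>
      obtain ⟨c₀, hc, hcb⟩ := ih
      obtain ⟨a₀, ha, hb⟩ := hac.of_addEmpty
      exact ⟨a₀, ha, .head (hb c₀ hc) hcb⟩
  obtain ⟨b, hab, -⟩ := Relation.TransGen.head'_iff.1 hcyc
  obtain ⟨a₀, rfl, -⟩ := hab.of_addEmpty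
  obtain ⟨a₁, h1, h2⟩ := key hcyc
  rw [Fin.castSucc_injective _ h1] at h2
  exact h.not_transGen _ h2

variable [DecidableEq G]

theorem IsPartition.addEmpty {S : Finset G} (h : IsPartition S X) :
    IsPartition S (addEmpty X) := by
  refine ⟨fun a b => ?_, ?_⟩
  · induction a using Fin.lastCases with
    | last => simp
    | cast a =>
      induction b using Fin.lastCases with
      | last => simp
      | cast b =>
        intro hab
        simpa using h.1 a b fun e => hab (congrArg _ e)
  · rw [← h.2]
    ext g
    simp [Fin.exists_fin_succ']

theorem EFXFeasible.addEmpty {u : Finset G → ℝ≥0} {ℓ : Fin k} (h : EFXFeasible u X ℓ) :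
    EFXFeasible u (addEmpty X) ℓ.castSucc := by
  rw [efxFeasible_iff] at h ⊢
  intro b
  induction b using Fin.lastCases with
  | last => intro _ g hg; simp at hg
  | cast b =>
    intro hb
    simpa using h b fun e => hb (congrArg _ e)

/-- An empty bundle arouses neither kind of envy, so the partition witnessing MXS can be enlarged by
one as well. -/
theorem Fair.addEmpty [Fintype G] {u : Finset G → ℝ≥0} {ℓ : Fin k} (h : Fair u X ℓ) :
    Fair u (addEmpty X) ℓ.castSucc := by
  refine ⟨?_, ?_⟩
  · obtain ⟨Y, h1, h2, h3⟩ := h.1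
    exact ⟨FairDivision.addEmpty Y, h1.addEmpty, h2.addEmpty, by simpa using h3⟩
  · have := eflFeasible_iff.1 h.2
    rw [eflFeasible_iff]
    intro b
    induction b using Fin.lastCases with
    | last => simp
    | cast b => simpa using this b

theorem PartialFair.addEmpty [Fintype G] (h : PartialFair v X f) :
    PartialFair v (addEmpty X) (addFree f) := by
  refine ⟨fun a b => ?_, fun ℓ w => ?_⟩
  · induction a using Fin.lastCases with
    | last =>
      induction b using Fin.lastCases with
      | last => simp
      | cast b =>
        intro _
        by_cases hb : f b = none
        · exact Or.inr (by simp [hb])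
        · exact Or.inl (by simpa using Ne.symm hb)
    | cast a =>
      induction b using Fin.lastCases with
      | last =>
        intro _
        by_cases ha : f a = none
        · exact Or.inr (by simp [ha])
        · exact Or.inl (by simpa using ha)
      | cast b =>
        intro hab
        simpa using h.assoc a b fun e => hab (congrArg _ e)
  · induction ℓ using Fin.lastCases with
    | last => simp
    | cast ℓ =>
      intro hw
      exact (h.fair ℓ w (by simpa using hw)).addEmpty

end Growth

/-! ### The main loop and the final statements. -/

section Algorithm

variable {G : Type*} [Fintype G] [DecidableEq G] {n : ℕ} {v : Fin n → Finset G → ℝ≥0}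
  {fm : FindMins v}

/-- Every execution of the main algorithm from the given state is finite and returns an MXS and EFL
allocation. -/
inductive CGood (v : Fin n → Finset G → ℝ≥0) (fm : FindMins v) : Config G n → Prop where
  | halt {X f} (h : IsMXSEFLAllocation v X f) : CGood v fm (.halt X f)
  | step {s} (h : ∃ s', Step v fm s s') (h' : ∀ s', Step v fm s s' → CGood v fm s') : CGood v fm s

theorem cgood_rebalance {k : ℕ} {s : RState G n k} (h : RGood v fm s)
    (hret : ∀ X f, IsPartition Finset.univ X → FullFairAssociation v X f →
      CGood v fm (.loop k X f)) : CGood v fm (.rebalance k s) := by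
  induction h with
  | @ret X f hX hf =>
    refine .step ⟨_, .leave⟩ fun s' hs => ?_
    cases hs with
    | inner hs => cases hs
    | leave => exact hret X f hX hf
  | step h h' ih =>
    refine .step ?_ fun s' hs => ?_
    · obtain ⟨s', hs⟩ := h
      exact ⟨_, .inner hs⟩
    · cases hs with
      | inner hs => exact ih _ hs
      | leave =>
        obtain ⟨s', hs⟩ := h
        cases hs

theorem FullFairAssociation.isMXSEFLAllocation {X : Fin n → Finset G} {f : Fin n → Option (Fin n)}
    (hX : IsPartition Finset.univ X) (h : FullFairAssociation v X f) :
    IsMXSEFLAllocation v X f := by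
  refine ⟨hX, h.1, h.2.1, fun i => ?_⟩
  choose a ha using fun ℓ => Option.ne_none_iff_exists'.1 (h.2.1 ℓ)
  -- The `n` bundles have distinct agents, so all `n` agents occur.
  have hinj : Function.Injective a := fun x y hxy =>
    h.1.eq_of_eq_some (ha x) (hxy ▸ ha y)
  obtain ⟨ℓ, rfl⟩ := Finite.surjective_of_injective hinj i
  exact ⟨ℓ, ha ℓ, h.2.2 ℓ _ (ha ℓ)⟩

theorem cgood_elim (hv : ∀ w, Monotone (v w)) (hr : ∀ w, RestrictedMMSFeasible (v w)) {k : ℕ}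
    (hk : k < n) (hnext : ∀ X f, IsPartition Finset.univ X → FullFairAssociation v X f →
      CGood v fm (.loop (k + 1) X f))
    {X : Fin k → Finset G} (hX : IsPartition Finset.univ X) :
    ∀ f, FullFairAssociation v X f → CGood v fm (.elim k X f) := by
  refine rotate_induction (v := v) (X := X) (fun f hf => hf.1)
    (fun f a c hf hc => ?_) fun f hf ih => .step ?_ ?_
  · have h : PartialFair v X (rotate f a c) := PartialFair.improves ⟨hf.1, hf.2.2⟩ hc.improves
    exact ⟨h.assoc, fun ℓ hℓ => hf.2.1 ℓ ((hc.rotate_eq_none ℓ).1 hℓ), h.fair⟩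
  · by_cases hc : NoCycle v X f
    · exact ⟨_, .grow hc⟩
    · simp only [NoCycle, not_forall, not_not] at hc
      obtain ⟨a, c, hc⟩ := hc
      exact ⟨_, .rotate hc⟩
  · intro s' hs
    cases hs with
    | rotate hc => exact ih _ _ hc
    | grow hc =>
      exact cgood_rebalance
        (rgood_test hv hr hk (z := Fin.last k) rfl _ (addEmpty X) (addFree f) rfl
        ⟨hX.addEmpty, PartialFair.addEmpty ⟨hf.1, hf.2.2⟩, addFree_eq_none hf.2.1⟩
        (hc.addEmpty _)) hnext

theorem cgood_loop (hv : ∀ w, Monotone (v w)) (hr : ∀ w, RestrictedMMSFeasible (v w)) {k : ℕ}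
    (hk : k ≤ n) : ∀ X f, IsPartition Finset.univ X → FullFairAssociation v X f →
      CGood v fm (.loop k X f) := by
  induction hk using Nat.decreasingInduction with
  | self =>
    intro X f hX hf
    refine .step ⟨_, .halt⟩ fun s' hs => ?_
    cases hs with
    | enter hk => exact absurd hk (lt_irrefl _)
    | halt => exact .halt (hf.isMXSEFLAllocation hX)
  | of_succ k hk ih =>
    intro X f hX hf
    refine .step ⟨_, .enter hk⟩ fun s' hs => ?_
    cases hs with
    | enter => exact cgood_elim hv hr hk ih hX f hf
    | halt => exact absurd hk (lt_irrefl _)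

theorem cgood_start (hn : 0 < n) (hv : ∀ w, Monotone (v w))
    (hr : ∀ w, RestrictedMMSFeasible (v w)) : CGood v fm (start G hn) := by
  have hX : IsPartition (Finset.univ : Finset G) fun _ : Fin 1 => Finset.univ :=
    ⟨fun a b hab => absurd (Subsingleton.elim a b) hab, by simp⟩
  refine cgood_loop hv hr hn _ _ hX
    ⟨fun a b hab => absurd (Subsingleton.elim a b) hab, fun _ => by simp, fun ℓ i _ => ?_⟩
  exact EFXFeasible.fair (hv i) hX fun b hb => absurd (Subsingleton.elim b ℓ) hb

theorem CGood.not_infinite {s : Config G n} (h : CGood v fm s) :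
    ¬ ∃ σ : ℕ → Config G n, σ 0 = s ∧ ∀ t, Step v fm (σ t) (σ (t + 1)) := by
  induction h with
  | halt _ =>
    rintro ⟨σ, h0, hσ⟩
    have := hσ 0
    rw [h0] at this
    cases this
  | step _ _ ih =>
    rintro ⟨σ, rfl, hσ⟩
    exact ih _ (hσ 0) ⟨fun t => σ (t + 1), rfl, fun t => hσ (t + 1)⟩

theorem CGood.reach {s s' : Config G n} (h : CGood v fm s)
    (hs : Relation.ReflTransGen (Step v fm) s s') : CGood v fm s' := by
  induction hs with
  | refl => exact h
  | tail _ hstep ih =>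
    cases ih with
    | halt _ => cases hstep
    | step _ h' => exact h' _ hstep

theorem CGood.exists_allocation {s : Config G n} (h : CGood v fm s) :
    ∃ X f, IsMXSEFLAllocation v X f := by
  induction h with
  | halt h => exact ⟨_, _, h⟩
  | step h _ ih =>
    obtain ⟨s', hs⟩ := h
    exact ih s' hs

theorem alwaysTerminates (hn : 0 < n) (hv : ∀ w, Monotone (v w))
    (hr : ∀ w, RestrictedMMSFeasible (v w)) (fm : FindMins v) : AlwaysTerminates hn v fm :=
  (cgood_start hn hv hr).not_infinite

theorem alwaysCorrect (hn : 0 < n) (hv : ∀ w, Monotone (v w))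
    (hr : ∀ w, RestrictedMMSFeasible (v w)) (fm : FindMins v) : AlwaysCorrect hn v fm := by
  intro s hs hstuck
  cases (cgood_start hn hv hr).reach hs with
  | halt h => exact ⟨_, _, rfl, h⟩
  | step h _ =>
    obtain ⟨s', hs'⟩ := h
    exact absurd hs' (hstuck s')

theorem exists_allocation (hn : 0 < n) (hv : ∀ w, Monotone (v w))
    (hr : ∀ w, RestrictedMMSFeasible (v w)) : ∃ X f, IsMXSEFLAllocation v X f := by
  obtain ⟨fm⟩ := FindMins.exists v
  exact (cgood_start (fm := fm) hn hv hr).exists_allocation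

end Algorithm

end FairDivision

theorem theorem1 {G : Type*} [Fintype G] [DecidableEq G] {n : ℕ} (hn : 0 < n) :
    (∀ v : Fin n → Finset G → ℝ≥0,
      (∀ i, Monotone (v i)) → (∀ i, RestrictedMMSFeasible (v i)) →
        (∀ fm : FindMins v, AlwaysTerminates hn v fm ∧ AlwaysCorrect hn v fm) ∧
        ∃ X f, IsMXSEFLAllocation v X f) ∧
    (∀ v : Fin n → Finset G → ℝ≥0, (∀ i, IsAdditive (v i)) →
      (∀ i, Monotone (v i) ∧ RestrictedMMSFeasible (v i)) ∧
        ∃ X f, IsMXSEFLAllocation v X f) :=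
  ⟨fun _ hv hr => ⟨fun fm => ⟨alwaysTerminates hn hv hr fm, alwaysCorrect hn hv hr fm⟩,
      exists_allocation hn hv hr⟩,
    fun _ h => ⟨fun i => ⟨(h i).monotone, (h i).restrictedMMSFeasible⟩,
      exists_allocation hn (fun i => (h i).monotone) fun i => (h i).restrictedMMSFeasible⟩⟩
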